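/- **Lemma 6.3.** *Notation.* Let $G=\mathrm{PSL}(2,\mathbb R)$, $n[x]=\begin{pmatrix}1&x\\0&1\end{pmatrix}$, $a[y]=\begin{pmatrix}\sqrt y&0\\0&1/\sqrt y\end{pmatrix}$ $(y>0)$, $k[\theta]=\begin{pmatrix}\cos\theta&\sin\theta\\-\sin\theta&\cos\theta\end{pmatrix}$, $w=\begin{pmatrix}0&1\\-1&0\end{pmatrix}$, $e(x)=e^{2\pi ix}$, $d^\times u=du/|u|$. For $p\in\mathbb Z$ put $\phi_p(n[x]a[y]k[\theta],\nu)=y^{\nu+1/2}e^{2pi\theta}$. For a function $f$ on $G$ put $(\omega(h)f)(g)=f(gh)$, $$\mathcal A^{\delta}f(g)=\int_{-\infty}^{\infty}e(-\delta\xi)\,f(w\,n[\xi]\,g)\,d\xi\quad(\delta=\pm1),\qquad \mathcal Kf(u)=\mathcal A^{\mathrm{sgn}(u)}f(a[|u|])\quad(u\in\mathbb R^\times).$$ Put $$j_\nu(u)=\pi\frac{\sqrt{|u|}}{\sin\pi\nu}\left(J^{\mathrm{sgn}(u)}_{-2\nu}(4\pi\sqrt{|u|})-J^{\mathrm{sgn}(u)}_{2\nu}(4\pi\sqrt{|u|})\right),\qquad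 J^+_\nu=J_\nu,\ J^-_\nu=I_\nu .$$ Let $k\ge1$ be an integer and $\nu=k-\frac12$. For $\sigma=\pm1$ let $D_k^{\sigma}=\bigoplus_{p\in\mathbb Z,\ \sigma p\ge k}\mathbb C\,\phi_p$, $\phi_p=\phi_p(\cdot,k-\frac12)$, be the Hilbert space of formal sums $\phi=\sum c_p\phi_p$ with the norm $$\|\phi\|=\pi^{k-\frac12}\Big(\sum_{\sigma p\ge k}\frac{\Gamma(|p|-k+1)}{\Gamma(|p|+k)}|c_p|^2\Big)^{1/2}.$$ Thus $D_k=D_k^{+}$ is the holomorphic and $D_k^{-}$ the antiholomorphic discrete series. A vector $\phi=\sum c_p\phi_p$ is *smooth* if $c_p$ decays faster than every negative power of $|p|$. Put $\mathbb R_+=(0,\infty)$ and $\mathbb R_-=(-\infty,0)$. *Statement.* Let $\sigma=\pm1$. 1. For smooth $\phi\in D_k^\sigma$ the series $\phi(g)=\sum c_p\phi_p(g)$ and the integrals $\mathcal A^{\pm}\phi(g)$ converge absolutely for all $g\in G$, and $\mathcal K\phi(u)=0$ if $\sigma u<0$. 2. The operator $\mathcal K$, defined as above on smooth vectors, extends to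 a unitary map of $D_k^\sigma$ onto $L^2(\mathbb R_\sigma,\pi^{-1}d^\times)$; in particular $\mathcal K$ maps $D_k$ unitarily onto $L^2((0,\infty),\pi^{-1}d^\times)$. Right translation $\omega$ maps smooth vectors of $D_k^\sigma$ to smooth vectors of $D_k^\sigma$ and extends to a (strongly continuous) unitary representation of $G$ in $D_k^\sigma$; the operators $\mathcal K\omega(h)\mathcal K^{-1}$, $h\in G$, form an equivalent (strongly continuous) unitary representation of $G$ in $L^2(\mathbb R_\sigma,\pi^{-1}d^\times)$. 3. For every smooth $\phi\in D_k^\sigma$, all $u\in\mathbb R^\times$, $x\in\mathbb R$ and $y>0$, $$\mathcal K\omega(n[x])\phi(u)=e(ux)\,\mathcal K\phi(u),\qquad \mathcal K\omega(a[y])\phi(u)=\mathcal K\phi(uy),$$ $$\mathcal K\omega(w)\phi(u)=\int_{\mathbb R^\times}j_{k-\frac12}(u\lambda)\,\mathcal K\phi(\lambda)\,d^\times\lambda ,$$ where the last integral converges absolutely. Here $j_{k-\frac12}(u)=2\pi(-1)^k\sqrt u\,J_{2k-1}(4\pi\sqrt u)$ for $u>0$ and $j_{k-\frac12}(u)=0$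 for $u<0$. 4. Let $\iota$ be the involution $n\,a\,k\mapsto n^{-1}a\,k^{-1}$ of $G$ ($n=n[x]$, $a=a[y]$, $k=k[\theta]$). There is a unitary map of $D_k^{\sigma}$ onto $D_k^{-\sigma}$ that maps each smooth $\phi$ to a smooth vector whose function on $G$ is $\phi\circ\iota$, and $\mathcal K(\phi\circ\iota)(u)=\mathcal K\phi(-u)$ for smooth $\phi$ and $u\in\mathbb R^\times$. -/

import Mathlib

namespace Kirillov

open MeasureTheory

noncomputable section

/-- The group `SL(2, ℝ)`, used for coordinates on `PSL(2, ℝ)`. -/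
abbrev SL : Type := Matrix.SpecialLinearGroup (Fin 2) ℝ

/-- The group `G = PSL(2, ℝ)`, the quotient of `SL(2, ℝ)` by its center `{1, -1}`,
with the quotient topology. -/
abbrev G : Type := Matrix.ProjectiveSpecialLinearGroup (Fin 2) ℝ

/-- The element `[p, q; r, s]` of `SL(2, ℝ)`. -/
def sl (p q r s : ℝ) (h : p * s - q * r = 1) : SL :=
  ⟨!![p, q; r, s], by rw [Matrix.det_fin_two_of, h]⟩

theorem sl_eta (g : SL) : g = sl (g 0 0) (g 0 1) (g 1 0) (g 1 1) (by
    rw [← Matrix.det_fin_two, g.det_coe]) :=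
  Subtype.ext (Matrix.eta_fin_two _)

theorem sl_congr {p q r s p' q' r' s' : ℝ} {h : p * s - q * r = 1} {h' : p' * s' - q' * r' = 1}
    (h1 : p = p') (h2 : q = q') (h3 : r = r') (h4 : s = s') :
    sl p q r s h = sl p' q' r' s' h' := by
  subst h1 h2 h3 h4; rfl

theorem mul_apply_sl (g h : SL) (i j : Fin 2) : (g * h) i j = g i 0 * h 0 j + g i 1 * h 1 j := by
  rw [Matrix.SpecialLinearGroup.coe_mul, Matrix.mul_apply, Fin.sum_univ_two]

theorem sl_inv (p q r s : ℝ) (h : p * s - q * r = 1) :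
    (sl p q r s h)⁻¹ = sl s (-q) (-r) p (by linarith) :=
  Subtype.ext (by
    rw [Matrix.SpecialLinearGroup.coe_inv]
    exact Matrix.adjugate_fin_two_of p q r s)

/-- `n[x]` is the class of `[1, x; 0, 1]`. -/
def n (x : ℝ) : G := QuotientGroup.mk (sl 1 x 0 1 (by ring))

/-- `a[y]` is the class of `[√y, 0; 0, 1/√y]`, for `y > 0`. -/
def a (y : ℝ) (hy : 0 < y) : G :=
  QuotientGroup.mk (sl (√y) 0 0 (1 / √y) (by
    rw [mul_one_div_cancel (Real.sqrt_pos.2 hy).ne']; ring))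

/-- `k[θ]` is the class of `[cos θ, sin θ; -sin θ, cos θ]`. -/
def rot (θ : ℝ) : G :=
  QuotientGroup.mk (sl (Real.cos θ) (Real.sin θ) (-Real.sin θ) (Real.cos θ) (by
    linarith [Real.cos_sq_add_sin_sq θ, sq (Real.cos θ), sq (Real.sin θ)]))

/-- The Weyl element `w`, the class of `[0, 1; -1, 0]`. -/
def w : G := QuotientGroup.mk (sl 0 1 (-1) 0 (by ring))

/-- Elements of the center of `SL(2, ℝ)` are `1` and `-1`. -/
theorem mem_center {z : SL} (hz : z ∈ Subgroup.center SL) : z = 1 ∨ z = -1 := by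
  obtain ⟨r, hr, h⟩ := Matrix.SpecialLinearGroup.mem_center_iff.1 hz
  have h2 : r * r = 1 := by rw [← sq]; simpa using hr
  rcases mul_self_eq_one_iff.1 h2 with rfl | rfl
  · left; apply Subtype.ext; rw [← h]; simp
  · right; apply Subtype.ext; rw [← h]; ext i j; fin_cases i <;> fin_cases j <;> simp

/-- `φ_p(g, ν) = y ^ (ν + 1/2) * exp(2 p i θ)` as a function on `SL(2, ℝ)`: if the lower row of `g`
is `(c, d)`, then in `g = n[x] a[y] k[θ]` one has `y = 1 / (c² + d²)` and
`exp(i θ) = (d - i c) / |d - i c|`. -/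
def phiSL (ν : ℝ) (p : ℤ) (g : SL) : ℂ :=
  (((1 / (g 1 0 ^ 2 + g 1 1 ^ 2)) ^ (ν + 1 / 2) : ℝ) : ℂ) *
    (((g 1 1 : ℂ) - g 1 0 * Complex.I) / (‖(g 1 1 : ℂ) - g 1 0 * Complex.I‖ : ℂ)) ^ (2 * p)

theorem phiSL_neg (ν : ℝ) (p : ℤ) (g : SL) : phiSL ν p (-g) = phiSL ν p g := by
  have h1 : ((-g : SL) 1 0 : ℝ) = - g 1 0 := by simp
  have h2 : ((-g : SL) 1 1 : ℝ) = - g 1 1 := by simp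
  have h3 : ((-g 1 1 : ℝ) : ℂ) - (-g 1 0 : ℝ) * Complex.I
      = - ((g 1 1 : ℂ) - g 1 0 * Complex.I) := by push_cast; ring
  unfold phiSL
  rw [h1, h2, h3, norm_neg, neg_div, zpow_mul, zpow_mul, even_two.neg_zpow]
  simp

/-- The function `φ_p(g, ν)` on `G = PSL(2, ℝ)`. -/
def phi (ν : ℝ) (p : ℤ) (g : G) : ℂ :=
  Quotient.liftOn' g (phiSL ν p) (fun x y h => by
    rw [QuotientGroup.leftRel_apply] at h
    rcases mem_center h with h | h
    · rw [inv_mul_eq_one.1 h]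
    · rw [inv_mul_eq_iff_eq_mul.1 h, mul_neg, mul_one, phiSL_neg])

/-- In Iwasawa coordinates, `φ_p(n[x] a[y] k[θ], ν) = y ^ (ν + 1/2) * exp(2 p i θ)`. -/
theorem phi_iwasawa (ν : ℝ) (p : ℤ) (x y : ℝ) (hy : 0 < y) (θ : ℝ) :
    phi ν p (n x * a y hy * rot θ) =
      ((y ^ (ν + 1 / 2) : ℝ) : ℂ) * Complex.exp (2 * p * θ * Complex.I) := by
  have hs : 0 < √y := Real.sqrt_pos.2 hy
  have hs2 : √y ^ 2 = y := Real.sq_sqrt hy.le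
  change phiSL ν p (sl 1 x 0 1 _ * sl (√y) 0 0 (1 / √y) _ * sl (Real.cos θ) (Real.sin θ)
    (-Real.sin θ) (Real.cos θ) _) = _
  unfold phiSL
  simp only [mul_apply_sl]
  simp only [sl, Matrix.of_apply, Matrix.cons_val', Matrix.cons_val_zero, Matrix.cons_val_one,
    Matrix.cons_val_fin_one, zero_mul, mul_zero, zero_add, add_zero, one_mul, mul_neg]
  have e1 : (-(1 / √y * Real.sin θ)) ^ 2 + (1 / √y * Real.cos θ) ^ 2 = 1 / y := by
    have := Real.cos_sq_add_sin_sq θ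
    have h3 : (1 / √y) ^ 2 = 1 / y := by rw [div_pow, hs2, one_pow]
    calc _ = (1 / √y) ^ 2 * (Real.cos θ ^ 2 + Real.sin θ ^ 2) := by ring
      _ = _ := by rw [this, h3, mul_one]
  have e2 : ((1 / √y * Real.cos θ : ℝ) : ℂ) - ((-(1 / √y * Real.sin θ) : ℝ) : ℂ) * Complex.I
      = ((1 / √y : ℝ) : ℂ) * Complex.exp (θ * Complex.I) := by
    rw [Complex.exp_mul_I]; push_cast; ring
  have e3 : ((1 / √y : ℝ) : ℂ) ≠ 0 := by
    exact_mod_cast (one_div_pos.2 hs).ne'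
  rw [e1, e2, norm_mul, Complex.norm_exp_ofReal_mul_I, Complex.norm_real, Real.norm_eq_abs,
    abs_of_pos (one_div_pos.2 hs), mul_one, mul_div_cancel_left₀ _ e3, ← Complex.exp_int_mul,
    one_div_one_div]
  congr 2
  push_cast
  ring

/-- Right translation: `(ω(h) f)(g) = f(g h)`. -/
def rightTranslate (h : G) (f : G → ℂ) : G → ℂ := fun g => f (g * h)

/-- `e(x) = exp(2 π i x)`. -/
def e (x : ℝ) : ℂ := Complex.exp (2 * Real.pi * Complex.I * x)

/-- The integrand of the Jacquet operator. -/
def jacquetIntegrand (δ : ℝ) (f : G → ℂ) (g : G) (ξ : ℝ) : ℂ :=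
  e (-δ * ξ) * f (w * n ξ * g)

/-- The Jacquet operator: `(A^δ f)(g) = ∫ e(-δ ξ) f(w n[ξ] g) dξ`, for `δ = 1` or `-1`. -/
def jacquet (δ : ℝ) (f : G → ℂ) (g : G) : ℂ := ∫ ξ : ℝ, jacquetIntegrand δ f g ξ

/-- The Kirillov operator `(K f)(u) = (A^{sgn u} f)(a[|u|])`, `u ≠ 0` (and `0` at `u = 0`). -/
def kirillov (f : G → ℂ) (u : ℝ) : ℂ :=
  if hu : u ≠ 0 then jacquet (SignType.sign u : ℝ) f (a |u| (abs_pos.2 hu)) else 0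

/-- The measure `d^× u = du / |u|` on the line (the point `0` has measure zero). -/
def mulMeasure : Measure ℝ := volume.withDensity (fun u => ENNReal.ofReal (1 / |u|))

/-- The half-line `{u : 0 < σ u}` for a sign `σ`, that is `(0, ∞)` or `(-∞, 0)`. -/
def halfLine (σ : ℤˣ) : Set ℝ := {u | 0 < ((σ : ℤ) : ℝ) * u}

/-- The measure `π⁻¹ d^×` on the half-line of sign `σ`. -/
def halfMeasure (σ : ℤˣ) : Measure ℝ :=
  ENNReal.ofReal (1 / Real.pi) • mulMeasure.restrict (halfLine σ)

/-- The Hilbert space `L²((0, ∞), π⁻¹ d^×)` for `σ = 1`, and `L²((-∞, 0), π⁻¹ d^×)` for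
`σ = -1`. -/
abbrev L2Half (σ : ℤˣ) : Type := Lp ℂ 2 (halfMeasure σ)

/-- The Bessel function `J_ν(x)` of real order, `x > 0`. The terms in which `m + ν + 1` is a pole of
the Gamma function vanish, as they should. -/
def besselJ (ν x : ℝ) : ℝ :=
  ∑' m : ℕ, (-1) ^ m / (m.factorial * Real.Gamma (m + ν + 1)) * (x / 2) ^ (2 * m + ν)

/-- The modified Bessel function `I_ν(x)` of real order, `x > 0`. -/
def besselI (ν x : ℝ) : ℝ :=
  ∑' m : ℕ, 1 / (m.factorial * Real.Gamma (m + ν + 1)) * (x / 2) ^ (2 * m + ν)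

/-- `J^+_ν = J_ν` if `u > 0` and `J^-_ν = I_ν` if `u < 0`. -/
def besselSigned (u ν x : ℝ) : ℝ := if 0 < u then besselJ ν x else besselI ν x

/-- The Bessel function of the representation:
`j_ν(u) = π √|u| / sin(π ν) * (J^{sgn u}_{-2ν}(4π√|u|) - J^{sgn u}_{2ν}(4π√|u|))`. -/
def repBessel (ν u : ℝ) : ℝ :=
  Real.pi * √|u| / Real.sin (Real.pi * ν) *
    (besselSigned u (-2 * ν) (4 * Real.pi * √|u|) - besselSigned u (2 * ν) (4 * Real.pi * √|u|))

/-- The weights occurring in the discrete series of sign `σ`: the integers `p ≥ k` if `σ = 1`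
(holomorphic), and `p ≤ -k` if `σ = -1` (antiholomorphic). -/
abbrev Weight (k : ℕ) (σ : ℤˣ) : Type := {p : ℤ // (k : ℤ) ≤ σ * p}

/-- The squared norm of `φ_p`, namely `π ^ (2k - 1) Γ(|p| - k + 1) / Γ(|p| + k)`. -/
def normSqPhi (k : ℕ) (p : ℤ) : ℝ :=
  Real.pi ^ (2 * (k : ℝ) - 1) *
    (Real.Gamma (((|p| : ℤ) : ℝ) - k + 1) / Real.Gamma (((|p| : ℤ) : ℝ) + k))

theorem le_abs_weight {k : ℕ} {σ : ℤˣ} (p : Weight k σ) : (k : ℤ) ≤ |(p : ℤ)| := by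
  have h := p.2
  rcases Int.units_eq_one_or σ with hs | hs
  · have h1 : (k : ℤ) ≤ (p : ℤ) := by simpa [hs] using h
    exact h1.trans (le_abs_self _)
  · have h1 : (k : ℤ) ≤ -(p : ℤ) := by simpa [hs] using h
    exact h1.trans (neg_le_abs _)

theorem normSqPhi_pos {k : ℕ} [NeZero k] {σ : ℤˣ} (p : Weight k σ) : 0 < normSqPhi k p := by
  have h1 : (k : ℝ) ≤ ((|(p : ℤ)| : ℤ) : ℝ) := by exact_mod_cast le_abs_weight p
  have h2 : (0 : ℝ) < k := by exact_mod_cast Nat.pos_of_ne_zero (NeZero.ne k)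
  unfold normSqPhi
  have := Real.Gamma_pos_of_pos (show (0 : ℝ) < ((|(p : ℤ)| : ℤ) : ℝ) - k + 1 by linarith)
  have := Real.Gamma_pos_of_pos (show (0 : ℝ) < ((|(p : ℤ)| : ℤ) : ℝ) + k by linarith)
  have := Real.rpow_pos_of_pos Real.pi_pos (2 * (k : ℝ) - 1)
  positivity

/-- The line `ℂ φ_p`; the number `c : ℂ` stands for the vector `c φ_p`. Its norm is `|c|` times
the norm of `φ_p`. -/
def Line (k : ℕ) (σ : ℤˣ) (_p : Weight k σ) : Type := ℂ

instance (k : ℕ) (σ : ℤˣ) (p : Weight k σ) : AddCommGroup (Line k σ p) :=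
  inferInstanceAs (AddCommGroup ℂ)

instance (k : ℕ) (σ : ℤˣ) (p : Weight k σ) : Module ℂ (Line k σ p) :=
  inferInstanceAs (Module ℂ ℂ)

/-- The number `c` of the vector `c φ_p`. -/
def Line.val {k : ℕ} {σ : ℤˣ} {p : Weight k σ} (v : Line k σ p) : ℂ := v

/-- The inner product on the line `ℂ φ_p` (linear in the second argument). -/
@[reducible]
def lineCore (k : ℕ) [NeZero k] (σ : ℤˣ) (p : Weight k σ) :
    InnerProductSpace.Core ℂ (Line k σ p) where
  inner x y := (normSqPhi k p : ℂ) * (starRingEnd ℂ x.val * y.val)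
  conj_inner_symm x y := by
    simp only [map_mul, Complex.conj_ofReal, Complex.conj_conj]
    ring
  re_inner_nonneg x := by
    rw [← Complex.normSq_eq_conj_mul_self, ← Complex.ofReal_mul]
    exact mul_nonneg (normSqPhi_pos p).le (Complex.normSq_nonneg _)
  add_left x y z := by
    have h : (x + y).val = x.val + y.val := rfl
    rw [h, map_add]; ring
  smul_left x y r := by
    have h : (r • x).val = r * x.val := rfl
    rw [h, map_mul]; ring
  definite x h := by
    have hp : (normSqPhi k p : ℂ) ≠ 0 := by exact_mod_cast (normSqPhi_pos p).ne'
    have h1 := (mul_eq_zero.1 h).resolve_left hp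
    rcases mul_eq_zero.1 h1 with h2 | h2
    · exact (map_eq_zero (starRingEnd ℂ)).1 h2
    · exact h2

instance (k : ℕ) [NeZero k] (σ : ℤˣ) (p : Weight k σ) : NormedAddCommGroup (Line k σ p) :=
  (lineCore k σ p).toNormedAddCommGroup

instance (k : ℕ) [NeZero k] (σ : ℤˣ) (p : Weight k σ) : InnerProductSpace ℂ (Line k σ p) :=
  InnerProductSpace.ofCore (lineCore k σ p).toCore

instance (k : ℕ) (σ : ℤˣ) (p : Weight k σ) : FiniteDimensional ℂ (Line k σ p) :=
  inferInstanceAs (FiniteDimensional ℂ ℂ)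

instance (k : ℕ) [NeZero k] (σ : ℤˣ) (p : Weight k σ) : CompleteSpace (Line k σ p) :=
  FiniteDimensional.complete ℂ _

/-- The Hilbert space `D_k`, the Hilbert direct sum of the lines `ℂ φ_p`, `p ≥ k`, for `σ = 1`;
for `σ = -1` it is its antiholomorphic analogue, the Hilbert direct sum of the lines `ℂ φ_p`,
`p ≤ -k`. -/
abbrev D (k : ℕ) [NeZero k] (σ : ℤˣ) : Type := lp (Line k σ) 2

/-- The coefficient `c_p` of `φ = ∑ c_p φ_p`. -/
def coeff {k : ℕ} [NeZero k] {σ : ℤˣ} (φ : D k σ) (p : Weight k σ) : ℂ := (φ p).val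

/-- The norm of the Hilbert space is the weighted norm
`π ^ (k - 1/2) (∑ Γ(|p| - k + 1) / Γ(|p| + k) |c_p|²) ^ (1/2)`. -/
theorem norm_sq_eq {k : ℕ} [NeZero k] {σ : ℤˣ} (φ : D k σ) :
    ‖φ‖ ^ 2 = Real.pi ^ (2 * (k : ℝ) - 1) * ∑' p : Weight k σ,
      Real.Gamma (((|(p : ℤ)| : ℤ) : ℝ) - k + 1) / Real.Gamma (((|(p : ℤ)| : ℤ) : ℝ) + k) *
        ‖coeff φ p‖ ^ 2 := by
  have h1 : ‖φ‖ ^ 2 = ∑' p : Weight k σ, ‖φ p‖ ^ 2 := by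
    have := lp.norm_rpow_eq_tsum (p := 2) (by norm_num) φ
    simpa using this
  rw [h1, ← tsum_mul_left]
  refine tsum_congr fun p => ?_
  have h2 : ‖φ p‖ ^ 2 = RCLike.re (inner ℂ (φ p) (φ p)) := (inner_self_eq_norm_sq (𝕜 := ℂ) _).symm
  have h3 : inner ℂ (φ p) (φ p) =
      (normSqPhi k p : ℂ) * (starRingEnd ℂ (coeff φ p) * coeff φ p) := rfl
  rw [h2, h3, ← Complex.normSq_eq_conj_mul_self, ← Complex.ofReal_mul, RCLike.re_to_complex,
    Complex.ofReal_re, Complex.normSq_eq_norm_sq, normSqPhi, mul_assoc]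

/-- `φ = ∑ c_p φ_p` is smooth if `c_p` decays faster than any negative power of `|p|`. -/
def IsSmooth {k : ℕ} [NeZero k] {σ : ℤˣ} (φ : D k σ) : Prop :=
  ∀ N : ℕ, ∃ C : ℝ, ∀ p : Weight k σ, ‖coeff φ p‖ * |((p : ℤ) : ℝ)| ^ N ≤ C

/-- The term `c_p φ_p(g, k - 1/2)` of the series of `φ`. -/
def term {k : ℕ} [NeZero k] {σ : ℤˣ} (φ : D k σ) (g : G) (p : Weight k σ) : ℂ :=
  coeff φ p * phi ((k : ℝ) - 1 / 2) p g

/-- The function `φ(g) = ∑ c_p φ_p(g, k - 1/2)` on `G`. -/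
def toFun {k : ℕ} [NeZero k] {σ : ℤˣ} (φ : D k σ) (g : G) : ℂ := ∑' p, term φ g p

/-- Conjugation of `SL(2, ℝ)` by `diag(1, -1)`. -/
def involutionSL : SL →* SL where
  toFun g := sl (g 0 0) (-g 0 1) (-g 1 0) (g 1 1) (by
    rw [neg_mul_neg, ← Matrix.det_fin_two, g.det_coe])
  map_one' := by
    conv_rhs => rw [sl_eta 1]
    apply sl_congr <;> simp
  map_mul' g h := by
    rw [sl_eta (sl _ _ _ _ _ * sl _ _ _ _ _)]
    apply sl_congr <;> simp only [mul_apply_sl] <;>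
      simp only [sl, Matrix.of_apply, Matrix.cons_val', Matrix.cons_val_zero, Matrix.cons_val_one,
        Matrix.cons_val_fin_one] <;> ring

theorem involutionSL_sl (p q r s : ℝ) (h : p * s - q * r = 1) :
    involutionSL (sl p q r s h) = sl p (-q) (-r) s (by linarith) := rfl

/-- The involution `n[x] a[y] k[θ] ↦ n[x]⁻¹ a[y] k[θ]⁻¹` of `G`. -/
def involution : G →* G :=
  QuotientGroup.map _ _ involutionSL (by
    intro z hz
    have h : involutionSL z = z := by
      rcases mem_center hz with rfl | rfl
      · exact map_one _
      · rw [sl_eta (-1), involutionSL_sl]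
        apply sl_congr <;> simp
    rw [Subgroup.mem_comap, h]
    exact hz)

theorem involution_iwasawa (x y : ℝ) (hy : 0 < y) (θ : ℝ) :
    involution (n x * a y hy * rot θ) = (n x)⁻¹ * a y hy * (rot θ)⁻¹ := by
  rw [map_mul, map_mul]
  congr 1
  · congr 1
    · refine congrArg QuotientGroup.mk (?_ : _ = (sl _ _ _ _ _)⁻¹)
      rw [sl_inv, involutionSL_sl]
    · refine congrArg QuotientGroup.mk ?_
      rw [involutionSL_sl]
      apply sl_congr <;> simp
  · refine congrArg QuotientGroup.mk (?_ : _ = (sl _ _ _ _ _)⁻¹)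
    rw [sl_inv, involutionSL_sl]

end

end Kirillov

open Kirillov

namespace Kirillov
open MeasureTheory

/-! Let `(c, d)` be the lower row of `g` and `ζ = d + σ i c`. For `p = σ (k + n)` one has `φ_p(g) =
ζ^(-2k) (ζ̄/ζ)^n`, for both signs `σ`. A smooth vector is thus `ζ^(-2k)` times a power series with
rapidly decaying coefficients, evaluated on the unit circle at `ζ̄/ζ`. Right translation becomes the
weight `2k` action of Moebius maps of the disc. Rapid decay of coefficients is equivalent to
boundedness of all derivatives on the open disc, a property that these maps preserve; hence
translates of smooth vectors are smooth (`IsSmooth.exists_rightTranslate`).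

Substituting `ξ = σ |u| t` in the Jacquet integral shows that `K φ(u)` is `|u|^(1-k)` times the
Fourier transform at `σ u` of the boundary function on the real line (`kirillov_toFun`). For `φ_p`
this boundary function is `((t-i)/(t+i))^n (t+i)^(-2k)`. Its Fourier transform vanishes on the
negative half-line and is a Laguerre function on the positive one (`fourier_cayleyPow`). That gives
the support of `K φ`. Laguerre orthogonality gives exactly the norms of the `φ_p`, so `K` extends to
an isometry.

The isometry is onto: a vector orthogonal to its range is orthogonal to `e(ux) K φ_p(u)` for all
`x`, where `φ_p` has the lowest `|p|`. Since this `K φ_p` has no zero on the half-line, injectivity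
of the Fourier transform makes the vector zero (`kirillovIsometry_surjective`).

The formulas for `n[x]` and `a[y]` are changes of variable. The element `w` multiplies `φ_p` by
`(-1)^p`, and Laguerre functions are eigenfunctions of the Hankel transform with eigenvalues
`(-1)^n` (`integral_besselClifford_mul_laguerre`). So the formula for `w` holds on each `φ_p`;
polynomial bounds in `n` against rapid decay permit summation.

The three kinds of generators preserve the norm, so right translation extends by density to unitary
operators. Strong continuity follows from continuity of diagonal matrix coefficients. The involution
only replaces `c` by `-c`, that is, `σ` by `-σ`. -/

noncomputable section

/-! ### Laguerre polynomials: binomial sums and orthogonality -/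

section

-- `(N + α + j).choose N` is the coefficient of `X ^ N` in `(1 + X) ^ (N + α + j)`, and the binomial
-- theorem sums these over `j`. The case `a = -1` yields orthogonality, the case `a = -2` the Hankel
-- eigenfunction property.
open Polynomial in
theorem sum_choose_mul_pow_mul_choose (n N α : ℕ) (a : ℝ) :
    ∑ j ∈ Finset.range (n + 1), (n.choose j : ℝ) * a ^ j * ((N + α + j).choose N : ℝ) =
      ((1 + X : ℝ[X]) ^ (N + α) * (C a * (1 + X) + 1) ^ n).coeff N := by
  rw [add_pow (C a * (1 + X)), Finset.mul_sum, finsetSum_coeff]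
  refine Finset.sum_congr rfl fun j _ => ?_
  have : (1 + X : ℝ[X]) ^ (N + α) * ((C a * (1 + X)) ^ j * 1 ^ (n - j) * (n.choose j : ℝ[X])) =
      C ((n.choose j : ℝ) * a ^ j) * (1 + X) ^ (N + α + j) := by
    simp only [mul_pow, one_pow, map_mul, map_pow, map_natCast]
    ring
  rw [this, coeff_C_mul, coeff_one_add_X_pow]

/-- At `a = -1` the `n`-th power in the generating polynomial collapses to `(-X) ^ n`, which leaves
nothing in degrees below `n`. -/
theorem sum_choose_neg_one (n N α : ℕ) (h : N ≤ n) :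
    ∑ j ∈ Finset.range (n + 1), (n.choose j : ℝ) * (-1) ^ j * ((N + α + j).choose N : ℝ) =
      if N = n then (-1) ^ n else 0 := by
  rw [sum_choose_mul_pow_mul_choose]
  have : (Polynomial.C (-1 : ℝ) * (1 + Polynomial.X) + 1) ^ n =
      Polynomial.C ((-1) ^ n) * Polynomial.X ^ n := by
    rw [map_pow, ← mul_pow]
    congr 1
    simp only [map_neg, map_one]
    ring
  rw [this, mul_left_comm, Polynomial.coeff_C_mul, Polynomial.coeff_mul_X_pow']
  rcases h.eq_or_lt with rfl | h
  · simp [Polynomial.coeff_zero_eq_eval_zero]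
  · rw [if_neg (by omega), if_neg (by omega), mul_zero]

/-- At `a = -2` the base of the `n`-th power is `-(2 X + 1)`; a second binomial expansion produces
the other side. -/
theorem sum_choose_neg_two (n N α : ℕ) :
    ∑ j ∈ Finset.range (n + 1), (n.choose j : ℝ) * (-2) ^ j * ((N + α + j).choose N : ℝ) =
      (-1) ^ n * ∑ j ∈ Finset.range (n + 1),
        (n.choose j : ℝ) * 2 ^ j * (if j ≤ N then ((N + α).choose (N - j) : ℝ) else 0) := by
  rw [sum_choose_mul_pow_mul_choose]
  have : (Polynomial.C (-2 : ℝ) * (1 + Polynomial.X) + 1) ^ n =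
      Polynomial.C ((-1) ^ n) * (Polynomial.C 2 * Polynomial.X + 1) ^ n := by
    rw [map_pow, ← mul_pow]
    congr 1
    have h2 : (Polynomial.C (2 : ℝ)) = 2 := rfl
    simp only [map_neg, map_one, h2]
    ring
  rw [this, mul_left_comm, Polynomial.coeff_C_mul,
    add_pow (Polynomial.C 2 * Polynomial.X), Finset.mul_sum, Polynomial.finsetSum_coeff]
  congr 1
  refine Finset.sum_congr rfl fun j _ => ?_
  have : (1 + Polynomial.X : Polynomial ℝ) ^ (N + α) *
      ((Polynomial.C 2 * Polynomial.X) ^ j * 1 ^ (n - j) * (n.choose j : Polynomial ℝ)) =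
      Polynomial.C ((n.choose j : ℝ) * 2 ^ j) *
        ((1 + Polynomial.X) ^ (N + α) * Polynomial.X ^ j) := by
    simp only [mul_pow, one_pow, map_mul, map_pow, map_natCast]
    ring
  rw [this, Polynomial.coeff_C_mul, Polynomial.coeff_mul_X_pow']
  simp only [Polynomial.coeff_one_add_X_pow]

/-- A multiple of the Laguerre polynomial `L_n^{(α)}`, namely `n! / (n + α)!` times it. -/
def laguerre (α n : ℕ) (x : ℝ) : ℝ :=
  ∑ j ∈ Finset.range (n + 1), (n.choose j : ℝ) * (-1) ^ j / ((α + j).factorial : ℝ) * x ^ j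

theorem integral_pow_mul_exp_neg_mul (m : ℕ) {r : ℝ} (hr : 0 < r) :
    ∫ x in Set.Ioi (0 : ℝ), x ^ m * Real.exp (-(r * x)) = m.factorial / r ^ (m + 1) := by
  have := Real.integral_rpow_mul_exp_neg_mul_Ioi (a := m + 1) (r := r) (by positivity) hr
  simp only [add_sub_cancel_right, Real.rpow_natCast] at this
  rw [this, Real.Gamma_nat_eq_factorial, one_div, show ((m : ℝ) + 1) = ((m + 1 : ℕ) : ℝ) by simp,
    Real.rpow_natCast, inv_pow]
  field_simp

theorem integrableOn_pow_mul_exp_neg_mul (m : ℕ) {r : ℝ} (hr : 0 < r) :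
    IntegrableOn (fun x : ℝ => x ^ m * Real.exp (-(r * x))) (Set.Ioi 0) := by
  by_contra h
  have h1 := integral_pow_mul_exp_neg_mul m hr
  -- An integral that does not converge is 0 by convention, against the positive value in `h1`.
  rw [integral_undef h] at h1
  have : (0 : ℝ) < m.factorial / r ^ (m + 1) := by positivity
  linarith

theorem sum_choose_mul_factorial_div (n N α : ℕ) (a : ℝ) :
    ∑ j ∈ Finset.range (n + 1),
      (n.choose j : ℝ) * a ^ j / ((α + j).factorial : ℝ) * ((N + α + j).factorial : ℝ) =
    N.factorial * ∑ j ∈ Finset.range (n + 1),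
      (n.choose j : ℝ) * a ^ j * ((N + α + j).choose N : ℝ) := by
  rw [Finset.mul_sum]
  refine Finset.sum_congr rfl fun j _ => ?_
  have := Nat.add_choose_mul_factorial_mul_factorial N (α + j)
  rw [← Nat.choose_symm_add, ← add_assoc] at this
  have h2 : ((N + α + j).choose N : ℝ) * N.factorial * (α + j).factorial =
    (N + α + j).factorial := by exact_mod_cast this
  rw [← h2]
  field_simp

theorem integral_pow_mul_laguerre (α n N : ℕ) (h : N ≤ n) :
    ∫ x in Set.Ioi (0 : ℝ), x ^ (N + α) * Real.exp (-(1 * x)) * laguerre α n x =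
      if N = n then (-1) ^ n * (n.factorial : ℝ) else 0 := by
  have h1 : ∀ x : ℝ, x ^ (N + α) * Real.exp (-(1 * x)) * laguerre α n x =
      ∑ j ∈ Finset.range (n + 1), (n.choose j : ℝ) * (-1) ^ j / ((α + j).factorial : ℝ) *
        (x ^ (N + α + j) * Real.exp (-(1 * x))) := by
    intro x
    rw [laguerre, Finset.mul_sum]
    refine Finset.sum_congr rfl fun j _ => ?_
    ring
  simp only [h1]
  rw [integral_finsetSum _ fun j _ =>
    (integrableOn_pow_mul_exp_neg_mul _ one_pos).const_mul _]
  simp only [integral_const_mul, integral_pow_mul_exp_neg_mul _ one_pos, one_pow, div_one]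
  rw [sum_choose_mul_factorial_div, sum_choose_neg_one n N α h]
  split_ifs with h
  · rw [h, mul_comm]
  · rw [mul_zero]

theorem integrableOn_pow_mul_laguerre (α n N : ℕ) :
    IntegrableOn (fun x => x ^ N * Real.exp (-(1 * x)) * laguerre α n x) (Set.Ioi 0) := by
  have h1 : ∀ x : ℝ, x ^ N * Real.exp (-(1 * x)) * laguerre α n x =
      ∑ j ∈ Finset.range (n + 1), (n.choose j : ℝ) * (-1) ^ j / ((α + j).factorial : ℝ) *
        (x ^ (N + j) * Real.exp (-(1 * x))) := by
    intro x
    rw [laguerre, Finset.mul_sum]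
    refine Finset.sum_congr rfl fun j _ => ?_
    ring
  simp only [h1]
  exact integrable_finsetSum _ fun j _ =>
    (integrableOn_pow_mul_exp_neg_mul _ one_pos).const_mul _

/-- Expand the polynomial of lower degree in monomials: the one of degree `n` is orthogonal to all
smaller powers, so only the leading term, present when `m = n`, contributes. -/
theorem integral_laguerre_mul_laguerre_of_le (α m n : ℕ) (h : m ≤ n) :
    ∫ x in Set.Ioi (0 : ℝ), x ^ α * Real.exp (-x) * (laguerre α m x * laguerre α n x) =
      if m = n then (n.factorial : ℝ) / (α + n).factorial else 0 := by
  have h1 : ∀ x : ℝ, x ^ α * Real.exp (-x) * (laguerre α m x * laguerre α n x) =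
      ∑ i ∈ Finset.range (m + 1), (m.choose i : ℝ) * (-1) ^ i / ((α + i).factorial : ℝ) *
        (x ^ (i + α) * Real.exp (-(1 * x)) * laguerre α n x) := by
    intro x
    rw [← mul_assoc, mul_comm (x ^ α * _), laguerre, Finset.sum_mul, Finset.sum_mul]
    refine Finset.sum_congr rfl fun j _ => ?_
    rw [one_mul]
    ring
  simp only [h1]
  rw [integral_finsetSum _ fun j _ => (integrableOn_pow_mul_laguerre _ _ _).const_mul _]
  simp only [integral_const_mul]
  rw [Finset.sum_congr rfl fun i hi => by
    rw [integral_pow_mul_laguerre α n i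
      ((Nat.lt_succ_iff.1 (Finset.mem_range.1 hi)).trans h), mul_ite, mul_zero]]
  rw [Finset.sum_ite_eq']
  rcases h.eq_or_lt with rfl | h
  · rw [if_pos (by simp), if_pos rfl, Nat.choose_self]
    have : ((-1 : ℝ) ^ m) * (-1) ^ m = 1 := by rw [← mul_pow]; simp
    calc _ = ((-1 : ℝ) ^ m * (-1) ^ m) * m.factorial / (α + m).factorial := by push_cast; ring
      _ = _ := by rw [this, one_mul]
  · rw [if_neg (by simp; omega), if_neg (by omega)]

theorem integral_laguerre_mul_laguerre (α m n : ℕ) :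
    ∫ x in Set.Ioi (0 : ℝ), x ^ α * Real.exp (-x) * (laguerre α m x * laguerre α n x) =
      if m = n then (n.factorial : ℝ) / (α + n).factorial else 0 := by
  rcases le_total m n with h | h
  · exact integral_laguerre_mul_laguerre_of_le α m n h
  · have := integral_laguerre_mul_laguerre_of_le α n m h
    simp only [mul_comm (laguerre α n _)] at this
    rw [this]
    by_cases hmn : m = n
    · rw [hmn]
    · rw [if_neg hmn, if_neg (Ne.symm hmn)]

theorem integrableOn_laguerre_mul_laguerre (α m n : ℕ) :
    IntegrableOn (fun x => x ^ α * Real.exp (-x) * (laguerre α m x * laguerre α n x))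
      (Set.Ioi 0) := by
  have h1 : ∀ x : ℝ, x ^ α * Real.exp (-x) * (laguerre α m x * laguerre α n x) =
      ∑ i ∈ Finset.range (m + 1), (m.choose i : ℝ) * (-1) ^ i / ((α + i).factorial : ℝ) *
        (x ^ (i + α) * Real.exp (-(1 * x)) * laguerre α n x) := by
    intro x
    rw [← mul_assoc, mul_comm (x ^ α * _), laguerre, Finset.sum_mul, Finset.sum_mul]
    refine Finset.sum_congr rfl fun j _ => ?_
    rw [one_mul]
    ring
  simp only [h1]
  exact integrable_finsetSum _ fun j _ => (integrableOn_pow_mul_laguerre _ _ _).const_mul _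

end

/-! ### Power series on the disc with rapidly decaying coefficients -/

section

/-- Sequences that decay faster than every negative power of the index. -/
def RapidDecay (c : ℕ → ℂ) : Prop :=
  ∀ N : ℕ, ∃ C : ℝ, ∀ n : ℕ, ‖c n‖ * ((n : ℝ) + 1) ^ N ≤ C

theorem RapidDecay.summable_mul_pow {c : ℕ → ℂ} (hc : RapidDecay c) (N : ℕ) :
    Summable fun n : ℕ => ‖c n‖ * ((n : ℝ) + 1) ^ N := by
  -- Two extra powers leave room for comparison with the series of inverse squares.
  obtain ⟨C, hC⟩ := hc (N + 2)
  have h1 : Summable fun n : ℕ => C * (1 / ((n + 1 : ℕ) : ℝ) ^ 2) :=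
    ((summable_nat_add_iff 1).2 (Real.summable_one_div_nat_pow.2 one_lt_two)).mul_left C
  refine Summable.of_nonneg_of_le (fun n => by positivity) (fun n => ?_) h1
  rw [mul_one_div, le_div_iff₀ (by positivity)]
  refine le_trans (le_of_eq ?_) (hC n)
  push_cast
  ring

theorem RapidDecay.summable_norm {c : ℕ → ℂ} (hc : RapidDecay c) : Summable fun n => ‖c n‖ := by
  simpa using hc.summable_mul_pow 0

theorem RapidDecay.succ {c : ℕ → ℂ} (hc : RapidDecay c) :
    RapidDecay fun n => ((n : ℂ) + 1) * c (n + 1) := by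
  intro N
  obtain ⟨C, hC⟩ := hc (N + 1)
  refine ⟨C, fun n => le_trans ?_ (hC (n + 1))⟩
  have h : ‖(n : ℂ) + 1‖ = (n : ℝ) + 1 := by
    rw [show (n : ℂ) + 1 = ((n + 1 : ℕ) : ℂ) by push_cast; rfl, Complex.norm_natCast]
    push_cast; rfl
  rw [norm_mul, h]
  have h2 : ((n : ℝ) + 1) ^ (N + 1) ≤ (((n + 1 : ℕ) : ℝ) + 1) ^ (N + 1) := by
    push_cast; gcongr; linarith
  calc _ = ‖c (n + 1)‖ * ((n : ℝ) + 1) ^ (N + 1) := by ring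
    _ ≤ _ := by gcongr

/-- The sum of the power series with coefficients `c`. -/
def powerSum (c : ℕ → ℂ) (z : ℂ) : ℂ := ∑' n, c n * z ^ n

theorem norm_mul_pow_le {c : ℂ} {z : ℂ} (hz : ‖z‖ ≤ 1) (n : ℕ) : ‖c * z ^ n‖ ≤ ‖c‖ := by
  rw [norm_mul, norm_pow]
  exact mul_le_of_le_one_right (norm_nonneg _) (pow_le_one₀ (norm_nonneg _) hz)

theorem RapidDecay.summable {c : ℕ → ℂ} (hc : RapidDecay c) {z : ℂ} (hz : ‖z‖ ≤ 1) :
    Summable fun n => c n * z ^ n :=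
  Summable.of_norm_bounded hc.summable_norm fun n => norm_mul_pow_le hz n

theorem RapidDecay.norm_powerSum_le {c : ℕ → ℂ} (hc : RapidDecay c) {z : ℂ} (hz : ‖z‖ ≤ 1) :
    ‖powerSum c z‖ ≤ ∑' n, ‖c n‖ :=
  tsum_of_norm_bounded hc.summable_norm.hasSum fun n => norm_mul_pow_le hz n

theorem RapidDecay.continuousOn_powerSum {c : ℕ → ℂ} (hc : RapidDecay c) :
    ContinuousOn (powerSum c) (Metric.closedBall 0 1) :=
  continuousOn_tsum (fun n => by fun_prop) hc.summable_norm
    fun n z hz => norm_mul_pow_le (by simpa using hz) n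

theorem RapidDecay.hasDerivAt_powerSum {c : ℕ → ℂ} (hc : RapidDecay c) {z : ℂ}
    (hz : z ∈ Metric.ball (0 : ℂ) 1) :
    HasDerivAt (powerSum c) (powerSum (fun n => ((n : ℂ) + 1) * c (n + 1)) z) z := by
  have h1 : HasDerivAt (powerSum c) (∑' n, c n * (n * z ^ (n - 1))) z := by
    refine hasDerivAt_tsum_of_isPreconnected (t := Metric.ball (0 : ℂ) 1)
      (hc.summable_mul_pow 1) Metric.isOpen_ball (convex_ball _ _).isPreconnected
      (fun n y _ => (hasDerivAt_pow n y).const_mul (c n)) (fun n y hy => ?_)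
      (Metric.mem_ball_self one_pos) (hc.summable (by simp)) hz
    rw [← mul_assoc]
    refine (norm_mul_pow_le (by simpa using (Metric.mem_ball.1 hy).le) _).trans ?_
    rw [norm_mul, Complex.norm_natCast, pow_one]
    gcongr
    linarith
  convert h1 using 1
  have h2 : Summable fun n => c n * (n * z ^ (n - 1)) := by
    refine Summable.of_norm_bounded (hc.summable_mul_pow 1) fun n => ?_
    rw [← mul_assoc]
    refine (norm_mul_pow_le (by simpa using (Metric.mem_ball.1 hz).le) _).trans ?_
    rw [norm_mul, Complex.norm_natCast, pow_one]
    gcongr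
    linarith
  rw [h2.tsum_eq_zero_add]
  simp only [Nat.cast_zero, zero_mul, mul_zero, zero_add, powerSum]
  refine tsum_congr fun n => ?_
  push_cast
  ring

/-- On the open unit disc, `F` has `m` complex derivatives, all of them bounded. -/
def BoundedDerivs : ℕ → (ℂ → ℂ) → Prop
  | 0, F => ∃ C : ℝ, ∀ z ∈ Metric.ball (0 : ℂ) 1, ‖F z‖ ≤ C
  | m + 1, F => (∃ C : ℝ, ∀ z ∈ Metric.ball (0 : ℂ) 1, ‖F z‖ ≤ C) ∧
      ∃ F' : ℂ → ℂ, (∀ z ∈ Metric.ball (0 : ℂ) 1, HasDerivAt F (F' z) z) ∧ BoundedDerivs m F'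

theorem BoundedDerivs.bounded {m : ℕ} {F : ℂ → ℂ} (h : BoundedDerivs m F) :
    ∃ C : ℝ, ∀ z ∈ Metric.ball (0 : ℂ) 1, ‖F z‖ ≤ C := by
  cases m with
  | zero => exact h
  | succ m => exact h.1

theorem BoundedDerivs.of_succ {m : ℕ} {F : ℂ → ℂ} (h : BoundedDerivs (m + 1) F) :
    BoundedDerivs m F := by
  induction m generalizing F with
  | zero => exact h.1
  | succ m ih =>
    obtain ⟨hb, F', hF', h'⟩ := h
    exact ⟨hb, F', hF', ih h'⟩

theorem BoundedDerivs.add {m : ℕ} {F H : ℂ → ℂ} (hF : BoundedDerivs m F)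
    (hH : BoundedDerivs m H) : BoundedDerivs m fun z => F z + H z := by
  have hb : ∃ C : ℝ, ∀ z ∈ Metric.ball (0 : ℂ) 1, ‖F z + H z‖ ≤ C := by
    obtain ⟨A, hA⟩ := hF.bounded
    obtain ⟨B, hB⟩ := hH.bounded
    exact ⟨A + B, fun z hz => (norm_add_le _ _).trans (add_le_add (hA z hz) (hB z hz))⟩
  induction m generalizing F H with
  | zero => exact hb
  | succ m ih =>
    obtain ⟨-, F', hF', h1⟩ := hF
    obtain ⟨-, H', hH', h2⟩ := hH
    refine ⟨hb, fun z => F' z + H' z, fun z hz => (hF' z hz).add (hH' z hz), ih h1 h2 ?_⟩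
    obtain ⟨A, hA⟩ := h1.bounded
    obtain ⟨B, hB⟩ := h2.bounded
    exact ⟨A + B, fun z hz => (norm_add_le _ _).trans (add_le_add (hA z hz) (hB z hz))⟩

theorem BoundedDerivs.mul {m : ℕ} {F H : ℂ → ℂ} (hF : BoundedDerivs m F)
    (hH : BoundedDerivs m H) : BoundedDerivs m fun z => F z * H z := by
  have hb : ∃ C : ℝ, ∀ z ∈ Metric.ball (0 : ℂ) 1, ‖F z * H z‖ ≤ C := by
    obtain ⟨A, hA⟩ := hF.bounded
    obtain ⟨B, hB⟩ := hH.bounded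
    refine ⟨A * B, fun z hz => (norm_mul_le _ _).trans ?_⟩
    exact mul_le_mul (hA z hz) (hB z hz) (norm_nonneg _) ((norm_nonneg _).trans (hA z hz))
  induction m generalizing F H with
  | zero => exact hb
  | succ m ih =>
    have hF0 := hF.of_succ
    have hH0 := hH.of_succ
    obtain ⟨-, F', hF', h1⟩ := hF
    obtain ⟨-, H', hH', h2⟩ := hH
    have key : ∀ {A B : ℂ → ℂ}, BoundedDerivs m A → BoundedDerivs m B →
        ∃ C : ℝ, ∀ z ∈ Metric.ball (0 : ℂ) 1, ‖A z * B z‖ ≤ C := by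
      intro A B hA hB
      obtain ⟨a, ha⟩ := hA.bounded
      obtain ⟨b, hb⟩ := hB.bounded
      refine ⟨a * b, fun z hz => (norm_mul_le _ _).trans ?_⟩
      exact mul_le_mul (ha z hz) (hb z hz) (norm_nonneg _) ((norm_nonneg _).trans (ha z hz))
    exact ⟨hb, fun z => F' z * H z + F z * H' z, fun z hz => (hF' z hz).mul (hH' z hz),
      (ih h1 hH0 (key h1 hH0)).add (ih hF0 h2 (key hF0 h2))⟩

theorem BoundedDerivs.const_mul {m : ℕ} {F : ℂ → ℂ} (hF : BoundedDerivs m F) (a : ℂ) :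
    BoundedDerivs m fun z => a * F z := by
  refine BoundedDerivs.mul (F := fun _ => a) ?_ hF
  clear hF
  induction m generalizing a with
  | zero => exact ⟨‖a‖, fun _ _ => le_rfl⟩
  | succ m ih => exact ⟨⟨‖a‖, fun _ _ => le_rfl⟩, fun _ => 0, fun z _ => hasDerivAt_const z a, ih 0⟩

theorem RapidDecay.boundedDerivs {c : ℕ → ℂ} (hc : RapidDecay c) (m : ℕ) :
    BoundedDerivs m (powerSum c) := by
  have hb : ∀ {c : ℕ → ℂ}, RapidDecay c →
      ∃ C : ℝ, ∀ z ∈ Metric.ball (0 : ℂ) 1, ‖powerSum c z‖ ≤ C := fun hc =>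
    ⟨_, fun z hz => hc.norm_powerSum_le (by simpa using (Metric.mem_ball.1 hz).le)⟩
  induction m generalizing c with
  | zero => exact hb hc
  | succ m ih => exact ⟨hb hc, _, fun z hz => hc.hasDerivAt_powerSum hz, ih hc.succ⟩

theorem BoundedDerivs.differentiableOn {m : ℕ} {F : ℂ → ℂ} (h : BoundedDerivs (m + 1) F) :
    DifferentiableOn ℂ F (Metric.ball 0 1) := by
  obtain ⟨-, F', hF', -⟩ := h
  exact fun z hz => (hF' z hz).differentiableAt.differentiableWithinAt

/-- Cauchy's estimate on circles of radius `R < 1`, followed by `R → 1`; nothing is known about `F`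
on the unit circle itself. -/
theorem norm_iteratedDeriv_zero_le {F : ℂ → ℂ} (hd : DifferentiableOn ℂ F (Metric.ball 0 1)) {C : ℝ}
    (hC : ∀ z ∈ Metric.ball (0 : ℂ) 1, ‖F z‖ ≤ C) (n : ℕ) :
    ‖iteratedDeriv n F 0‖ ≤ n.factorial * C := by
  have h1 : ∀ R : ℝ, R ∈ Set.Ioo (0 : ℝ) 1 →
      ‖iteratedDeriv n F 0‖ ≤ n.factorial * C / R ^ n := by
    intro R hR
    have hsub : Metric.closedBall (0 : ℂ) R ⊆ Metric.ball 0 1 :=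
      Metric.closedBall_subset_ball hR.2
    refine Complex.norm_iteratedDeriv_le_of_forall_mem_sphere_norm_le n hR.1 ?_
      fun z hz => hC z (hsub (Metric.sphere_subset_closedBall hz))
    exact (hd.mono hsub).diffContOnCl_ball subset_rfl
  have h2 : Filter.Tendsto (fun R : ℝ => n.factorial * C / R ^ n) (nhdsWithin 1 (Set.Iio 1))
      (nhds (n.factorial * C / 1 ^ n)) := by
    refine Filter.Tendsto.mono_left ?_ nhdsWithin_le_nhds
    have : ContinuousAt (fun R : ℝ => n.factorial * C / R ^ n) 1 :=
      ContinuousAt.div₀ (by fun_prop) (by fun_prop) (by simp)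
    exact this
  rw [one_pow, div_one] at h2
  refine ge_of_tendsto h2 ?_
  filter_upwards [Ioo_mem_nhdsLT (zero_lt_one (α := ℝ))] with R hR using h1 R hR

/-- Each derivative gains a power of `n`: the Taylor coefficient of `F` of order `n + 1` is `1 / (n
+ 1)` times that of `F'` of order `n`. One derivative beyond `m` supplies the holomorphy needed for
Cauchy's estimate. -/
theorem BoundedDerivs.exists_norm_taylor_le {m : ℕ} {F : ℂ → ℂ} (h : BoundedDerivs (m + 1) F) :
    ∃ C : ℝ, ∀ n : ℕ, ‖((n.factorial : ℂ))⁻¹ * iteratedDeriv n F 0‖ * ((n : ℝ) + 1) ^ m ≤ C := by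
  induction m generalizing F with
  | zero =>
    obtain ⟨C, hC⟩ := h.bounded
    refine ⟨C, fun n => ?_⟩
    rw [pow_zero, mul_one, norm_mul, norm_inv, Complex.norm_natCast,
      inv_mul_le_iff₀ (by positivity)]
    exact norm_iteratedDeriv_zero_le h.differentiableOn hC n
  | succ m ih =>
    obtain ⟨-, F', hF', h'⟩ := h
    obtain ⟨C, hC⟩ := ih h'
    -- The power of 2 comes from `n + 2 ≤ 2 (n + 1)`.
    refine ⟨max ‖F 0‖ (2 ^ (m + 1) * C), fun n => ?_⟩
    cases n with
    | zero => simp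
    | succ n =>
      have heq : iteratedDeriv (n + 1) F 0 = iteratedDeriv n F' 0 := by
        rw [iteratedDeriv_succ']
        refine Filter.EventuallyEq.iteratedDeriv_eq n ?_
        filter_upwards [Metric.ball_mem_nhds (0 : ℂ) one_pos] with z hz using (hF' z hz).deriv
      refine le_trans ?_ ((mul_le_mul_of_nonneg_left (hC n) (by positivity)).trans
        (le_max_right _ _))
      rw [heq, norm_mul, norm_mul, norm_inv, norm_inv, Complex.norm_natCast, Complex.norm_natCast,
        Nat.factorial_succ]
      have h3 : (((n + 1 : ℕ) : ℝ) + 1) ^ (m + 1) ≤ (2 * ((n : ℝ) + 1)) ^ (m + 1) := by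
        push_cast; gcongr; linarith [(Nat.cast_nonneg n : (0 : ℝ) ≤ n)]
      calc _ ≤ (((n + 1) * n.factorial : ℕ) : ℝ)⁻¹ * ‖iteratedDeriv n F' 0‖ *
            (2 * ((n : ℝ) + 1)) ^ (m + 1) := by gcongr
        _ = _ := by
          push_cast
          rw [mul_pow, mul_inv]
          field_simp
          ring

/-- Converse of `RapidDecay.boundedDerivs`. Together they replace a condition on coefficients by one
that behaves well under composition. -/
theorem exists_rapidDecay {F : ℂ → ℂ} (h : ∀ m, BoundedDerivs m F) :
    ∃ c, RapidDecay c ∧ ∀ z ∈ Metric.ball (0 : ℂ) 1, powerSum c z = F z := by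
  refine ⟨fun n => ((n.factorial : ℂ))⁻¹ * iteratedDeriv n F 0, fun N =>
    (h (N + 1)).exists_norm_taylor_le, fun z hz => ?_⟩
  have := Complex.hasSum_taylorSeries_on_ball (h 1).differentiableOn hz
  refine Eq.trans (tsum_congr fun n => ?_) this.tsum_eq
  simp only [sub_zero, smul_eq_mul]
  ring

/-! ### Moebius transformations of the disc -/

section Moebius

variable {α β : ℂ}

theorem le_norm_moebius_denom {z : ℂ} (hz : ‖z‖ ≤ 1) :
    ‖α‖ - ‖β‖ ≤ ‖α + β * z‖ := by
  have h1 : ‖β * z‖ ≤ ‖β‖ := by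
    rw [norm_mul]; exact mul_le_of_le_one_right (norm_nonneg _) hz
  have h2 := norm_sub_norm_le α (-(β * z))
  rw [norm_neg, sub_neg_eq_add] at h2
  linarith

theorem moebius_denom_ne (hαβ : ‖β‖ < ‖α‖) {z : ℂ} (hz : ‖z‖ ≤ 1) : α + β * z ≠ 0 := by
  rw [← norm_pos_iff]
  linarith [le_norm_moebius_denom (α := α) (β := β) hz]

/-- The Moebius transformation `z ↦ (ᾱ z + β̄) / (α + β z)` of the unit disc. -/
def moebius (α β z : ℂ) : ℂ := (starRingEnd ℂ α * z + starRingEnd ℂ β) / (α + β * z)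

/-- Invariance of the Hermitian form of signature `(1, 1)` up to its scale; it is the reason why the
disc is mapped into itself. -/
theorem normSq_moebius_sub (α β z : ℂ) :
    Complex.normSq (α + β * z) - Complex.normSq (starRingEnd ℂ α * z + starRingEnd ℂ β) =
      (Complex.normSq α - Complex.normSq β) * (1 - Complex.normSq z) := by
  simp only [Complex.normSq_apply, Complex.add_re, Complex.add_im, Complex.mul_re, Complex.mul_im,
    Complex.conj_re, Complex.conj_im]
  ring

theorem norm_moebius_le (hαβ : ‖β‖ < ‖α‖) {z : ℂ} (hz : ‖z‖ ≤ 1) : ‖moebius α β z‖ ≤ 1 := by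
  rw [moebius, norm_div, div_le_one (norm_pos_iff.2 (moebius_denom_ne hαβ hz))]
  have h := normSq_moebius_sub α β z
  simp only [Complex.normSq_eq_norm_sq] at h
  have h2 : 0 ≤ (‖α‖ ^ 2 - ‖β‖ ^ 2) * (1 - ‖z‖ ^ 2) := by
    apply mul_nonneg <;> nlinarith [norm_nonneg α, norm_nonneg β, norm_nonneg z]
  exact (sq_le_sq₀ (norm_nonneg _) (norm_nonneg _)).1 (by linarith)

theorem norm_moebius_lt (hαβ : ‖β‖ < ‖α‖) {z : ℂ} (hz : ‖z‖ < 1) : ‖moebius α β z‖ < 1 := by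
  rw [moebius, norm_div, div_lt_one (norm_pos_iff.2 (moebius_denom_ne hαβ hz.le))]
  have h := normSq_moebius_sub α β z
  simp only [Complex.normSq_eq_norm_sq] at h
  have h2 : 0 < (‖α‖ ^ 2 - ‖β‖ ^ 2) * (1 - ‖z‖ ^ 2) := by
    apply mul_pos <;> nlinarith [norm_nonneg α, norm_nonneg β, norm_nonneg z]
  exact (sq_lt_sq₀ (norm_nonneg _) (norm_nonneg _)).1 (by linarith)

theorem hasDerivAt_moebius (hαβ : ‖β‖ < ‖α‖) {z : ℂ} (hz : ‖z‖ ≤ 1) :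
    HasDerivAt (moebius α β) ((starRingEnd ℂ α * α - starRingEnd ℂ β * β) *
      ((α + β * z) ^ 2)⁻¹) z := by
  have h0 := moebius_denom_ne hαβ hz
  have h1 : HasDerivAt (fun z => starRingEnd ℂ α * z + starRingEnd ℂ β) (starRingEnd ℂ α) z := by
    simpa using ((hasDerivAt_id z).const_mul (starRingEnd ℂ α)).add_const (starRingEnd ℂ β)
  have h2 : HasDerivAt (fun z => α + β * z) β z := by
    simpa using ((hasDerivAt_id z).const_mul β).const_add α
  refine (h1.div h2 h0).congr_deriv ?_
  field_simp
  ring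

theorem boundedDerivs_inv_pow (hαβ : ‖β‖ < ‖α‖) (m N : ℕ) :
    BoundedDerivs m fun z => ((α + β * z) ^ N)⁻¹ := by
  have hb : ∀ N : ℕ, ∃ C : ℝ, ∀ z ∈ Metric.ball (0 : ℂ) 1, ‖((α + β * z) ^ N)⁻¹‖ ≤ C := by
    refine fun N => ⟨((‖α‖ - ‖β‖) ^ N)⁻¹, fun z hz => ?_⟩
    have hp : 0 < ‖α‖ - ‖β‖ := sub_pos.2 hαβ
    rw [norm_inv, norm_pow]
    have := le_norm_moebius_denom (α := α) (β := β) (z := z)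
      (by simpa using (Metric.mem_ball.1 hz).le)
    gcongr
  induction m generalizing N with
  | zero => exact hb N
  | succ m ih =>
    refine ⟨hb N, fun z => (-(N * β)) * ((α + β * z) ^ (N + 1))⁻¹, fun z hz => ?_,
      (ih (N + 1)).const_mul _⟩
    have h0 : α + β * z ≠ 0 := moebius_denom_ne hαβ (by simpa using (Metric.mem_ball.1 hz).le)
    have h2 : HasDerivAt (fun z => α + β * z) β z := by
      simpa using ((hasDerivAt_id z).const_mul β).const_add α
    refine ((h2.pow N).inv (pow_ne_zero _ h0)).congr_deriv ?_
    cases N with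
    | zero => simp
    | succ N =>
      simp only [Nat.add_sub_cancel, Pi.pow_apply]
      field_simp
      ring

/-- The chain rule produces a constant times `(α + β z)^(-2)`, whose derivatives are bounded because
the pole lies outside the closed disc. -/
theorem BoundedDerivs.comp_moebius (hαβ : ‖β‖ < ‖α‖) {m : ℕ} {F : ℂ → ℂ}
    (hF : BoundedDerivs m F) : BoundedDerivs m fun z => F (moebius α β z) := by
  have hmaps : ∀ z ∈ Metric.ball (0 : ℂ) 1, moebius α β z ∈ Metric.ball (0 : ℂ) 1 := by
    intro z hz
    simpa using norm_moebius_lt hαβ (by simpa using hz)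
  have hb : ∀ {m : ℕ} {F : ℂ → ℂ}, BoundedDerivs m F →
      ∃ C : ℝ, ∀ z ∈ Metric.ball (0 : ℂ) 1, ‖F (moebius α β z)‖ ≤ C := by
    intro m F hF
    obtain ⟨C, hC⟩ := hF.bounded
    exact ⟨C, fun z hz => hC _ (hmaps z hz)⟩
  induction m generalizing F with
  | zero => exact hb hF
  | succ m ih =>
    have hF0 := hF
    obtain ⟨-, F', hF', h'⟩ := hF
    refine ⟨hb hF0, _, fun z hz => (hF' _ (hmaps z hz)).comp z
      (hasDerivAt_moebius hαβ (by simpa using (Metric.mem_ball.1 hz).le)), ?_⟩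
    exact (ih h').mul ((boundedDerivs_inv_pow hαβ m 2).const_mul _)

/-- The space of power series with rapidly decaying coefficients is stable under the action of
Moebius transformations of weight `N`. -/
theorem RapidDecay.exists_moebius {c : ℕ → ℂ} (hc : RapidDecay c) (hαβ : ‖β‖ < ‖α‖) (N : ℕ) :
    ∃ c', RapidDecay c' ∧ ∀ z : ℂ, ‖z‖ ≤ 1 →
      powerSum c' z = ((α + β * z) ^ N)⁻¹ * powerSum c (moebius α β z) := by
  obtain ⟨c', hc', h⟩ := exists_rapidDecay fun m =>
    (boundedDerivs_inv_pow hαβ m N).mul ((hc.boundedDerivs m).comp_moebius hαβ)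
  refine ⟨c', hc', fun z hz => ?_⟩
  have hcl : closure (Metric.ball (0 : ℂ) 1) = Metric.closedBall 0 1 :=
    closure_ball _ one_ne_zero
  have hmem : ∀ {z : ℂ}, z ∈ Metric.closedBall (0 : ℂ) 1 → ‖z‖ ≤ 1 := by
    intro z hz
    simpa using hz
  -- The Taylor argument gives equality on the open disc only; continuity carries it to the unit
  -- circle, where the values of functions on `G` are read off.
  refine Set.EqOn.of_subset_closure (s := Metric.ball (0 : ℂ) 1) (t := Metric.closedBall 0 1)
    (f := powerSum c') (g := fun z => ((α + β * z) ^ N)⁻¹ * powerSum c (moebius α β z))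
    h hc'.continuousOn_powerSum ?_ Metric.ball_subset_closedBall hcl.symm.subset (by simpa using hz)
  refine ContinuousOn.mul (ContinuousOn.inv₀ (by fun_prop)
    fun z hz => pow_ne_zero _ (moebius_denom_ne hαβ (hmem hz))) ?_
  refine hc.continuousOn_powerSum.comp (fun z hz =>
    (hasDerivAt_moebius hαβ (hmem hz)).continuousAt.continuousWithinAt) fun z hz => ?_
  simpa using norm_moebius_le hαβ (hmem hz)

end Moebius

end

/-! ### Fourier transforms of powers of the Cayley transform -/

section

theorem integral_pow_mul_cexp_neg_mul (l : ℕ) {r : ℂ} (hr : 0 < r.re) :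
    ∫ v in Set.Ioi (0 : ℝ), (v : ℂ) ^ l * Complex.exp (-(r * v)) = l.factorial / r ^ (l + 1) := by
  have hr0 : r ≠ 0 := by rintro rfl; simp at hr
  have hint : ∀ l : ℕ, IntegrableOn (fun v : ℝ => (v : ℂ) ^ l * Complex.exp (-(r * v)))
      (Set.Ioi 0) := by
    intro l
    refine (integrableOn_pow_mul_exp_neg_mul l hr).mono' (by fun_prop) ?_
    filter_upwards [ae_restrict_mem measurableSet_Ioi] with v hv
    have hv : (0 : ℝ) < v := hv
    rw [norm_mul, norm_pow, Complex.norm_real, Complex.norm_exp, Real.norm_eq_abs, abs_of_pos hv]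
    simp
  induction l with
  | zero =>
    have := integral_exp_mul_complex_Ioi (a := -r) (by simpa using hr) 0
    simpa [neg_mul, neg_div] using this
  | succ l ih =>
    have hd : ∀ v ∈ Set.Ici (0 : ℝ), HasDerivAt
        (fun v : ℝ => (v : ℂ) ^ (l + 1) * Complex.exp (-(r * v)))
        ((l + 1) * ((v : ℂ) ^ l * Complex.exp (-(r * v))) -
          r * ((v : ℂ) ^ (l + 1) * Complex.exp (-(r * v)))) v := by
      intro v _
      have h1 : HasDerivAt (fun v : ℝ => (v : ℂ)) 1 v := Complex.ofRealCLM.hasDerivAt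
      refine ((h1.pow (l + 1)).mul ((h1.const_mul r).neg.cexp)).congr_deriv ?_
      simp only [Pi.pow_apply, Pi.neg_apply, Nat.add_sub_cancel]
      push_cast
      ring
    have ht : Filter.Tendsto (fun v : ℝ => (v : ℂ) ^ (l + 1) * Complex.exp (-(r * v)))
        Filter.atTop (nhds 0) := by
      rw [tendsto_zero_iff_norm_tendsto_zero]
      have := Real.tendsto_pow_mul_exp_neg_atTop_nhds_zero (l + 1)
      have h2 := (this.comp (Filter.tendsto_id.const_mul_atTop hr)).const_mul ((r.re ^ (l + 1))⁻¹)
      rw [mul_zero] at h2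
      refine h2.congr' ?_
      filter_upwards [Filter.eventually_gt_atTop 0] with v hv
      rw [norm_mul, norm_pow, Complex.norm_real, Complex.norm_exp, Real.norm_eq_abs, abs_of_pos hv]
      simp only [Function.comp, id, mul_pow]
      have : r.re ^ (l + 1) ≠ 0 := by positivity
      field_simp
      simp
    have h3 := integral_Ioi_of_hasDerivAt_of_tendsto' hd
      (((hint l).const_mul _).sub ((hint (l + 1)).const_mul _)) ht
    rw [integral_sub ((hint l).const_mul _) ((hint (l + 1)).const_mul _), integral_const_mul,
      integral_const_mul, ih] at h3
    simp only [Complex.ofReal_zero, zero_pow (Nat.succ_ne_zero l), zero_mul, sub_zero] at h3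
    have h4 := (sub_eq_zero.1 h3).symm
    rw [Nat.factorial_succ]
    push_cast
    apply mul_left_cancel₀ hr0
    rw [h4]
    field_simp
    ring

/-- The function `((t - i) / (t + i)) ^ n (t + i) ^ (-m)` on the real line. -/
def cayleyPow (n m : ℕ) (t : ℝ) : ℂ :=
  (((t : ℂ) - Complex.I) / ((t : ℂ) + Complex.I)) ^ n * (((t : ℂ) + Complex.I) ^ m)⁻¹

theorem add_I_ne_zero (t : ℝ) : (t : ℂ) + Complex.I ≠ 0 := by
  intro h
  simpa using congrArg Complex.im h

theorem norm_add_I_sq (t : ℝ) : ‖(t : ℂ) + Complex.I‖ ^ 2 = 1 + t ^ 2 := by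
  rw [← Complex.normSq_eq_norm_sq, Complex.normSq_apply]
  simp [sq, add_comm]

theorem norm_sub_I_div_add_I (t : ℝ) : ‖((t : ℂ) - Complex.I) / ((t : ℂ) + Complex.I)‖ = 1 := by
  have h : (t : ℂ) - Complex.I = starRingEnd ℂ ((t : ℂ) + Complex.I) := by
    rw [map_add, Complex.conj_ofReal, Complex.conj_I, sub_eq_add_neg]
  rw [norm_div, h, RCLike.norm_conj, div_self (norm_ne_zero_iff.2 (add_I_ne_zero t))]

theorem norm_inv_add_I_pow_le {m : ℕ} (hm : 2 ≤ m) (t : ℝ) :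
    ‖(((t : ℂ) + Complex.I) ^ m)⁻¹‖ ≤ (1 + t ^ 2)⁻¹ := by
  have h1 : 1 ≤ ‖(t : ℂ) + Complex.I‖ := by
    have := norm_add_I_sq t
    nlinarith [norm_nonneg ((t : ℂ) + Complex.I), sq_nonneg t]
  rw [norm_inv, norm_pow, ← norm_add_I_sq]
  gcongr

theorem norm_cayleyPow_le (n : ℕ) {m : ℕ} (hm : 2 ≤ m) (t : ℝ) :
    ‖cayleyPow n m t‖ ≤ (1 + t ^ 2)⁻¹ := by
  rw [cayleyPow, norm_mul, norm_pow, norm_sub_I_div_add_I, one_pow, one_mul]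
  exact norm_inv_add_I_pow_le hm t

theorem continuous_cayley : Continuous fun t : ℝ => ((t : ℂ) - Complex.I) / ((t : ℂ) + Complex.I) :=
  Continuous.div (by fun_prop) (by fun_prop) add_I_ne_zero

theorem continuous_cayleyPow (n m : ℕ) : Continuous (cayleyPow n m) :=
  (continuous_cayley.pow n).mul
    (Continuous.inv₀ (by fun_prop) fun t => pow_ne_zero _ (add_I_ne_zero t))

theorem integrable_cayleyPow (n : ℕ) {m : ℕ} (hm : 2 ≤ m) : Integrable (cayleyPow n m) :=
  integrable_inv_one_add_sq.mono' (continuous_cayleyPow n m).aestronglyMeasurable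
    (Filter.Eventually.of_forall (norm_cayleyPow_le n hm))

/-- Differentiation stays within the family and only raises `m`, so decay estimates can be iterated.
The truncated `n - 1` is harmless, as its coefficient is zero when `n = 0`. -/
theorem hasDerivAt_cayleyPow (n m : ℕ) (t : ℝ) :
    HasDerivAt (cayleyPow n m) (2 * Complex.I * n * cayleyPow (n - 1) (m + 2) t -
      m * cayleyPow n (m + 1) t) t := by
  have h0 := add_I_ne_zero t
  have h1 : HasDerivAt (fun v : ℝ => (v : ℂ)) 1 t := Complex.ofRealCLM.hasDerivAt
  have h2 := h1.add_const Complex.I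
  have h3 := ((h1.sub_const Complex.I).div h2 h0).pow n
  have h4 := (h2.pow m).inv (pow_ne_zero m h0)
  refine (h3.mul h4).congr_deriv ?_
  simp only [cayleyPow, Pi.pow_apply, Pi.div_apply, Pi.inv_apply]
  have e1 : (n : ℂ) * (((t : ℂ) - Complex.I) / (t + Complex.I)) ^ (n - 1) *
      ((1 * ((t : ℂ) + Complex.I) - (t - Complex.I) * 1) / (t + Complex.I) ^ 2) *
      ((t + Complex.I) ^ m)⁻¹ = 2 * Complex.I * n *
      ((((t : ℂ) - Complex.I) / (t + Complex.I)) ^ (n - 1) * ((t + Complex.I) ^ (m + 2))⁻¹) := by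
    field_simp
    ring
  have e2 : (-(m * ((t : ℂ) + Complex.I) ^ (m - 1) * 1) / ((t + Complex.I) ^ m) ^ 2) =
      -(m * ((t + Complex.I) ^ (m + 1))⁻¹) := by
    cases m with
    | zero => simp
    | succ m =>
      rw [Nat.add_sub_cancel]
      field_simp
      ring
  rw [e1, e2]
  ring

open FourierTransform in
theorem fourier_const_smul_apply (a : ℂ) (f : ℝ → ℂ) (v : ℝ) : 𝓕 (a • f) v = a * 𝓕 f v :=
  congrFun (VectorFourier.fourierIntegral_const_smul Real.fourierChar volume (innerₗ ℝ) f a) v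

-- The inverse transform of `v^(l+1) exp(-2πv)` on the half-line is a Gamma integral, and Fourier
-- inversion reverses it. Inversion applies since `l + 1 ≥ 1` makes this function continuous at 0
-- and `l + 2 ≥ 2` makes its transform integrable.
open FourierTransform in
theorem fourier_inv_add_I_pow (l : ℕ) (v : ℝ) :
    𝓕 (fun t : ℝ => (((t : ℂ) + Complex.I) ^ (l + 2))⁻¹) v =
      (-2 * Real.pi * Complex.I) ^ (l + 2) / (l + 1).factorial *
        (Set.Ioi (0 : ℝ)).indicator
          (fun v => ((v ^ (l + 1) * Real.exp (-(2 * Real.pi * v)) : ℝ) : ℂ)) v := by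
  set g : ℝ → ℂ := (Set.Ioi (0 : ℝ)).indicator
    (fun v => ((v ^ (l + 1) * Real.exp (-(2 * Real.pi * v)) : ℝ) : ℂ)) with hg
  have hgi : Integrable g :=
    (integrable_indicator_iff measurableSet_Ioi).2
      (integrableOn_pow_mul_exp_neg_mul (l + 1) Real.two_pi_pos).ofReal
  have hgc : Continuous g := by
    have : g = fun v => (((max v 0) ^ (l + 1) * Real.exp (-(2 * Real.pi * v)) : ℝ) : ℂ) := by
      ext v
      rw [hg]
      by_cases hv : 0 < v
      · rw [Set.indicator_of_mem (by exact hv), max_eq_left hv.le]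
      · rw [Set.indicator_of_notMem (by exact hv), max_eq_right (not_lt.1 hv)]
        simp
    rw [this]
    fun_prop
  have hinv : 𝓕⁻ g = fun t : ℝ => ((l + 1).factorial / (-2 * Real.pi * Complex.I) ^ (l + 2) : ℂ) *
      (((t : ℂ) + Complex.I) ^ (l + 2))⁻¹ := by
    ext t
    rw [Real.fourierInv_eq']
    have h1 : ∀ v : ℝ, Complex.exp (↑(2 * Real.pi * inner ℝ v t) * Complex.I) • g v =
        (Set.Ioi (0 : ℝ)).indicator (fun v : ℝ => (v : ℂ) ^ (l + 1) *
          Complex.exp (-((-2 * Real.pi * Complex.I * (t + Complex.I)) * v))) v := by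
      intro v
      rw [hg]
      by_cases hv : v ∈ Set.Ioi (0 : ℝ)
      · rw [Set.indicator_of_mem hv, Set.indicator_of_mem hv, smul_eq_mul]
        push_cast
        rw [mul_left_comm, ← Complex.exp_add]
        congr 2
        have : inner ℝ v t = t * v := rfl
        rw [this]
        push_cast
        linear_combination (-2 * Real.pi * v : ℂ) * Complex.I_mul_I
      · rw [Set.indicator_of_notMem hv, Set.indicator_of_notMem hv, smul_zero]
    simp only [h1]
    rw [integral_indicator measurableSet_Ioi, integral_pow_mul_cexp_neg_mul, mul_pow]
    · rw [div_mul_eq_div_div, div_eq_mul_inv]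
    · simp
      positivity
  have hc : (-2 * Real.pi * Complex.I : ℂ) ^ (l + 2) ≠ 0 := by
    apply pow_ne_zero
    simp [Real.pi_ne_zero]
  have hf : ((l + 1).factorial : ℂ) ≠ 0 := by exact_mod_cast (l + 1).factorial_ne_zero
  have hi0 : Integrable (fun t : ℝ => (((t : ℂ) + Complex.I) ^ (l + 2))⁻¹) := by
    have := integrable_cayleyPow 0 (m := l + 2) (by omega)
    refine this.congr (Filter.Eventually.of_forall fun t => ?_)
    simp [cayleyPow]
  have hii : Integrable (𝓕⁻ g) := by
    rw [hinv]
    exact hi0.const_mul _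
  have hfg : Integrable (𝓕 g) := by
    have := hii.comp_neg
    refine this.congr (Filter.Eventually.of_forall fun t => ?_)
    simp only [Real.fourierInv_eq_fourier_neg, neg_neg]
  have key := congrFun (hgc.fourier_fourierInv_eq hgi hfg) v
  have hsm : (fun t : ℝ => (((t : ℂ) + Complex.I) ^ (l + 2))⁻¹) =
      ((-2 * Real.pi * Complex.I) ^ (l + 2) / (l + 1).factorial : ℂ) • 𝓕⁻ g := by
    rw [hinv]
    ext t
    simp only [Pi.smul_apply, smul_eq_mul]
    field_simp
  rw [hsm, fourier_const_smul_apply, key]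

theorem cayleyPow_eq_sum (n m : ℕ) (t : ℝ) :
    cayleyPow n m t = ∑ j ∈ Finset.range (n + 1), (n.choose j * (-2 * Complex.I) ^ j : ℂ) *
      (((t : ℂ) + Complex.I) ^ (m + j))⁻¹ := by
  have h0 := add_I_ne_zero t
  have h1 : ((t : ℂ) - Complex.I) / ((t : ℂ) + Complex.I) =
      (-2 * Complex.I) * ((t : ℂ) + Complex.I)⁻¹ + 1 := by
    field_simp
    ring
  rw [cayleyPow, h1, add_pow, Finset.sum_mul]
  refine Finset.sum_congr rfl fun j _ => ?_
  rw [pow_add, mul_inv, mul_pow, one_pow, inv_pow]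
  ring

-- Since `(t-i)/(t+i) = 1 - 2i/(t+i)`, the function is a binomial sum of negative powers of `t + i`,
-- and their transforms assemble into a Laguerre polynomial.
open FourierTransform in
theorem fourier_cayleyPow (n l : ℕ) (v : ℝ) :
    𝓕 (cayleyPow n (l + 2)) v = (Set.Ioi (0 : ℝ)).indicator
      (fun v => (-2 * Real.pi * Complex.I) ^ (l + 2) *
        ((v ^ (l + 1) * Real.exp (-(2 * Real.pi * v)) * laguerre (l + 1) n (4 * Real.pi * v) : ℝ)
          : ℂ)) v := by
  have hi : ∀ j : ℕ, Integrable (fun t : ℝ => (((t : ℂ) + Complex.I) ^ (l + 2 + j))⁻¹) := by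
    intro j
    have := integrable_cayleyPow 0 (m := l + 2 + j) (by omega)
    refine this.congr (Filter.Eventually.of_forall fun t => ?_)
    simp [cayleyPow]
  have h1 : 𝓕 (cayleyPow n (l + 2)) v = ∑ j ∈ Finset.range (n + 1),
      (n.choose j * (-2 * Complex.I) ^ j : ℂ) *
        𝓕 (fun t : ℝ => (((t : ℂ) + Complex.I) ^ (l + 2 + j))⁻¹) v := by
    simp only [Real.fourier_real_eq, ← integral_const_mul]
    rw [← integral_finsetSum]
    · refine integral_congr_ae (Filter.Eventually.of_forall fun t => ?_)
      simp only [cayleyPow_eq_sum, Finset.smul_sum, Circle.smul_def, smul_eq_mul]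
      refine Finset.sum_congr rfl fun j _ => ?_
      ring
    · intro j _
      refine Integrable.const_mul ?_ _
      have := (Real.fourierIntegral_convergent_iff (μ := volume) v).2 (hi j)
      refine this.congr (Filter.Eventually.of_forall fun t => ?_)
      simp [mul_comm]
  rw [h1]
  by_cases hv : v ∈ Set.Ioi (0 : ℝ)
  · rw [Set.indicator_of_mem hv, laguerre]
    push_cast
    rw [Finset.mul_sum, Finset.mul_sum]
    refine Finset.sum_congr rfl fun j _ => ?_
    rw [show l + 2 + j = l + j + 2 by ring, fourier_inv_add_I_pow, Set.indicator_of_mem hv]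
    -- `(-2i)(-2πi) = -4π`: this produces the argument `4πv` and the alternating signs.
    have e : (-2 * Complex.I) ^ j * (-2 * Real.pi * Complex.I) ^ j =
        (-1) ^ j * (4 * Real.pi : ℂ) ^ j := by
      rw [← mul_pow, ← mul_pow]
      congr 1
      linear_combination (4 * Real.pi : ℂ) * Complex.I_mul_I
    rw [show l + j + 1 = l + 1 + j by ring, show l + j + 2 = l + 2 + j by ring,
      pow_add _ (l + 2) j, mul_pow (4 * Real.pi : ℂ)]
    push_cast
    rw [pow_add _ (l + 1) j]
    linear_combination ((n.choose j : ℂ) * (-2 * Real.pi * Complex.I) ^ (l + 2) /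
      ((l + 1 + j).factorial : ℂ) * ((v : ℂ) ^ (l + 1) * (v : ℂ) ^ j *
      Complex.exp (-(2 * Real.pi * v)))) * e
  · rw [Set.indicator_of_notMem hv]
    refine Finset.sum_eq_zero fun j _ => ?_
    rw [show l + 2 + j = l + j + 2 by ring, fourier_inv_add_I_pow, Set.indicator_of_notMem hv,
      mul_zero, mul_zero]

open FourierTransform in
theorem norm_fourier_cayleyPow_le_pi (n : ℕ) {m : ℕ} (hm : 2 ≤ m) (v : ℝ) :
    ‖𝓕 (cayleyPow n m) v‖ ≤ Real.pi := by
  rw [← integral_univ_inv_one_add_sq, Real.fourier_real_eq]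
  refine norm_integral_le_of_norm_le integrable_inv_one_add_sq
    (Filter.Eventually.of_forall fun t => ?_)
  rw [Circle.norm_smul]
  exact norm_cayleyPow_le n hm t

open FourierTransform in
theorem mul_fourier_cayleyPow (n : ℕ) {m : ℕ} (hm : 2 ≤ m) (v : ℝ) :
    2 * Real.pi * Complex.I * v * 𝓕 (cayleyPow n m) v =
      2 * Complex.I * n * 𝓕 (cayleyPow (n - 1) (m + 2)) v - m * 𝓕 (cayleyPow n (m + 1)) v := by
  have hd : deriv (cayleyPow n m) = (2 * Complex.I * n) • cayleyPow (n - 1) (m + 2) +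
      (-(m : ℂ)) • cayleyPow n (m + 1) := by
    ext t
    rw [(hasDerivAt_cayleyPow n m t).deriv]
    simp only [Pi.add_apply, Pi.smul_apply, smul_eq_mul]
    ring
  have i1 := integrable_cayleyPow (n - 1) (m := m + 2) (by omega)
  have i2 := integrable_cayleyPow n (m := m + 1) (by omega)
  have h := congrFun (Real.fourier_deriv (integrable_cayleyPow n hm)
    (fun t => (hasDerivAt_cayleyPow n m t).differentiableAt)
    (by rw [hd]; exact (i1.smul _).add (i2.smul _))) v
  rw [hd] at h
  have h2 : 𝓕 ((2 * Complex.I * n) • cayleyPow (n - 1) (m + 2) +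
      (-(m : ℂ)) • cayleyPow n (m + 1)) v = (2 * Complex.I * n) * 𝓕 (cayleyPow (n - 1) (m + 2)) v +
        (-(m : ℂ)) * 𝓕 (cayleyPow n (m + 1)) v := by
    have h3 := VectorFourier.fourierIntegral_add (e := Real.fourierChar) (μ := volume)
      (L := innerₗ ℝ) Real.continuous_fourierChar (by fun_prop)
      (i1.smul (2 * Complex.I * n : ℂ)) (i2.smul (-(m : ℂ)))
    refine (congrFun h3 v).trans ?_
    exact congrArg₂ (· + ·) (fourier_const_smul_apply _ _ v) (fourier_const_smul_apply _ _ v)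
  rw [h2, smul_eq_mul] at h
  rw [← h]
  ring

open FourierTransform in
theorem norm_mul_fourier_cayleyPow_le (n : ℕ) {m : ℕ} (hm : 2 ≤ m) (v A : ℝ)
    (h1 : ‖𝓕 (cayleyPow (n - 1) (m + 2)) v‖ ≤ A) (h2 : ‖𝓕 (cayleyPow n (m + 1)) v‖ ≤ A) :
    |v| * ‖𝓕 (cayleyPow n m) v‖ ≤ (2 * n + m) / (2 * Real.pi) * A := by
  have h := congrArg norm (mul_fourier_cayleyPow n hm v)
  rw [norm_mul, norm_mul, norm_mul, norm_mul, Complex.norm_I, Complex.norm_real, Complex.norm_real,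
    Real.norm_eq_abs, Real.norm_eq_abs, abs_of_pos Real.pi_pos, Complex.norm_two, mul_one] at h
  have h3 := norm_sub_le (2 * Complex.I * n * 𝓕 (cayleyPow (n - 1) (m + 2)) v)
    (m * 𝓕 (cayleyPow n (m + 1)) v)
  rw [← h] at h3
  simp only [norm_mul, Complex.norm_natCast, Complex.norm_I, Complex.norm_two, mul_one] at h3
  rw [div_mul_eq_mul_div, le_div_iff₀ Real.two_pi_pos]
  have h4 : 2 * (n : ℝ) * ‖𝓕 (cayleyPow (n - 1) (m + 2)) v‖ ≤ 2 * n * A := by gcongr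
  have h5 : (m : ℝ) * ‖𝓕 (cayleyPow n (m + 1)) v‖ ≤ m * A := by gcongr
  linarith

-- Two uses of the rule "derivative becomes multiplication by `2πiv`" give decay `v^(-2)`. The cost
-- is quadratic in `n`, which rapidly decaying coefficients absorb.
open FourierTransform in
theorem norm_fourier_cayleyPow_le (n : ℕ) {m : ℕ} (hm : 2 ≤ m) (v : ℝ) :
    ‖𝓕 (cayleyPow n m) v‖ ≤ 2 * (2 * n + m + 2) ^ 2 * (1 + v ^ 2)⁻¹ := by
  have hpi := Real.pi_gt_three
  have hpi4 := Real.pi_le_four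
  have s1 : ∀ (n : ℕ) {m : ℕ}, 2 ≤ m → |v| * ‖𝓕 (cayleyPow n m) v‖ ≤ (2 * n + m) / 2 := by
    intro n m hm
    refine (norm_mul_fourier_cayleyPow_le n hm v Real.pi
      (norm_fourier_cayleyPow_le_pi _ (by omega) v)
      (norm_fourier_cayleyPow_le_pi _ (by omega) v)).trans (le_of_eq ?_)
    field_simp
  rcases eq_or_ne v 0 with rfl | hv
  · refine (norm_fourier_cayleyPow_le_pi n hm 0).trans ?_
    have : (2 : ℝ) ≤ m := by exact_mod_cast hm
    simp only [ne_eq, OfNat.ofNat_ne_zero, not_false_eq_true, zero_pow, add_zero, inv_one, mul_one]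
    nlinarith [(Nat.cast_nonneg n : (0 : ℝ) ≤ n)]
  · have hv0 : 0 < |v| := abs_pos.2 hv
    have s2 := norm_mul_fourier_cayleyPow_le n hm v ((2 * n + m + 2) / 2 / |v|) (by
      rw [le_div_iff₀ hv0, mul_comm]
      refine (s1 (n - 1) (m := m + 2) (by omega)).trans ?_
      have : ((n - 1 : ℕ) : ℝ) ≤ n := by exact_mod_cast Nat.sub_le n 1
      push_cast
      linarith) (by
      rw [le_div_iff₀ hv0, mul_comm]
      refine (s1 n (m := m + 1) (by omega)).trans ?_
      push_cast
      linarith)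
    rw [mul_div_assoc', le_div_iff₀ hv0] at s2
    have s3 := norm_fourier_cayleyPow_le_pi n hm v
    rw [← div_eq_mul_inv, le_div_iff₀ (by positivity)]
    have e : ‖𝓕 (cayleyPow n m) v‖ * v ^ 2 = |v| * ‖𝓕 (cayleyPow n m) v‖ * |v| := by
      rw [← sq_abs]; ring
    have hm' : (2 : ℝ) ≤ m := by exact_mod_cast hm
    have hn' : (0 : ℝ) ≤ n := Nat.cast_nonneg n
    have s4 : (2 * (n : ℝ) + m) / (2 * Real.pi) * ((2 * n + m + 2) / 2) ≤ (2 * n + m + 2) ^ 2 := by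
      rw [div_mul_div_comm, div_le_iff₀ (by positivity)]
      nlinarith [mul_nonneg hn' hn', mul_nonneg hn' (Nat.cast_nonneg m : (0 : ℝ) ≤ m)]
    rw [mul_add, mul_one, e]
    nlinarith

end

/-! ### Bessel functions and the Hankel transform -/

section

theorem hasSum_of_eq {ι E : Type*} [AddCommMonoid E] [TopologicalSpace E] {f g : ι → E} {a : E}
    (h : HasSum f a) (e : ∀ i, g i = f i) : HasSum g a :=
  (funext e : g = f) ▸ h

/-- The Bessel-Clifford function: `J_α(x) = (x / 2) ^ α besselClifford α (x ^ 2 / 4)`. -/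
def besselClifford (α : ℕ) (y : ℝ) : ℝ :=
  ∑' m : ℕ, (-1) ^ m / ((m.factorial : ℝ) * ((m + α).factorial : ℝ)) * y ^ m

theorem abs_besselClifford_coeff_le (α m : ℕ) :
    |(-1 : ℝ) ^ m / ((m.factorial : ℝ) * ((m + α).factorial : ℝ))| ≤ 1 / m.factorial := by
  rw [abs_div, abs_pow, abs_neg, abs_one, one_pow, abs_of_pos (by positivity)]
  have : (1 : ℝ) ≤ (m + α).factorial := by exact_mod_cast (m + α).factorial_pos
  gcongr
  exact le_mul_of_one_le_right (by positivity) this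

theorem hasSum_besselClifford (α : ℕ) (y : ℝ) :
    HasSum (fun m : ℕ => (-1) ^ m / ((m.factorial : ℝ) * ((m + α).factorial : ℝ)) * y ^ m)
      (besselClifford α y) := by
  refine Summable.hasSum (Summable.of_norm_bounded (Real.summable_pow_div_factorial |y|)
    fun m => ?_)
  rw [norm_mul, norm_pow, Real.norm_eq_abs, Real.norm_eq_abs, div_eq_mul_one_div (|y| ^ m),
    mul_comm]
  exact mul_le_mul_of_nonneg_left (abs_besselClifford_coeff_le α m) (by positivity)

theorem hasDerivAt_besselClifford (α : ℕ) (y : ℝ) :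
    HasDerivAt (besselClifford α) (-besselClifford (α + 1) y) y := by
  set R : ℝ := |y| + 1
  have hR : 1 ≤ R := by simp [R]
  have hyR : y ∈ Metric.ball (0 : ℝ) R := by simp [R]
  have bound : ∀ (m : ℕ), ∀ z ∈ Metric.ball (0 : ℝ) R,
      ‖(-1) ^ m / ((m.factorial : ℝ) * ((m + α).factorial : ℝ)) * (m * z ^ (m - 1))‖ ≤
        (2 * R) ^ m / m.factorial := by
    intro m z hz
    have hz' : |z| ≤ R := by simpa using (Metric.mem_ball.1 hz).le
    rw [norm_mul, norm_mul, norm_pow, Real.norm_eq_abs, Real.norm_eq_abs, Real.norm_eq_abs,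
      Nat.abs_cast]
    -- The factor `m` from differentiation is absorbed by doubling the radius.
    have h1 : (m : ℝ) ≤ 2 ^ m := by exact_mod_cast m.lt_two_pow_self.le
    have h2 : |z| ^ (m - 1) ≤ R ^ m :=
      (pow_le_pow_left₀ (abs_nonneg _) hz' _).trans (pow_le_pow_right₀ hR (Nat.sub_le m 1))
    calc _ ≤ 1 / (m.factorial : ℝ) * (2 ^ m * R ^ m) := by
          gcongr
          exact abs_besselClifford_coeff_le α m
      _ = _ := by rw [mul_pow]; ring
  have h1 : HasDerivAt (besselClifford α)
      (∑' m : ℕ, (-1) ^ m / ((m.factorial : ℝ) * ((m + α).factorial : ℝ)) * (m * y ^ (m - 1))) y :=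
    hasDerivAt_tsum_of_isPreconnected (t := Metric.ball (0 : ℝ) R)
      (Real.summable_pow_div_factorial (2 * R)) Metric.isOpen_ball (convex_ball _ _).isPreconnected
      (fun n z _ => (hasDerivAt_pow n z).const_mul _) bound hyR
      (hasSum_besselClifford α y).summable hyR
  refine h1.congr_deriv ?_
  have h2 : Summable fun m : ℕ =>
      (-1) ^ m / ((m.factorial : ℝ) * ((m + α).factorial : ℝ)) * (m * y ^ (m - 1)) :=
    Summable.of_norm_bounded (Real.summable_pow_div_factorial (2 * R)) fun m => bound m y hyR
  rw [h2.tsum_eq_zero_add, ← (hasSum_besselClifford (α + 1) y).neg.tsum_eq]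
  simp only [Nat.cast_zero, zero_mul, mul_zero, zero_add]
  refine tsum_congr fun m => ?_
  rw [Nat.add_sub_cancel, Nat.factorial_succ m, add_right_comm m 1 α, ← add_assoc]
  push_cast
  rw [pow_succ]
  field_simp

theorem mul_besselClifford_add_two (α : ℕ) (y : ℝ) :
    y * besselClifford (α + 2) y = (α + 1) * besselClifford (α + 1) y - besselClifford α y := by
  have h1 := ((hasSum_besselClifford (α + 1) y).mul_left ((α : ℝ) + 1)).sub
    (hasSum_besselClifford α y)
  have h2 := (hasSum_besselClifford (α + 2) y).mul_left y
  refine HasSum.unique ?_ h1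
  rw [← hasSum_nat_add_iff' 1]
  simp only [Finset.range_one, Finset.sum_singleton, Nat.factorial_zero, pow_zero, zero_add]
  have e : ((α : ℝ) + 1) * (1 / (((1 : ℕ) : ℝ) * ((α + 1).factorial : ℝ)) * 1) -
      1 / (((1 : ℕ) : ℝ) * (α.factorial : ℝ)) * 1 = 0 := by
    rw [Nat.factorial_succ]
    push_cast
    field_simp
    ring
  rw [e, sub_zero]
  refine hasSum_of_eq h2 fun m => ?_
  rw [show m + 1 + α = m + α + 1 by ring, show m + 1 + (α + 1) = m + α + 2 by ring,
    show m + (α + 2) = m + α + 2 by ring, Nat.factorial_succ (m + α + 1), Nat.factorial_succ m]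
  push_cast
  field_simp
  ring

/-- An energy argument: with `C_α` the Bessel-Clifford function, `E = C_α² + y C_{α+1}²` has
derivative `-(2α+1) C_{α+1}² ≤ 0` by the three-term recurrence, and `E(0) = 1/(α!)²`. -/
theorem abs_besselClifford_le (α : ℕ) {y : ℝ} (hy : 0 ≤ y) : |besselClifford α y| ≤ 1 := by
  set E : ℝ → ℝ := fun y => besselClifford α y ^ 2 + y * besselClifford (α + 1) y ^ 2
  have hE : ∀ y, HasDerivAt E (-(2 * α + 1) * besselClifford (α + 1) y ^ 2) y := by
    intro y
    have h1 := hasDerivAt_besselClifford α y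
    have h2 := hasDerivAt_besselClifford (α + 1) y
    refine ((h1.pow 2).add ((hasDerivAt_id y).mul (h2.pow 2))).congr_deriv ?_
    have h3 := mul_besselClifford_add_two α y
    simp only [id, Pi.pow_apply]
    linear_combination (-2 * besselClifford (α + 1) y) * h3
  have hanti : Antitone E := antitone_of_deriv_nonpos (fun y => (hE y).differentiableAt) fun y => by
    rw [(hE y).deriv]
    nlinarith [sq_nonneg (besselClifford (α + 1) y), (Nat.cast_nonneg α : (0 : ℝ) ≤ α)]
  have h0 : besselClifford α 0 = 1 / α.factorial := by
    rw [besselClifford, tsum_eq_single 0 fun m hm => by simp [hm]]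
    simp
  have h1 := hanti hy
  simp only [E, h0, zero_mul, add_zero] at h1
  have h2 : (1 / (α.factorial : ℝ)) ^ 2 ≤ 1 := by
    apply pow_le_one₀ (by positivity)
    rw [div_le_one (by positivity)]
    exact_mod_cast α.factorial_pos
  rw [abs_le_one_iff_mul_self_le_one, ← sq]
  nlinarith [mul_nonneg hy (sq_nonneg (besselClifford (α + 1) y))]

theorem continuous_besselClifford (α : ℕ) : Continuous (besselClifford α) :=
  continuous_iff_continuousAt.2 fun y => (hasDerivAt_besselClifford α y).continuousAt

theorem besselJ_natCast (α : ℕ) (x : ℝ) :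
    besselJ α x = (x / 2) ^ α * besselClifford α ((x / 2) ^ 2) := by
  rw [besselJ, besselClifford, ← tsum_mul_left]
  refine tsum_congr fun m => ?_
  have h1 : Real.Gamma (m + α + 1) = (m + α).factorial := by
    rw [← Real.Gamma_nat_eq_factorial]
    push_cast
    rfl
  have h2 : (x / 2) ^ (2 * (m : ℝ) + α) = (x / 2) ^ (2 * m + α) := by
    rw [← Real.rpow_natCast]
    push_cast
    rfl
  rw [h1, h2, pow_add, pow_mul]
  ring

/-- `Real.Gamma` takes the value 0 at its poles, and division by 0 gives 0; so the first `α` terms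
of the series of order `-α` vanish, as they do for the entire function `1/Γ`. -/
theorem Gamma_sub_natCast_add_one (m α : ℕ) (h : m < α) : Real.Gamma (m + -(α : ℝ) + 1) = 0 := by
  rw [Real.Gamma_eq_zero_iff]
  refine ⟨α - m - 1, ?_⟩
  have : ((α - m - 1 : ℕ) : ℝ) = α - m - 1 := by
    rw [Nat.sub_sub, Nat.cast_sub (by omega)]
    push_cast
    ring
  rw [this]
  ring

/-- Shift the index by `α` past the vanishing terms; `s = -1` is the case of `J` and `s = 1` that of
`I`. -/
theorem bessel_tsum_neg_natCast (s : ℝ) (α : ℕ) (x : ℝ) :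
    ∑' m : ℕ, s ^ m / (m.factorial * Real.Gamma (m + -(α : ℝ) + 1)) *
        (x / 2) ^ (2 * (m : ℝ) + -(α : ℝ)) =
      s ^ α * ∑' m : ℕ, s ^ m / (m.factorial * Real.Gamma (m + α + 1)) *
        (x / 2) ^ (2 * (m : ℝ) + α) := by
  have hinj : Function.Injective fun m : ℕ => m + α := add_left_injective α
  rw [← hinj.tsum_eq, ← tsum_mul_left]
  · refine tsum_congr fun m => ?_
    have h1 : Real.Gamma (m + α + 1) = (m + α).factorial := by
      rw [← Real.Gamma_nat_eq_factorial]
      push_cast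
      rfl
    have h2 : Real.Gamma (((m + α : ℕ) : ℝ) + -(α : ℝ) + 1) = m.factorial := by
      rw [← Real.Gamma_nat_eq_factorial]
      push_cast
      congr 1
      ring
    have h3 : 2 * ((m + α : ℕ) : ℝ) + -(α : ℝ) = 2 * m + α := by
      push_cast
      ring
    rw [h1, h2, h3, pow_add]
    ring
  · intro m hm
    by_contra hr
    have : m < α := by
      by_contra hlt
      exact hr ⟨m - α, Nat.sub_add_cancel (not_lt.1 hlt)⟩
    refine hm ?_
    simp [Gamma_sub_natCast_add_one m α this]

theorem besselJ_neg_natCast (α : ℕ) (x : ℝ) :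
    besselJ (-α) x = (-1) ^ α * besselJ α x :=
  bessel_tsum_neg_natCast (-1) α x

theorem besselI_neg_natCast (α : ℕ) (x : ℝ) : besselI (-α) x = besselI α x := by
  have := bessel_tsum_neg_natCast 1 α x
  simpa only [one_pow, one_mul, besselI] using this

/-- The order `2ν = 2k - 1` is an odd integer, so `J` of opposite orders differ by a sign and add
up, while `I` of opposite orders agree and cancel. The sign `(-1)^k` comes from `sin(π(k - 1/2))`.
-/
theorem repBessel_half_integer (k : ℕ) [NeZero k] (u : ℝ) :
    repBessel ((k : ℝ) - 1 / 2) u =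
      if 0 < u then 2 * Real.pi * (-1) ^ k * √u * besselJ (2 * k - 1) (4 * Real.pi * √u)
      else 0 := by
  have hk : 1 ≤ k := Nat.one_le_iff_ne_zero.2 (NeZero.ne k)
  have hc : ((2 * k - 1 : ℕ) : ℝ) = 2 * k - 1 := by
    rw [Nat.cast_sub (by omega)]
    push_cast
    ring
  have e1 : -2 * ((k : ℝ) - 1 / 2) = -((2 * k - 1 : ℕ) : ℝ) := by rw [hc]; ring
  have e2 : 2 * ((k : ℝ) - 1 / 2) = ((2 * k - 1 : ℕ) : ℝ) := by rw [hc]; ring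
  have e3 : Real.sin (Real.pi * ((k : ℝ) - 1 / 2)) = -(-1) ^ k := by
    rw [show Real.pi * ((k : ℝ) - 1 / 2) = k * Real.pi - Real.pi / 2 by ring,
      Real.sin_sub_pi_div_two, Real.cos_nat_mul_pi]
  rw [repBessel, e1, e2, e3]
  unfold besselSigned
  split_ifs with h
  · have hodd : (-1 : ℝ) ^ (2 * k - 1) = -1 := Odd.neg_one_pow ⟨k - 1, by omega⟩
    rw [besselJ_neg_natCast, hodd, abs_of_pos h, hc]
    have h1 : ((-1 : ℝ) ^ k) ≠ 0 := by simp
    have h2 : ((-1 : ℝ) ^ k) * (-1) ^ k = 1 := by rw [← mul_pow]; simp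
    generalize besselJ (2 * k - 1) (4 * Real.pi * √u) = B
    field_simp
    linear_combination (-2 * B) * h2
  · rw [besselI_neg_natCast, sub_self, mul_zero]

theorem repBessel_eq_besselClifford (k : ℕ) [NeZero k] {u : ℝ} (hu : 0 < u) :
    repBessel ((k : ℝ) - 1 / 2) u =
      (-1) ^ k * (2 * Real.pi) ^ (2 * k) * u ^ k *
        besselClifford (2 * k - 1) ((2 * Real.pi) ^ 2 * u) := by
  have hk : 1 ≤ k := Nat.one_le_iff_ne_zero.2 (NeZero.ne k)
  have hc : (2 * k - 1 : ℝ) = ((2 * k - 1 : ℕ) : ℝ) := by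
    rw [Nat.cast_sub (by omega)]
    push_cast
    ring
  rw [repBessel_half_integer k, if_pos hu, hc, besselJ_natCast,
    show 4 * Real.pi * √u / 2 = 2 * Real.pi * √u by ring, mul_pow (2 * Real.pi) (√u) 2,
    Real.sq_sqrt hu.le]
  have : u ^ k = √u ^ (2 * k) := by rw [pow_mul, Real.sq_sqrt hu.le]
  rw [this]
  obtain ⟨l, rfl⟩ : ∃ l, k = l + 1 := ⟨k - 1, by omega⟩
  rw [show 2 * (l + 1) - 1 = 2 * l + 1 by omega, show 2 * (l + 1) = 2 * l + 1 + 1 by ring]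
  ring

/-- Termwise integration. Absolute convergence follows from `(m+α+j)! ≤ 2^(m+α+j) j! (m+α)!`, which
leaves a multiple of the exponential series of `2y`. -/
theorem hasSum_integral_besselClifford_mul (α j : ℕ) {y : ℝ} (hy : 0 ≤ y) :
    HasSum (fun m : ℕ => (-1) ^ m / ((m.factorial : ℝ) * ((m + α).factorial : ℝ)) * y ^ m *
      (m + α + j).factorial)
      (∫ s in Set.Ioi (0 : ℝ), besselClifford α (y * s) * (s ^ (α + j) * Real.exp (-(1 * s)))) := by
  let F : ℕ → ℝ → ℝ := fun m s => (-1) ^ m / ((m.factorial : ℝ) * ((m + α).factorial : ℝ)) * y ^ m *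
    (s ^ (m + α + j) * Real.exp (-(1 * s)))
  have hFi : ∀ m, IntegrableOn (F m) (Set.Ioi 0) := fun m =>
    (integrableOn_pow_mul_exp_neg_mul _ one_pos).const_mul _
  have hval : ∀ m, ∫ s in Set.Ioi (0 : ℝ), F m s =
      (-1) ^ m / ((m.factorial : ℝ) * ((m + α).factorial : ℝ)) * y ^ m * (m + α + j).factorial := by
    intro m
    simp only [F]
    rw [integral_const_mul, integral_pow_mul_exp_neg_mul _ one_pos, one_pow, div_one]
  have hnorm : ∀ m, ∫ s in Set.Ioi (0 : ℝ), ‖F m s‖ =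
      1 / ((m.factorial : ℝ) * ((m + α).factorial : ℝ)) * y ^ m * (m + α + j).factorial := by
    intro m
    have : ∀ s ∈ Set.Ioi (0 : ℝ), ‖F m s‖ =
        1 / ((m.factorial : ℝ) * ((m + α).factorial : ℝ)) * y ^ m *
          (s ^ (m + α + j) * Real.exp (-(1 * s))) := by
      intro s hs
      have hs : (0 : ℝ) < s := hs
      simp only [F]
      rw [norm_mul, norm_mul, norm_div, norm_pow, norm_neg, norm_one, one_pow,
        Real.norm_of_nonneg (by positivity), Real.norm_of_nonneg (by positivity),
        Real.norm_of_nonneg (by positivity)]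
    rw [setIntegral_congr_fun measurableSet_Ioi this, integral_const_mul,
      integral_pow_mul_exp_neg_mul _ one_pos, one_pow, div_one]
  have hsum : Summable fun m => ∫ s in Set.Ioi (0 : ℝ), ‖F m s‖ := by
    simp only [hnorm]
    refine Summable.of_nonneg_of_le (fun m => by positivity) (fun m => ?_)
      ((Real.summable_pow_div_factorial (2 * y)).mul_left ((j.factorial : ℝ) * 2 ^ (α + j)))
    have h1 : ((m + α + j).factorial : ℝ) ≤ 2 ^ (m + α + j) * j.factorial * (m + α).factorial := by
      have h2 := Nat.add_choose_mul_factorial_mul_factorial (m + α) j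
      have h3 := Nat.choose_le_two_pow (m + α + j) j
      rw [← h2]
      push_cast
      have h4 : (((m + α + j).choose j : ℕ) : ℝ) ≤ 2 ^ (m + α + j) := by exact_mod_cast h3
      calc _ = ((m + α + j).choose j : ℝ) * j.factorial * (m + α).factorial := by ring
        _ ≤ _ := by gcongr
    calc _ ≤ 1 / ((m.factorial : ℝ) * ((m + α).factorial : ℝ)) * y ^ m *
          (2 ^ (m + α + j) * j.factorial * (m + α).factorial) := by gcongr
      _ = _ := by
        rw [mul_pow, show m + α + j = m + (α + j) by ring, pow_add]
        field_simp
  have key := hasSum_integral_of_summable_integral_norm hFi hsum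
  simp only [hval] at key
  have hF_sum : ∀ s, ∑' m, F m s =
      besselClifford α (y * s) * (s ^ (α + j) * Real.exp (-(1 * s))) := by
    intro s
    refine Eq.trans (tsum_congr fun m => ?_)
      ((hasSum_besselClifford α (y * s)).mul_right (s ^ (α + j) * Real.exp (-(1 * s)))).tsum_eq
    simp only [F]
    rw [mul_pow, show m + α + j = m + (α + j) by ring, pow_add _ m]
    ring
  simpa only [hF_sum] using key

theorem hasSum_shift_exp (j : ℕ) (x : ℝ) :
    HasSum (fun m : ℕ => if j ≤ m then x ^ m / ((m - j).factorial : ℝ) else 0)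
      (x ^ j * Real.exp x) := by
  have hinj : Function.Injective fun m : ℕ => m + j := add_left_injective j
  rw [← hinj.hasSum_iff]
  · have := (NormedSpace.expSeries_div_hasSum_exp x).mul_left (x ^ j)
    rw [← Real.exp_eq_exp_ℝ] at this
    refine hasSum_of_eq this fun m => ?_
    simp only [Function.comp, le_add_iff_nonneg_left, zero_le, if_true, Nat.add_sub_cancel]
    rw [pow_add]
    ring
  · intro m hm
    rw [if_neg]
    intro h
    exact hm ⟨m - j, Nat.sub_add_cancel h⟩

/-- Laguerre functions are eigenfunctions of the Hankel transform. -/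
theorem integral_besselClifford_mul_laguerre (α n : ℕ) {y : ℝ} (hy : 0 ≤ y) :
    ∫ s in Set.Ioi (0 : ℝ), besselClifford α (y * s) *
        (s ^ α * Real.exp (-s) * laguerre α n (2 * s)) =
      (-1) ^ n * (Real.exp (-y) * laguerre α n (2 * y)) := by
  have hint : ∀ j, IntegrableOn
      (fun s => besselClifford α (y * s) * (s ^ (α + j) * Real.exp (-(1 * s)))) (Set.Ioi 0) := by
    intro j
    refine (integrableOn_pow_mul_exp_neg_mul (α + j) one_pos).mono' ?_ ?_
    · have := continuous_besselClifford α
      exact Continuous.aestronglyMeasurable (by fun_prop)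
    · filter_upwards [ae_restrict_mem measurableSet_Ioi] with s hs
      have hs : (0 : ℝ) < s := hs
      rw [norm_mul, Real.norm_of_nonneg (r := s ^ (α + j) * _) (by positivity)]
      exact mul_le_of_le_one_left (by positivity) (abs_besselClifford_le α (by positivity))
  have h1 : ∀ s : ℝ, besselClifford α (y * s) * (s ^ α * Real.exp (-s) * laguerre α n (2 * s)) =
      ∑ j ∈ Finset.range (n + 1), (n.choose j : ℝ) * (-2) ^ j / ((α + j).factorial : ℝ) *
        (besselClifford α (y * s) * (s ^ (α + j) * Real.exp (-(1 * s)))) := by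
    intro s
    rw [laguerre, Finset.mul_sum, Finset.mul_sum]
    refine Finset.sum_congr rfl fun j _ => ?_
    rw [one_mul, pow_add, mul_pow, show (-2 : ℝ) = (-1) * 2 by norm_num, mul_pow (-1 : ℝ) 2]
    ring
  simp only [h1]
  rw [integral_finsetSum _ fun j _ => (hint j).const_mul _]
  simp only [integral_const_mul]
  -- Both sides are now expanded in powers of `y`, and `heq` compares the coefficients by means of
  -- the binomial sum at `a = -2`.
  have hL := hasSum_sum (s := Finset.range (n + 1)) fun j _ =>
    (hasSum_integral_besselClifford_mul α j hy).mul_left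
      ((n.choose j : ℝ) * (-2) ^ j / ((α + j).factorial : ℝ))
  have hR := (hasSum_sum (s := Finset.range (n + 1)) fun j _ =>
    (hasSum_shift_exp j (-y)).mul_left
      ((n.choose j : ℝ) * 2 ^ j / ((α + j).factorial : ℝ))).mul_left ((-1 : ℝ) ^ n)
  have heq : ∀ m : ℕ, ∑ j ∈ Finset.range (n + 1),
      (n.choose j : ℝ) * (-2) ^ j / ((α + j).factorial : ℝ) *
        ((-1) ^ m / ((m.factorial : ℝ) * ((m + α).factorial : ℝ)) * y ^ m *
          (m + α + j).factorial) =
      (-1) ^ n * ∑ j ∈ Finset.range (n + 1), (n.choose j : ℝ) * 2 ^ j / ((α + j).factorial : ℝ) *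
        (if j ≤ m then (-y) ^ m / ((m - j).factorial : ℝ) else 0) := by
    intro m
    have e1 := sum_choose_mul_factorial_div n m α (-2)
    rw [sum_choose_neg_two] at e1
    calc _ = ((-1) ^ m / ((m.factorial : ℝ) * ((m + α).factorial : ℝ)) * y ^ m) *
          ∑ j ∈ Finset.range (n + 1), (n.choose j : ℝ) * (-2) ^ j / ((α + j).factorial : ℝ) *
            ((m + α + j).factorial : ℝ) := by
          rw [Finset.mul_sum]
          exact Finset.sum_congr rfl fun j _ => by ring
      _ = _ := by
          rw [e1, Finset.mul_sum, Finset.mul_sum, Finset.mul_sum, Finset.mul_sum]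
          refine Finset.sum_congr rfl fun j _ => ?_
          split_ifs with h
          · have h2 := Nat.choose_mul_factorial_mul_factorial (show m - j ≤ m + α by omega)
            rw [show m + α - (m - j) = α + j by omega] at h2
            have h3 : ((m + α).choose (m - j) : ℝ) * (m - j).factorial * (α + j).factorial =
                (m + α).factorial := by exact_mod_cast h2
            rw [← h3, neg_pow y]
            have : ((m + α).choose (m - j) : ℝ) ≠ 0 := by
              exact_mod_cast (Nat.choose_pos (show m - j ≤ m + α by omega)).ne'
            field_simp
          · simp
  simp only [heq] at hL
  rw [hL.unique hR, laguerre]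
  congr 1
  rw [Finset.mul_sum]
  refine Finset.sum_congr rfl fun j _ => ?_
  rw [neg_pow y, mul_pow]
  ring

end

/-! ### Vectors as sequences and as functions on the group -/

section

variable {k : ℕ} {σ : ℤˣ}

theorem units_mul_self (σ : ℤˣ) : (σ : ℤ) * σ = 1 := by
  rw [← Units.val_mul, Int.units_mul_self, Units.val_one]

/-- The weights of the discrete series, enumerated by the natural numbers. -/
def weightEquiv (k : ℕ) (σ : ℤˣ) : ℕ ≃ Weight k σ where
  toFun n := ⟨σ * (k + n), by rw [← mul_assoc, units_mul_self]; omega⟩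
  invFun p := (σ * (p : ℤ) - k).toNat
  left_inv n := by
    simp only [← mul_assoc, units_mul_self]
    omega
  right_inv p := by
    apply Subtype.ext
    have h := p.2
    simp only
    rw [Int.toNat_of_nonneg (by omega), add_sub_cancel, ← mul_assoc, units_mul_self, one_mul]

theorem weightEquiv_val (n : ℕ) : ((weightEquiv k σ n : Weight k σ) : ℤ) = σ * (k + n) := rfl

theorem abs_weightEquiv (n : ℕ) : |((weightEquiv k σ n : Weight k σ) : ℤ)| = k + n := by
  rw [weightEquiv_val, abs_mul, Int.isUnit_iff_abs_eq.1 σ.isUnit, one_mul]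
  exact abs_of_nonneg (by positivity)

theorem normSqPhi_weightEquiv [NeZero k] (n : ℕ) :
    normSqPhi k (weightEquiv k σ n : Weight k σ) =
      Real.pi ^ (2 * k - 1) * ((n.factorial : ℝ) / (2 * k - 1 + n).factorial) := by
  have hk : 1 ≤ k := Nat.one_le_iff_ne_zero.2 (NeZero.ne k)
  have hc : (2 * k - 1 : ℝ) = ((2 * k - 1 : ℕ) : ℝ) := by
    rw [Nat.cast_sub (by omega)]
    push_cast
    ring
  rw [normSqPhi, abs_weightEquiv, hc, Real.rpow_natCast]
  congr 2
  · rw [← Real.Gamma_nat_eq_factorial]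
    push_cast
    congr 1
    ring
  · rw [← Real.Gamma_nat_eq_factorial]
    push_cast
    rw [← hc]
    congr 1
    ring

/-- The number `d + σ i c`, where `(c, d)` is the lower row of `g`. -/
def zetaSL (σ : ℤˣ) (g : SL) : ℂ := (g 1 1 : ℂ) + ((σ : ℤ) : ℂ) * (g 1 0 : ℂ) * Complex.I

theorem conj_zetaSL (g : SL) :
    starRingEnd ℂ (zetaSL σ g) = (g 1 1 : ℂ) - ((σ : ℤ) : ℂ) * (g 1 0 : ℂ) * Complex.I := by
  simp [zetaSL, sub_eq_add_neg]

theorem norm_zetaSL_sq (g : SL) : ‖zetaSL σ g‖ ^ 2 = g 1 0 ^ 2 + g 1 1 ^ 2 := by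
  rw [← Complex.normSq_eq_norm_sq, Complex.normSq_apply]
  rcases Int.units_eq_one_or σ with rfl | rfl <;> simp [zetaSL] <;> ring

theorem lower_row_pos (g : SL) : 0 < g 1 0 ^ 2 + g 1 1 ^ 2 := by
  have h := g.det_coe
  rw [Matrix.det_fin_two] at h
  by_contra hn
  have h0 : g 1 0 = 0 := by nlinarith [sq_nonneg (g 1 0), sq_nonneg (g 1 1)]
  have h1 : g 1 1 = 0 := by nlinarith [sq_nonneg (g 1 0), sq_nonneg (g 1 1)]
  rw [h0, h1] at h
  simp at h

theorem zetaSL_ne_zero (g : SL) : zetaSL σ g ≠ 0 := by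
  have := lower_row_pos g
  rw [← norm_zetaSL_sq (σ := σ)] at this
  intro h
  simp [h] at this

theorem norm_conj_zetaSL_div (g : SL) : ‖starRingEnd ℂ (zetaSL σ g) / zetaSL σ g‖ = 1 := by
  rw [norm_div, RCLike.norm_conj, div_self (norm_ne_zero_iff.2 (zetaSL_ne_zero g))]

theorem zetaSL_mul_conj (g : SL) :
    zetaSL σ g * starRingEnd ℂ (zetaSL σ g) = ((g 1 0 ^ 2 + g 1 1 ^ 2 : ℝ) : ℂ) := by
  rw [Complex.mul_conj, Complex.normSq_eq_norm_sq, norm_zetaSL_sq]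

/-- With `y = 1/(ζ ζ̄)` and `exp(iθ)` equal to `ζ̄/|ζ|` for `σ = 1` and to `ζ/|ζ|` for `σ = -1`, the
sign of the weight `σ (k + n)` compensates the conjugation. From here on both series are treated
alike. -/
theorem phiSL_weightEquiv (n : ℕ) (g : SL) :
    phiSL ((k : ℝ) - 1 / 2) (weightEquiv k σ n : Weight k σ) g =
      (zetaSL σ g ^ (2 * k))⁻¹ * (starRingEnd ℂ (zetaSL σ g) / zetaSL σ g) ^ n := by
  have hz : zetaSL σ g ≠ 0 := zetaSL_ne_zero g
  have hz' : starRingEnd ℂ (zetaSL σ g) ≠ 0 := (map_ne_zero _).2 hz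
  have hN : ((‖zetaSL σ g‖ : ℝ) : ℂ) ^ 2 = zetaSL σ g * starRingEnd ℂ (zetaSL σ g) := by
    rw [zetaSL_mul_conj, ← norm_zetaSL_sq (σ := σ)]
    push_cast
    rfl
  have hNz : ((‖zetaSL σ g‖ : ℝ) : ℂ) ≠ 0 := by
    exact_mod_cast norm_ne_zero_iff.2 hz
  have h1 : (((1 / (g 1 0 ^ 2 + g 1 1 ^ 2)) ^ ((k : ℝ) - 1 / 2 + 1 / 2) : ℝ) : ℂ) =
      ((zetaSL σ g * starRingEnd ℂ (zetaSL σ g)) ^ k)⁻¹ := by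
    rw [sub_add_cancel, Real.rpow_natCast, zetaSL_mul_conj, one_div, inv_pow]
    push_cast
    rfl
  rw [phiSL, h1, weightEquiv_val]
  rcases Int.units_eq_one_or σ with rfl | rfl
  · have h2 : (g 1 1 : ℂ) - g 1 0 * Complex.I = starRingEnd ℂ (zetaSL 1 g) := by
      rw [conj_zetaSL]
      simp
    have h3 : 2 * (((1 : ℤˣ) : ℤ) * ((k : ℤ) + n)) = ((2 * (k + n) : ℕ) : ℤ) := by push_cast; ring
    rw [h2, h3, zpow_natCast, RCLike.norm_conj, div_pow, pow_mul ((‖zetaSL 1 g‖ : ℝ) : ℂ), hN]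
    generalize zetaSL 1 g = z at *
    generalize starRingEnd ℂ z = z' at *
    rw [div_pow]
    field_simp
    ring
  · have h2 : (g 1 1 : ℂ) - g 1 0 * Complex.I = zetaSL (-1) g := by
      rw [zetaSL]
      simp [sub_eq_add_neg]
    have h3 : 2 * (((-1 : ℤˣ) : ℤ) * ((k : ℤ) + n)) = -((2 * (k + n) : ℕ) : ℤ) := by
      push_cast; ring
    rw [h2, h3, zpow_neg, zpow_natCast, div_pow, pow_mul ((‖zetaSL (-1) g‖ : ℝ) : ℂ), hN]
    generalize zetaSL (-1) g = z at *
    generalize starRingEnd ℂ z = z' at *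
    rw [div_pow]
    field_simp
    ring

variable [NeZero k]

/-- The coefficients of a vector, indexed by the natural numbers. -/
def seq (φ : D k σ) (n : ℕ) : ℂ := coeff φ (weightEquiv k σ n)

theorem D.ext_seq {φ ψ : D k σ} (h : ∀ n, seq φ n = seq ψ n) : φ = ψ := by
  ext p
  obtain ⟨n, rfl⟩ := (weightEquiv k σ).surjective p
  exact h n

theorem isSmooth_iff {φ : D k σ} : IsSmooth φ ↔ RapidDecay (seq φ) := by
  have hk : (1 : ℝ) ≤ k := by exact_mod_cast Nat.one_le_iff_ne_zero.2 (NeZero.ne k)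
  have habs : ∀ n : ℕ, |(((weightEquiv k σ n : Weight k σ) : ℤ) : ℝ)| = k + n := by
    intro n
    rw [← Int.cast_abs, abs_weightEquiv]
    push_cast
    rfl
  constructor
  · intro h N
    obtain ⟨C, hC⟩ := h N
    refine ⟨C, fun n => le_trans ?_ (hC (weightEquiv k σ n))⟩
    rw [habs]
    exact mul_le_mul_of_nonneg_left (pow_le_pow_left₀ (by positivity) (by linarith) N)
      (norm_nonneg _)
  · intro h N
    obtain ⟨C, hC⟩ := h N
    refine ⟨k ^ N * C, fun p => ?_⟩
    obtain ⟨n, rfl⟩ := (weightEquiv k σ).surjective p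
    refine le_trans ?_ (mul_le_mul_of_nonneg_left (hC n) (by positivity))
    rw [habs]
    -- `k + n ≤ k (n + 1)` because `k ≥ 1`.
    have : ((k : ℝ) + n) ^ N ≤ (k * ((n : ℝ) + 1)) ^ N := by
      gcongr
      nlinarith [(Nat.cast_nonneg n : (0 : ℝ) ≤ n)]
    calc _ ≤ ‖seq φ n‖ * (k * ((n : ℝ) + 1)) ^ N :=
          mul_le_mul_of_nonneg_left this (norm_nonneg _)
      _ = _ := by rw [mul_pow]; ring

theorem norm_sq_line {p : Weight k σ} (v : Line k σ p) :
    ‖v‖ ^ 2 = normSqPhi k p * ‖v.val‖ ^ 2 := by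
  have h2 : ‖v‖ ^ 2 = RCLike.re (inner ℂ v v) := (inner_self_eq_norm_sq (𝕜 := ℂ) _).symm
  have h3 : inner ℂ v v = (normSqPhi k p : ℂ) * (starRingEnd ℂ v.val * v.val) := rfl
  rw [h2, h3, ← Complex.normSq_eq_conj_mul_self, ← Complex.ofReal_mul, RCLike.re_to_complex,
    Complex.ofReal_re, Complex.normSq_eq_norm_sq]

theorem hasSum_norm_sq (φ : D k σ) :
    HasSum (fun n => Real.pi ^ (2 * k - 1) * ((n.factorial : ℝ) / (2 * k - 1 + n).factorial) *
      ‖seq φ n‖ ^ 2) (‖φ‖ ^ 2) := by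
  have h := lp.hasSum_norm (p := 2) (by norm_num) φ
  have h1 : HasSum (fun p => ‖φ p‖ ^ 2) (‖φ‖ ^ 2) := by simpa using h
  rw [← (weightEquiv k σ).hasSum_iff] at h1
  refine hasSum_of_eq h1 fun n => ?_
  rw [Function.comp, norm_sq_line, normSqPhi_weightEquiv]
  rfl

/-- The vector `c φ_p` of the line `ℂ φ_p`. -/
def Line.ofVal (p : Weight k σ) (c : ℂ) : Line k σ p := c

/-- The vector with given coefficients. -/
def ofSeq (σ : ℤˣ) (c : ℕ → ℂ) (hc : Summable fun n =>
    Real.pi ^ (2 * k - 1) * ((n.factorial : ℝ) / (2 * k - 1 + n).factorial) * ‖c n‖ ^ 2) :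
    D k σ :=
  ⟨fun p => Line.ofVal p (c ((weightEquiv k σ).symm p)), by
    refine memℓp_gen ?_
    rw [← (weightEquiv k σ).summable_iff]
    refine hc.congr fun n => ?_
    simp only [Function.comp, ENNReal.toReal_ofNat, Real.rpow_ofNat]
    rw [norm_sq_line, normSqPhi_weightEquiv, Line.val, Line.ofVal, Equiv.symm_apply_apply]⟩

theorem seq_ofSeq (c : ℕ → ℂ) (hc) : seq (ofSeq (k := k) σ c hc) = c := by
  ext n
  change c ((weightEquiv k σ).symm (weightEquiv k σ n)) = c n
  rw [Equiv.symm_apply_apply]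

theorem RapidDecay.summable_weighted {c : ℕ → ℂ} (hc : RapidDecay c) (k : ℕ) : Summable fun n =>
    Real.pi ^ (2 * k - 1) * ((n.factorial : ℝ) / (2 * k - 1 + n).factorial) * ‖c n‖ ^ 2 := by
  obtain ⟨C, hC⟩ := hc 0
  simp only [pow_zero, mul_one] at hC
  refine Summable.of_nonneg_of_le (fun n => by positivity) (fun n => ?_)
    (hc.summable_norm.mul_left (Real.pi ^ (2 * k - 1) * C))
  have h1 : (n.factorial : ℝ) / (2 * k - 1 + n).factorial ≤ 1 := by
    rw [div_le_one (by positivity)]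
    exact_mod_cast Nat.factorial_le (by omega)
  calc _ ≤ Real.pi ^ (2 * k - 1) * 1 * (‖c n‖ * ‖c n‖) := by rw [sq]; gcongr
    _ ≤ Real.pi ^ (2 * k - 1) * 1 * (C * ‖c n‖) := by
      have := hC n
      gcongr
    _ = _ := by ring

theorem exists_isSmooth_seq (σ : ℤˣ) {c : ℕ → ℂ} (hc : RapidDecay c) :
    ∃ φ : D k σ, IsSmooth φ ∧ seq φ = c :=
  ⟨ofSeq σ c (hc.summable_weighted k), isSmooth_iff.2 (by rwa [seq_ofSeq]), seq_ofSeq _ _⟩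

theorem term_weightEquiv (φ : D k σ) (g : SL) (n : ℕ) :
    term φ (QuotientGroup.mk g) (weightEquiv k σ n) = (zetaSL σ g ^ (2 * k))⁻¹ *
      (seq φ n * (starRingEnd ℂ (zetaSL σ g) / zetaSL σ g) ^ n) := by
  have : term φ (QuotientGroup.mk g) (weightEquiv k σ n) =
    seq φ n * phiSL ((k : ℝ) - 1 / 2) (weightEquiv k σ n : Weight k σ) g := rfl
  rw [this, phiSL_weightEquiv]
  ring

theorem toFun_mk (φ : D k σ) (g : SL) :
    toFun φ (QuotientGroup.mk g) = (zetaSL σ g ^ (2 * k))⁻¹ *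
      powerSum (seq φ) (starRingEnd ℂ (zetaSL σ g) / zetaSL σ g) := by
  rw [toFun, ← (weightEquiv k σ).tsum_eq, powerSum, ← tsum_mul_left]
  exact tsum_congr fun n => term_weightEquiv φ g n

theorem IsSmooth.summable_term {φ : D k σ} (hφ : IsSmooth φ) (g : G) : Summable (term φ g) := by
  obtain ⟨g, rfl⟩ := QuotientGroup.mk_surjective g
  rw [← (weightEquiv k σ).summable_iff]
  refine Summable.congr
    (((isSmooth_iff.1 hφ).summable (norm_conj_zetaSL_div (σ := σ) g).le).mul_left
    ((zetaSL σ g ^ (2 * k))⁻¹)) fun n => ?_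
  exact (term_weightEquiv φ g n).symm

theorem continuous_zetaSL : Continuous (zetaSL σ) := by
  have h : ∀ i j : Fin 2, Continuous fun g : SL => g i j := fun i j =>
    (continuous_apply_apply i j).comp continuous_subtype_val
  have h1 := h 1 1
  have h2 := h 1 0
  unfold zetaSL
  fun_prop

theorem IsSmooth.continuous_toFun {φ : D k σ} (hφ : IsSmooth φ) : Continuous (toFun φ) := by
  have hz := continuous_zetaSL (σ := σ)
  have h1 : Continuous fun g : SL => toFun φ (QuotientGroup.mk g) := by
    simp only [toFun_mk]
    refine Continuous.mul (Continuous.inv₀ (by fun_prop) fun g => pow_ne_zero _ (zetaSL_ne_zero g))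
      ?_
    refine (isSmooth_iff.1 hφ).continuousOn_powerSum.comp_continuous
      (Continuous.div (Complex.continuous_conj.comp hz) hz zetaSL_ne_zero) fun g => ?_
    rw [mem_closedBall_zero_iff]
    exact (norm_conj_zetaSL_div g).le
  exact QuotientGroup.isOpenQuotientMap_mk.isQuotientMap.continuous_iff.2 h1

theorem continuous_mk_sl {X : Type*} [TopologicalSpace X] {p q r s : X → ℝ}
    (h : ∀ x, p x * s x - q x * r x = 1) (hp : Continuous p) (hq : Continuous q)
    (hr : Continuous r) (hs : Continuous s) :
    Continuous fun x => (QuotientGroup.mk (sl (p x) (q x) (r x) (s x) (h x)) : G) := by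
  refine QuotientGroup.continuous_mk.comp (Continuous.subtype_mk ?_ _)
  refine continuous_matrix fun i j => ?_
  fin_cases i <;> fin_cases j <;> assumption

theorem continuous_n : Continuous n :=
  continuous_mk_sl _ continuous_const continuous_id continuous_const continuous_const

theorem continuous_rot : Continuous rot :=
  continuous_mk_sl _ Real.continuous_cos Real.continuous_sin Real.continuous_sin.neg
    Real.continuous_cos

theorem IsSmooth.norm_toFun_le {φ : D k σ} (hφ : IsSmooth φ) (g : SL) :
    ‖toFun φ (QuotientGroup.mk g)‖ ≤ ((g 1 0 ^ 2 + g 1 1 ^ 2) ^ k)⁻¹ * ∑' n, ‖seq φ n‖ := by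
  rw [toFun_mk, norm_mul, norm_inv, norm_pow, pow_mul, norm_zetaSL_sq]
  have := (isSmooth_iff.1 hφ).norm_powerSum_le (norm_conj_zetaSL_div (σ := σ) g).le
  have h0 := lower_row_pos g
  gcongr

theorem continuous_e : Continuous e := by
  unfold e
  fun_prop

theorem norm_e (x : ℝ) : ‖e x‖ = 1 := by
  rw [e, show (2 * Real.pi * Complex.I * x : ℂ) = ((2 * Real.pi * x : ℝ) : ℂ) * Complex.I by
    push_cast; ring, Complex.norm_exp_ofReal_mul_I]

theorem e_add (x y : ℝ) : e (x + y) = e x * e y := by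
  rw [e, e, e, ← Complex.exp_add]
  push_cast
  ring_nf

/-- The function is bounded by a constant times `q^(-k)`, where `q` is the squared length of the
lower row of `w n[ξ] g`. This `q` is quadratic in `ξ` with positive minimum, and `k ≥ 1`. -/
theorem IsSmooth.integrable_jacquetIntegrand {φ : D k σ} (hφ : IsSmooth φ) (δ : ℝ) (g : G) :
    Integrable (jacquetIntegrand δ (toFun φ) g) := by
  have hk : 1 ≤ k := Nat.one_le_iff_ne_zero.2 (NeZero.ne k)
  obtain ⟨g, rfl⟩ := QuotientGroup.mk_surjective g
  set A : ℝ := g 1 0 ^ 2 + g 1 1 ^ 2 with hA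
  have hA0 : 0 < A := lower_row_pos g
  set B : ℝ := g 0 0 * g 1 0 + g 0 1 * g 1 1 with hB
  have hdet : g 0 0 * g 1 1 - g 0 1 * g 1 0 = 1 := by
    rw [← Matrix.det_fin_two, g.det_coe]
  have hi : Integrable fun ξ : ℝ => A ^ k * (∑' n, ‖seq φ n‖) * (1 + (A * ξ + B) ^ 2)⁻¹ := by
    have h1 := (integrable_inv_one_add_sq.comp_add_right B).comp_mul_left' hA0.ne'
    exact h1.const_mul _
  have hf := hφ.continuous_toFun
  refine hi.mono' ?_ (Filter.Eventually.of_forall fun ξ => ?_)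
  · have := continuous_e
    have := continuous_n
    unfold jacquetIntegrand
    exact Continuous.aestronglyMeasurable (by fun_prop)
  · rw [jacquetIntegrand, norm_mul, norm_e, one_mul]
    refine (hφ.norm_toFun_le (sl 0 1 (-1) 0 (by ring) * sl 1 ξ 0 1 (by ring) * g)).trans ?_
    have e10 : (sl 0 1 (-1) 0 (by ring) * sl 1 ξ 0 1 (by ring) * g : SL) 1 0 =
        -(g 0 0 + ξ * g 1 0) := by
      simp only [mul_apply_sl]
      simp [sl]
      ring
    have e11 : (sl 0 1 (-1) 0 (by ring) * sl 1 ξ 0 1 (by ring) * g : SL) 1 1 =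
        -(g 0 1 + ξ * g 1 1) := by
      simp only [mul_apply_sl]
      simp [sl]
      ring
    rw [e10, e11]
    set q : ℝ := (-(g 0 0 + ξ * g 1 0)) ^ 2 + (-(g 0 1 + ξ * g 1 1)) ^ 2 with hq
    -- Lagrange's identity for the two rows of `g`; the 1 is the squared determinant.
    have hAq : A * q = 1 + (A * ξ + B) ^ 2 := by
      have : (g 0 0 * g 1 1 - g 0 1 * g 1 0) ^ 2 = 1 := by rw [hdet, one_pow]
      rw [hA, hq, hB]
      linear_combination this
    have hq' : q⁻¹ = A * (1 + (A * ξ + B) ^ 2)⁻¹ := by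
      rw [← hAq, mul_inv, ← mul_assoc, mul_inv_cancel₀ hA0.ne', one_mul]
    have h1 : (1 + (A * ξ + B) ^ 2)⁻¹ ^ k ≤ (1 + (A * ξ + B) ^ 2)⁻¹ := by
      refine pow_le_of_le_one (by positivity) (inv_le_one_of_one_le₀ ?_) (by omega)
      nlinarith [sq_nonneg (A * ξ + B)]
    have h2 : 0 ≤ ∑' n, ‖seq φ n‖ := tsum_nonneg fun n => norm_nonneg _
    rw [← inv_pow, hq', mul_pow]
    calc _ ≤ A ^ k * (1 + (A * ξ + B) ^ 2)⁻¹ * ∑' n, ‖seq φ n‖ := by gcongr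
      _ = _ := by ring

end

/-! ### Right translation of smooth vectors -/

variable {k : ℕ} [NeZero k] {σ : ℤˣ}

/-- The lower row of `g h` depends real-linearly on that of `g`, so `ζ` changes by a real-linear map
`ζ ↦ αζ + βζ̄`; the coefficients are those of the Moebius map that gives the action of `h`. -/
theorem zetaSL_mul (g h : SL) : zetaSL σ (g * h) =
    ((((h 1 1 + h 0 0 : ℝ) : ℂ) + ((σ : ℤ) : ℂ) * ((h 1 0 - h 0 1 : ℝ) : ℂ) * Complex.I) / 2) *
      zetaSL σ g +
    ((((h 1 1 - h 0 0 : ℝ) : ℂ) + ((σ : ℤ) : ℂ) * ((h 1 0 + h 0 1 : ℝ) : ℂ) * Complex.I) / 2) *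
      starRingEnd ℂ (zetaSL σ g) := by
  rw [conj_zetaSL, zetaSL, zetaSL, mul_apply_sl, mul_apply_sl]
  have hσ : ((σ : ℤ) : ℂ) * ((σ : ℤ) : ℂ) = 1 := by exact_mod_cast units_mul_self σ
  push_cast
  linear_combination ((g 1 0 : ℂ) * h 0 1 * Complex.I ^ 2) * hσ +
    ((g 1 0 : ℂ) * h 0 1) * Complex.I_sq

/-- Right translates of smooth vectors are smooth vectors. -/
theorem IsSmooth.exists_rightTranslate {φ : D k σ} (hφ : IsSmooth φ) (h : G) :
    ∃ ψ : D k σ, IsSmooth ψ ∧ toFun ψ = rightTranslate h (toFun φ) := by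
  obtain ⟨h, rfl⟩ := QuotientGroup.mk_surjective h
  set α : ℂ :=
    (((h 1 1 + h 0 0 : ℝ) : ℂ) + ((σ : ℤ) : ℂ) * ((h 1 0 - h 0 1 : ℝ) : ℂ) * Complex.I) / 2
    with hα
  set β : ℂ :=
    (((h 1 1 - h 0 0 : ℝ) : ℂ) + ((σ : ℤ) : ℂ) * ((h 1 0 + h 0 1 : ℝ) : ℂ) * Complex.I) / 2
    with hβ
  have hdet : h 0 0 * h 1 1 - h 0 1 * h 1 0 = 1 := by
    rw [← Matrix.det_fin_two, h.det_coe]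
  have hαβ : ‖β‖ < ‖α‖ := by
    -- The difference is the determinant of `h`, so `h` acts by an automorphism of the disc.
    have h1 : Complex.normSq α - Complex.normSq β = 1 := by
      rw [hα, hβ, Complex.normSq_div, Complex.normSq_div, Complex.normSq_apply (_ + _),
        Complex.normSq_apply (_ + _)]
      rcases Int.units_eq_one_or σ with rfl | rfl
      · simp
        linear_combination hdet
      · simp
        linear_combination hdet
    rw [Complex.normSq_eq_norm_sq, Complex.normSq_eq_norm_sq] at h1
    exact (sq_lt_sq₀ (norm_nonneg _) (norm_nonneg _)).1 (by linarith)
  obtain ⟨c', hc', hpow⟩ := (isSmooth_iff.1 hφ).exists_moebius hαβ (2 * k)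
  obtain ⟨ψ, hψ, hseq⟩ := exists_isSmooth_seq (k := k) σ hc'
  refine ⟨ψ, hψ, funext fun g => ?_⟩
  obtain ⟨g, rfl⟩ := QuotientGroup.mk_surjective g
  have e1 : rightTranslate (QuotientGroup.mk h) (toFun φ) (QuotientGroup.mk g) =
    toFun φ (QuotientGroup.mk (g * h)) := rfl
  have hz : zetaSL σ g ≠ 0 := zetaSL_ne_zero g
  have hz2 : zetaSL σ (g * h) ≠ 0 := zetaSL_ne_zero _
  rw [e1, toFun_mk, toFun_mk, hseq, hpow _ (norm_conj_zetaSL_div g).le]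
  have hm : zetaSL σ (g * h) = α * zetaSL σ g + β * starRingEnd ℂ (zetaSL σ g) := zetaSL_mul g h
  have e2 : α + β * (starRingEnd ℂ (zetaSL σ g) / zetaSL σ g) =
      zetaSL σ (g * h) / zetaSL σ g := by
    rw [hm]
    field_simp
  have e3 : moebius α β (starRingEnd ℂ (zetaSL σ g) / zetaSL σ g) =
      starRingEnd ℂ (zetaSL σ (g * h)) / zetaSL σ (g * h) := by
    rw [moebius, e2, hm, map_add, map_mul, map_mul, Complex.conj_conj, ← hm]
    field_simp
  rw [e3, e2, ← mul_assoc]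
  congr 1
  rw [div_pow, inv_div, inv_mul_eq_div, div_div_cancel_left' (pow_ne_zero _ hz)]

theorem phi_rot (ν : ℝ) (p : ℤ) (θ : ℝ) :
    phi ν p (rot θ) = Complex.exp (2 * p * θ * Complex.I) := by
  have h := phi_iwasawa ν p 0 1 one_pos θ
  have hn : n 0 = 1 := congrArg QuotientGroup.mk (by
    conv_rhs => rw [sl_eta 1]
    apply sl_congr <;> simp)
  have ha : a 1 one_pos = 1 := congrArg QuotientGroup.mk (by
    conv_rhs => rw [sl_eta 1]
    apply sl_congr <;> simp)
  simpa [hn, ha] using h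

theorem integral_exp_int (q : ℤ) :
    ∫ θ in (0 : ℝ)..(2 * Real.pi), Complex.exp (2 * q * θ * Complex.I) =
      if q = 0 then (2 * Real.pi : ℂ) else 0 := by
  split_ifs with hq
  · simp [hq]
  · have hc : (2 * q * Complex.I : ℂ) ≠ 0 := by simp [hq]
    have := integral_exp_mul_complex (a := 0) (b := 2 * Real.pi) hc
    calc _ = ∫ θ in (0 : ℝ)..(2 * Real.pi), Complex.exp ((2 * q * Complex.I) * θ) := by
          congr 1
          ext θ
          ring_nf
      _ = _ := by
          rw [this, show (2 * q * Complex.I * ((2 * Real.pi : ℝ) : ℂ) : ℂ) =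
            ((2 * q : ℤ) : ℂ) * (2 * Real.pi * Complex.I) by push_cast; ring,
            Complex.exp_int_mul_two_pi_mul_I]
          simp

/-- The coefficients of a smooth vector are the Fourier coefficients of its function along the
rotations. -/
theorem IsSmooth.integral_toFun_rot {φ : D k σ} (hφ : IsSmooth φ) (p : Weight k σ) :
    ∫ θ in (0 : ℝ)..(2 * Real.pi),
      toFun φ (rot θ) * Complex.exp (2 * (-(p : ℤ) : ℤ) * θ * Complex.I) =
      2 * Real.pi * coeff φ p := by
  have hterm : ∀ (q : Weight k σ) (θ : ℝ),
      term φ (rot θ) q * Complex.exp (2 * (-(p : ℤ) : ℤ) * θ * Complex.I) =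
        coeff φ q * Complex.exp (2 * ((q : ℤ) - p : ℤ) * θ * Complex.I) := by
    intro q θ
    rw [term, phi_rot, mul_assoc, ← Complex.exp_add]
    push_cast
    ring_nf
  have hnorm : ∀ (q : Weight k σ) (θ : ℝ),
      ‖coeff φ q * Complex.exp (2 * ((q : ℤ) - p : ℤ) * θ * Complex.I)‖ = ‖coeff φ q‖ := by
    intro q θ
    rw [norm_mul, show (2 * ((q : ℤ) - p : ℤ) * θ * Complex.I : ℂ) =
      ((2 * ((q : ℤ) - p : ℤ) * θ : ℝ) : ℂ) * Complex.I by push_cast; ring,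
      Complex.norm_exp_ofReal_mul_I, mul_one]
  have hs : Summable fun q : Weight k σ => ‖coeff φ q‖ := by
    rw [← (weightEquiv k σ).summable_iff]
    exact (isSmooth_iff.1 hφ).summable_norm
  have h1 := intervalIntegral.hasSum_integral_of_dominated_convergence (μ := volume)
    (a := 0) (b := 2 * Real.pi)
    (F := fun (q : Weight k σ) (θ : ℝ) =>
      coeff φ q * Complex.exp (2 * ((q : ℤ) - p : ℤ) * θ * Complex.I))
    (f := fun θ => toFun φ (rot θ) * Complex.exp (2 * (-(p : ℤ) : ℤ) * θ * Complex.I))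
    (fun q _ => ‖coeff φ q‖) (fun q => Continuous.aestronglyMeasurable (by fun_prop))
    (fun q => Filter.Eventually.of_forall fun θ _ => (hnorm q θ).le)
    (Filter.Eventually.of_forall fun θ _ => hs)
    (by simp) (Filter.Eventually.of_forall fun θ _ => by
      simp only [← hterm]
      exact (hφ.summable_term (rot θ)).hasSum.mul_right _)
  simp only [intervalIntegral.integral_const_mul, integral_exp_int] at h1
  rw [← h1.tsum_eq, tsum_eq_single p]
  · rw [if_pos (sub_self _), mul_comm]
  · intro q hq
    rw [if_neg fun h => hq (Subtype.ext (sub_eq_zero.1 h)), mul_zero]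

/-- Fourier analysis along the rotations recovers the coefficients; this lets identities between
operators on vectors be checked on functions. -/
theorem IsSmooth.ext_toFun {φ ψ : D k σ} (hφ : IsSmooth φ) (hψ : IsSmooth ψ)
    (h : toFun φ = toFun ψ) : φ = ψ := by
  ext p
  have h1 := hφ.integral_toFun_rot p
  rw [h, hψ.integral_toFun_rot p] at h1
  have : (2 * Real.pi : ℂ) ≠ 0 := by simp [Real.pi_ne_zero]
  exact (mul_left_cancel₀ this h1).symm

/-! ### The Kirillov operator as a Fourier transform -/

/-- The function `ξ ↦ φ(w n[ξ])` on the real line. -/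
def boundaryValue (k : ℕ) (c : ℕ → ℂ) (t : ℝ) : ℂ :=
  (((t : ℂ) + Complex.I) ^ (2 * k))⁻¹ *
    powerSum c (((t : ℂ) - Complex.I) / ((t : ℂ) + Complex.I))

theorem boundaryValue_eq_tsum (k : ℕ) (c : ℕ → ℂ) (t : ℝ) :
    boundaryValue k c t = ∑' n, c n * cayleyPow n (2 * k) t := by
  rw [boundaryValue, powerSum, ← tsum_mul_left]
  refine tsum_congr fun n => ?_
  rw [cayleyPow]
  ring

-- Put `ξ = σ|u|t`. The lower row of `w n[ξ] a[|u|]` then has `ζ = -σ √|u| (t + i)`, which yields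
-- `|u|^(-k)` times the boundary function, while `dξ` yields `|u|`. The phase is `sgn(u) σ |u| t = σ
-- u t`.
open FourierTransform in
theorem kirillov_toFun (φ : D k σ) {u : ℝ} (hu : u ≠ 0) :
    kirillov (toFun φ) u = ((|u| * (|u| ^ k)⁻¹ : ℝ) : ℂ) *
      𝓕 (boundaryValue k (seq φ)) (((σ : ℤ) : ℝ) * u) := by
  have hv : 0 < |u| := abs_pos.2 hu
  have hs : 0 < √|u| := Real.sqrt_pos.2 hv
  have hσ : ((σ : ℤ) : ℝ) * ((σ : ℤ) : ℝ) = 1 := by exact_mod_cast units_mul_self σ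
  have hσ0 : ((σ : ℤ) : ℝ) ≠ 0 := left_ne_zero_of_mul_eq_one hσ
  have habs : |((σ : ℤ) : ℝ)| = 1 := by
    rcases Int.units_eq_one_or σ with rfl | rfl <;> simp
  rw [kirillov, dif_pos hu, jacquet]
  have hsub := Measure.integral_comp_mul_left
    (jacquetIntegrand (SignType.sign u : ℝ) (toFun φ) (a |u| hv)) (((σ : ℤ) : ℝ) * |u|)
  rw [abs_inv, abs_mul, habs, one_mul, abs_abs] at hsub
  have h1 : ∫ ξ, jacquetIntegrand (SignType.sign u : ℝ) (toFun φ) (a |u| hv) ξ =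
      ((|u| : ℝ) : ℂ) * ∫ t, jacquetIntegrand (SignType.sign u : ℝ) (toFun φ) (a |u| hv)
        (((σ : ℤ) : ℝ) * |u| * t) := by
    rw [hsub, Complex.real_smul, ← mul_assoc, ← Complex.ofReal_mul, mul_inv_cancel₀ hv.ne',
      Complex.ofReal_one, one_mul]
  rw [h1, Complex.ofReal_mul, mul_assoc]
  congr 1
  rw [Real.fourier_real_eq_integral_exp_smul, ← integral_const_mul]
  congr 1
  ext t
  have hmk : w * n (((σ : ℤ) : ℝ) * |u| * t) * a |u| hv =
      QuotientGroup.mk (sl 0 1 (-1) 0 (by ring) * sl 1 (((σ : ℤ) : ℝ) * |u| * t) 0 1 (by ring) *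
        sl (√|u|) 0 0 (1 / √|u|) (by rw [mul_one_div_cancel hs.ne']; ring)) := rfl
  set g : SL := sl 0 1 (-1) 0 (by ring) * sl 1 (((σ : ℤ) : ℝ) * |u| * t) 0 1 (by ring) *
        sl (√|u|) 0 0 (1 / √|u|) (by rw [mul_one_div_cancel hs.ne']; ring) with hg
  have e10 : g 1 0 = -√|u| := by
    rw [hg]
    simp only [mul_apply_sl]
    simp [sl]
  have e11 : g 1 1 = -((σ : ℤ) : ℝ) * √|u| * t := by
    rw [hg]
    simp only [mul_apply_sl]
    simp [sl]
    have : |u| = √|u| * √|u| := (Real.mul_self_sqrt hv.le).symm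
    field_simp
    rw [sq, ← this, mul_comm]
  have hσc : ((σ : ℤ) : ℂ) ≠ 0 := by exact_mod_cast hσ0
  have hsc : ((√|u| : ℝ) : ℂ) ≠ 0 := by exact_mod_cast hs.ne'
  have hz : zetaSL σ g = -(((σ : ℤ) : ℂ) * (√|u| : ℝ)) * ((t : ℂ) + Complex.I) := by
    rw [zetaSL, e10, e11]
    push_cast
    ring
  have hz' : starRingEnd ℂ (zetaSL σ g) =
      -(((σ : ℤ) : ℂ) * (√|u| : ℝ)) * ((t : ℂ) - Complex.I) := by
    rw [conj_zetaSL, e10, e11]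
    push_cast
    ring
  have hpow : zetaSL σ g ^ (2 * k) = ((|u| ^ k : ℝ) : ℂ) * ((t : ℂ) + Complex.I) ^ (2 * k) := by
    rw [hz, mul_pow]
    congr 1
    rw [pow_mul]
    push_cast
    congr 1
    have h2 : ((√|u| : ℝ) : ℂ) ^ 2 = (|u| : ℝ) := by
      rw [← Complex.ofReal_pow, Real.sq_sqrt hv.le]
    have h3 : ((σ : ℤ) : ℂ) ^ 2 = 1 := by rw [sq]; exact_mod_cast hσ
    rw [neg_sq, mul_pow, h2, h3, one_mul]
  have hexp : e (-(SignType.sign u : ℝ) * (((σ : ℤ) : ℝ) * |u| * t)) =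
      Complex.exp (↑(-2 * Real.pi * t * (((σ : ℤ) : ℝ) * u)) * Complex.I) := by
    have hsu : (SignType.sign u : ℝ) * |u| = u := sign_mul_abs u
    rw [e]
    congr 1
    rw [show -(SignType.sign u : ℝ) * (((σ : ℤ) : ℝ) * |u| * t) =
      -(((σ : ℤ) : ℝ) * ((SignType.sign u : ℝ) * |u|) * t) by ring, hsu]
    push_cast
    ring
  rw [jacquetIntegrand, hexp, hmk, toFun_mk, hpow, hz', hz, boundaryValue, smul_eq_mul,
    mul_div_mul_left _ _ (neg_ne_zero.2 (mul_ne_zero hσc hsc))]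
  push_cast
  rw [mul_inv]
  ring

/-! ### The actions of `n[x]`, `a[y]` and `w` -/

theorem n_add (x y : ℝ) : n (x + y) = n x * n y := by
  refine congrArg QuotientGroup.mk (?_ : _ = sl _ _ _ _ _ * sl _ _ _ _ _)
  rw [sl_eta (sl _ _ _ _ _ * sl _ _ _ _ _)]
  apply sl_congr <;> simp only [mul_apply_sl] <;> simp [sl, add_comm]

theorem a_mul_n (v x : ℝ) (hv : 0 < v) : a v hv * n x = n (v * x) * a v hv := by
  refine congrArg QuotientGroup.mk (?_ : sl _ _ _ _ _ * sl _ _ _ _ _ = sl _ _ _ _ _ * sl _ _ _ _ _)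
  rw [sl_eta (sl (√v) _ _ _ _ * _), sl_eta (sl 1 _ _ _ _ * _)]
  have hs : 0 < √v := Real.sqrt_pos.2 hv
  have h2 : v = √v * √v := (Real.mul_self_sqrt hv.le).symm
  apply sl_congr <;> simp only [mul_apply_sl] <;> simp [sl]
  field_simp
  rw [sq, ← h2]
  ring

theorem a_mul_a (v y : ℝ) (hv : 0 < v) (hy : 0 < y) :
    a v hv * a y hy = a (v * y) (mul_pos hv hy) := by
  refine congrArg QuotientGroup.mk (?_ : sl _ _ _ _ _ * sl _ _ _ _ _ = _)
  rw [sl_eta (sl _ _ _ _ _ * sl _ _ _ _ _)]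
  apply sl_congr <;> simp only [mul_apply_sl] <;> simp [sl, Real.sqrt_mul hv.le, mul_comm]

/-- Moving `n[x]` to the left of `a[|u|]` shifts `ξ` by `|u| x`, and the character in the integrand
turns this shift into the factor. -/
theorem kirillov_rightTranslate_n (f : G → ℂ) {u : ℝ} (hu : u ≠ 0) (x : ℝ) :
    kirillov (rightTranslate (n x) f) u = e (u * x) * kirillov f u := by
  have hv : 0 < |u| := abs_pos.2 hu
  rw [kirillov, dif_pos hu, kirillov, dif_pos hu, jacquet, jacquet]
  have h1 : ∀ ξ, jacquetIntegrand (SignType.sign u : ℝ) (rightTranslate (n x) f) (a |u| hv) ξ =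
      e (u * x) * jacquetIntegrand (SignType.sign u : ℝ) f (a |u| hv) (ξ + |u| * x) := by
    intro ξ
    rw [jacquetIntegrand, jacquetIntegrand, rightTranslate, mul_assoc (w * n ξ), a_mul_n, n_add,
      ← mul_assoc (e _), ← e_add]
    have hsu : (SignType.sign u : ℝ) * |u| = u := sign_mul_abs u
    congr 2
    · linear_combination x * hsu
    · simp only [mul_assoc]
  simp only [h1]
  rw [integral_const_mul, integral_add_right_eq_self]

theorem kirillov_rightTranslate_a (f : G → ℂ) {u : ℝ} (hu : u ≠ 0) {y : ℝ} (hy : 0 < y) :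
    kirillov (rightTranslate (a y hy) f) u = kirillov f (u * y) := by
  have hv : 0 < |u| := abs_pos.2 hu
  have huy : u * y ≠ 0 := mul_ne_zero hu hy.ne'
  rw [kirillov, dif_pos hu, kirillov, dif_pos huy, jacquet, jacquet]
  have h1 : SignType.sign (u * y) = SignType.sign u := by
    rw [sign_mul, sign_pos hy, mul_one]
  have h2 : a |u * y| (abs_pos.2 huy) = a |u| hv * a y hy := by
    rw [a_mul_a]
    congr 1
    rw [abs_mul, abs_of_pos hy]
  rw [h1, h2]
  congr 1
  ext ξ
  rw [jacquetIntegrand, jacquetIntegrand, rightTranslate, mul_assoc (w * n ξ)]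

theorem RapidDecay.neg_one_pow_mul {c : ℕ → ℂ} (hc : RapidDecay c) (k : ℕ) :
    RapidDecay fun n => (-1) ^ (k + n) * c n := by
  intro N
  obtain ⟨C, hC⟩ := hc N
  refine ⟨C, fun n => ?_⟩
  rw [norm_mul, norm_pow, norm_neg, norm_one, one_pow, one_mul]
  exact hC n

/-- Right multiplication by `w` replaces `ζ` by `-σ i ζ`. So `ζ^(-2k)` acquires `(-1)^k` and `ζ̄/ζ`
changes sign: `w` is diagonal in the basis `φ_p`. -/
theorem toFun_eq_rightTranslate_w {φ ψ : D k σ} (h : ∀ n, seq ψ n = (-1) ^ (k + n) * seq φ n) :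
    toFun ψ = rightTranslate w (toFun φ) := by
  refine funext fun g => ?_
  obtain ⟨g, rfl⟩ := QuotientGroup.mk_surjective g
  have e1 : rightTranslate w (toFun φ) (QuotientGroup.mk g) =
    toFun φ (QuotientGroup.mk (g * sl 0 1 (-1) 0 (by ring))) := rfl
  have hσ : ((σ : ℤ) : ℂ) * ((σ : ℤ) : ℂ) = 1 := by exact_mod_cast units_mul_self σ
  have hσ0 : ((σ : ℤ) : ℂ) ≠ 0 := left_ne_zero_of_mul_eq_one hσ
  have hz : zetaSL σ (g * sl 0 1 (-1) 0 (by ring)) =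
      -(((σ : ℤ) : ℂ) * Complex.I) * zetaSL σ g := by
    rw [zetaSL, zetaSL, mul_apply_sl, mul_apply_sl]
    simp [sl]
    linear_combination ((g 1 0 : ℂ) * Complex.I ^ 2) * hσ + (g 1 0 : ℂ) * Complex.I_sq
  have hz' : starRingEnd ℂ (zetaSL σ (g * sl 0 1 (-1) 0 (by ring))) =
      (((σ : ℤ) : ℂ) * Complex.I) * starRingEnd ℂ (zetaSL σ g) := by
    rw [hz, map_mul, map_neg, map_mul, Complex.conj_I]
    simp
  have hp : (-(((σ : ℤ) : ℂ) * Complex.I)) ^ (2 * k) = (-1) ^ k := by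
    rw [pow_mul, neg_sq, mul_pow, Complex.I_sq, sq, hσ, one_mul]
  rw [e1, toFun_mk, toFun_mk, hz', hz, mul_pow, hp, neg_mul, div_neg,
    mul_div_mul_left _ _ (mul_ne_zero hσ0 Complex.I_ne_zero), mul_inv, ← inv_pow (-1 : ℂ),
    inv_neg_one, mul_comm ((-1 : ℂ) ^ k), mul_assoc]
  congr 1
  rw [powerSum, powerSum, ← tsum_mul_left]
  refine tsum_congr fun n => ?_
  rw [h, neg_pow (_ / _)]
  ring

open FourierTransform in
theorem RapidDecay.hasSum_fourier_boundaryValue {c : ℕ → ℂ} (hc : RapidDecay c) (v : ℝ) :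
    HasSum (fun n => c n * 𝓕 (cayleyPow n (2 * k)) v) (𝓕 (boundaryValue k c) v) := by
  have hk : 1 ≤ k := Nat.one_le_iff_ne_zero.2 (NeZero.ne k)
  have hk2 : 2 ≤ 2 * k := by omega
  have hb := integral_univ_inv_one_add_sq
  set F : ℕ → ℝ → ℂ := fun n t => Real.fourierChar (-(t * v)) • (c n * cayleyPow n (2 * k) t)
    with hF
  have hnorm : ∀ n t, ‖F n t‖ = ‖c n‖ * ‖cayleyPow n (2 * k) t‖ := by
    intro n t
    rw [hF, Circle.norm_smul, norm_mul]
  have hFi : ∀ n, Integrable (F n) := by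
    intro n
    refine ((integrable_cayleyPow n hk2).norm.const_mul ‖c n‖).mono' ?_
      (Filter.Eventually.of_forall fun t => (hnorm n t).le)
    have := continuous_cayleyPow n (2 * k)
    have := Real.continuous_fourierChar
    exact Continuous.aestronglyMeasurable (by fun_prop)
  have hs : Summable fun n => ∫ t, ‖F n t‖ := by
    refine Summable.of_nonneg_of_le (fun n => integral_nonneg fun t => norm_nonneg _) (fun n => ?_)
      (hc.summable_norm.mul_right Real.pi)
    simp only [hnorm]
    rw [integral_const_mul, ← hb]
    refine mul_le_mul_of_nonneg_left ?_ (norm_nonneg _)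
    exact integral_mono (integrable_cayleyPow n hk2).norm integrable_inv_one_add_sq
      (norm_cayleyPow_le n hk2)
  have key := hasSum_integral_of_summable_integral_norm hFi hs
  have e1 : ∀ n, ∫ t, F n t = c n * 𝓕 (cayleyPow n (2 * k)) v := by
    intro n
    rw [Real.fourier_real_eq, ← integral_const_mul]
    simp only [hF, Circle.smul_def, smul_eq_mul, mul_left_comm]
  have e2 : ∀ t, ∑' n, F n t = Real.fourierChar (-(t * v)) • boundaryValue k c t := by
    intro t
    simp only [hF, Circle.smul_def, smul_eq_mul]
    rw [tsum_mul_left, boundaryValue_eq_tsum]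
  simp only [e1, e2] at key
  rw [Real.fourier_real_eq]
  exact key

open FourierTransform in
theorem fourier_cayleyPow_of_nonpos (n : ℕ) {v : ℝ} (hv : v ≤ 0) :
    𝓕 (cayleyPow n (2 * k)) v = 0 := by
  have hk : 1 ≤ k := Nat.one_le_iff_ne_zero.2 (NeZero.ne k)
  rw [show 2 * k = 2 * k - 2 + 2 by omega, fourier_cayleyPow,
    Set.indicator_of_notMem (by simpa using hv)]

open FourierTransform in
theorem fourier_cayleyPow_of_pos (n : ℕ) {v : ℝ} (hv : 0 < v) :
    𝓕 (cayleyPow n (2 * k)) v = (((-1) ^ k * (2 * Real.pi) ^ (2 * k) * (v ^ (2 * k - 1) *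
      Real.exp (-(2 * Real.pi * v)) * laguerre (2 * k - 1) n (4 * Real.pi * v)) : ℝ) : ℂ) := by
  have hk : 1 ≤ k := Nat.one_le_iff_ne_zero.2 (NeZero.ne k)
  obtain ⟨l, hl⟩ : ∃ l, 2 * k = l + 2 := ⟨2 * k - 2, by omega⟩
  have h1 : (-2 * Real.pi * Complex.I : ℂ) ^ (l + 2) = (-1) ^ k * (2 * Real.pi) ^ (2 * k) := by
    rw [← hl, mul_pow, pow_mul, pow_mul Complex.I, Complex.I_sq, neg_mul, neg_sq, ← pow_mul,
      mul_comm]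
  rw [hl, fourier_cayleyPow, Set.indicator_of_mem (by exact hv), h1, hl,
    show l + 2 - 1 = l + 1 by omega]
  push_cast
  rfl

open FourierTransform in
theorem RapidDecay.fourier_boundaryValue_of_nonpos {c : ℕ → ℂ} (hc : RapidDecay c) {v : ℝ}
    (hv : v ≤ 0) : 𝓕 (boundaryValue k c) v = 0 := by
  rw [← (hc.hasSum_fourier_boundaryValue v).tsum_eq]
  simp [fourier_cayleyPow_of_nonpos _ hv]

theorem kirillov_zero (f : G → ℂ) : kirillov f 0 = 0 := dif_neg (by simp)

theorem IsSmooth.kirillov_eq_zero {φ : D k σ} (hφ : IsSmooth φ) {u : ℝ}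
    (hu : ((σ : ℤ) : ℝ) * u ≤ 0) : kirillov (toFun φ) u = 0 := by
  rcases eq_or_ne u 0 with rfl | h0
  · exact kirillov_zero _
  · rw [kirillov_toFun φ h0, (isSmooth_iff.1 hφ).fourier_boundaryValue_of_nonpos hu, mul_zero]

theorem RapidDecay.integrable_boundaryValue {c : ℕ → ℂ} (hc : RapidDecay c) :
    Integrable (boundaryValue k c) := by
  have hk : 1 ≤ k := Nat.one_le_iff_ne_zero.2 (NeZero.ne k)
  refine (integrable_inv_one_add_sq.mul_const (∑' n, ‖c n‖)).mono'
    (Continuous.aestronglyMeasurable ?_) (Filter.Eventually.of_forall fun t => ?_)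
  · refine Continuous.mul
      (Continuous.inv₀ (by fun_prop) fun t => pow_ne_zero _ (add_I_ne_zero t)) ?_
    refine hc.continuousOn_powerSum.comp_continuous continuous_cayley fun t => ?_
    rw [mem_closedBall_zero_iff]
    exact (norm_sub_I_div_add_I t).le
  · rw [boundaryValue, norm_mul]
    have h1 := norm_inv_add_I_pow_le (m := 2 * k) (by omega) t
    have h2 := hc.norm_powerSum_le (norm_sub_I_div_add_I t).le
    gcongr

open FourierTransform in
theorem continuous_fourier {f : ℝ → ℂ} (hf : Integrable f) : Continuous (𝓕 f) :=
  VectorFourier.fourierIntegral_continuous Real.continuous_fourierChar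
    (show Continuous fun p : ℝ × ℝ => inner ℝ p.1 p.2 from continuous_inner) hf

open FourierTransform in
theorem integrable_fourier_cayleyPow (n : ℕ) {m : ℕ} (hm : 2 ≤ m) :
    Integrable (𝓕 (cayleyPow n m)) :=
  (integrable_inv_one_add_sq.const_mul (2 * (2 * n + m + 2 : ℝ) ^ 2)).mono'
    (continuous_fourier (integrable_cayleyPow n hm)).aestronglyMeasurable
    (Filter.Eventually.of_forall fun v => norm_fourier_cayleyPow_le n hm v)

-- Negative `v`, where the Bessel-Clifford function is not bounded by 1, do not matter: the Fourier
-- transform vanishes there.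
open FourierTransform in
theorem norm_besselClifford_mul_fourier_le (n : ℕ) {y : ℝ} (hy : 0 ≤ y) (v : ℝ) :
    ‖(besselClifford (2 * k - 1) (y * v) : ℂ) * 𝓕 (cayleyPow n (2 * k)) v‖ ≤
      ‖𝓕 (cayleyPow n (2 * k)) v‖ := by
  rcases le_or_gt v 0 with hv | hv
  · rw [fourier_cayleyPow_of_nonpos n hv, mul_zero]
  · rw [norm_mul, Complex.norm_real]
    exact mul_le_of_le_one_left (norm_nonneg _) (abs_besselClifford_le _ (by positivity))

-- The Hankel eigenfunction property rescaled by `s = 2πv`, `y = 2πx`; then `ys = (2π)² x v` and the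
-- Laguerre argument `2s` is `4πv`.
open FourierTransform in
theorem integral_besselClifford_mul_fourier (n : ℕ) {x : ℝ} (hx : 0 < x) :
    ∫ v, (besselClifford (2 * k - 1) ((2 * Real.pi) ^ 2 * x * v) : ℂ) *
        𝓕 (cayleyPow n (2 * k)) v =
      (((2 * Real.pi) ^ (2 * k))⁻¹ * (x * (x ^ (2 * k))⁻¹) : ℝ) *
        ((-1) ^ n * 𝓕 (cayleyPow n (2 * k)) x) := by
  have hk : 1 ≤ k := Nat.one_le_iff_ne_zero.2 (NeZero.ne k)
  have hπ := Real.two_pi_pos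
  set y : ℝ := 2 * Real.pi * x with hy
  have hy0 : 0 < y := by positivity
  set g : ℝ → ℝ := fun s => besselClifford (2 * k - 1) (y * s) *
    (s ^ (2 * k - 1) * Real.exp (-s) * laguerre (2 * k - 1) n (2 * s)) with hg
  have h1 : ∀ v : ℝ, (besselClifford (2 * k - 1) ((2 * Real.pi) ^ 2 * x * v) : ℂ) *
      𝓕 (cayleyPow n (2 * k)) v = (Set.Ioi (0 : ℝ)).indicator
        (fun v => (((-1) ^ k * (2 * Real.pi) * g (2 * Real.pi * v) : ℝ) : ℂ)) v := by
    intro v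
    by_cases hv : 0 < v
    · rw [Set.indicator_of_mem (by exact hv), fourier_cayleyPow_of_pos n hv, hg, hy,
        ← Complex.ofReal_mul]
      congr 1
      have e : (2 * Real.pi) ^ (2 * k) = (2 * Real.pi) * (2 * Real.pi) ^ (2 * k - 1) := by
        rw [← pow_succ']
        congr 1
        omega
      simp only
      rw [e, mul_pow (2 * Real.pi) v (2 * k - 1), show 2 * Real.pi * x * (2 * Real.pi * v) =
        (2 * Real.pi) ^ 2 * x * v by ring, show 2 * (2 * Real.pi * v) = 4 * Real.pi * v by ring]
      ring
    · rw [Set.indicator_of_notMem (by exact hv), fourier_cayleyPow_of_nonpos n (not_lt.1 hv),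
        mul_zero]
  simp only [h1]
  rw [integral_indicator measurableSet_Ioi, integral_complex_ofReal, integral_const_mul,
    integral_comp_mul_left_Ioi g 0 hπ, mul_zero, smul_eq_mul,
    integral_besselClifford_mul_laguerre _ _ hy0.le, fourier_cayleyPow_of_pos n hx]
  push_cast
  rw [show (4 * Real.pi * x) = 2 * y by rw [hy]; ring]
  have e : (x : ℂ) ^ (2 * k) = x * (x : ℂ) ^ (2 * k - 1) := by
    rw [← pow_succ']
    congr 1
    omega
  have hxc : (x : ℂ) ≠ 0 := by exact_mod_cast hx.ne'
  have hπc : (Real.pi : ℂ) ≠ 0 := by exact_mod_cast Real.pi_ne_zero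
  have hye : Complex.exp (-(2 * Real.pi * x)) = Complex.exp (-(y : ℂ)) := by
    rw [hy]
    push_cast
    rfl
  rw [e, hye]
  field_simp

open FourierTransform in
theorem RapidDecay.summable_integral_fourier {c : ℕ → ℂ} (hc : RapidDecay c) :
    Summable fun n => ∫ v, ‖c n‖ * ‖𝓕 (cayleyPow n (2 * k)) v‖ := by
  have hk : 1 ≤ k := Nat.one_le_iff_ne_zero.2 (NeZero.ne k)
  have hk2 : 2 ≤ 2 * k := by omega
  refine Summable.of_nonneg_of_le (fun n => integral_nonneg fun v => by positivity) (fun n => ?_)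
    ((hc.summable_mul_pow 2).mul_left (2 * (2 * k + 2 : ℝ) ^ 2 * Real.pi))
  rw [integral_const_mul]
  have h1 : ∫ v, ‖𝓕 (cayleyPow n (2 * k)) v‖ ≤
      2 * (2 * n + (2 * k : ℕ) + 2 : ℝ) ^ 2 * Real.pi := by
    rw [← integral_univ_inv_one_add_sq, ← integral_const_mul]
    exact integral_mono (integrable_fourier_cayleyPow n hk2).norm
      (integrable_inv_one_add_sq.const_mul _) fun v => norm_fourier_cayleyPow_le n hk2 v
  have h2 : (2 * n + (2 * k : ℕ) + 2 : ℝ) ^ 2 ≤ ((2 * k + 2) * ((n : ℝ) + 1)) ^ 2 := by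
    push_cast
    gcongr
    nlinarith [mul_nonneg (Nat.cast_nonneg k : (0 : ℝ) ≤ k) (Nat.cast_nonneg n : (0 : ℝ) ≤ n)]
  calc _ ≤ ‖c n‖ * (2 * ((2 * k + 2) * ((n : ℝ) + 1)) ^ 2 * Real.pi) := by
        refine mul_le_mul_of_nonneg_left (h1.trans ?_) (norm_nonneg _)
        gcongr
    _ = _ := by ring

open FourierTransform in
theorem RapidDecay.hasSum_integral_besselClifford {c : ℕ → ℂ} (hc : RapidDecay c) {y : ℝ}
    (hy : 0 ≤ y) :
    Integrable (fun v => (besselClifford (2 * k - 1) (y * v) : ℂ) * 𝓕 (boundaryValue k c) v) ∧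
    HasSum (fun n => c n * ∫ v, (besselClifford (2 * k - 1) (y * v) : ℂ) *
        𝓕 (cayleyPow n (2 * k)) v)
      (∫ v, (besselClifford (2 * k - 1) (y * v) : ℂ) * 𝓕 (boundaryValue k c) v) := by
  have hk : 1 ≤ k := Nat.one_le_iff_ne_zero.2 (NeZero.ne k)
  have hk2 : 2 ≤ 2 * k := by omega
  have hB := continuous_besselClifford (2 * k - 1)
  set F : ℕ → ℝ → ℂ := fun n v => c n * ((besselClifford (2 * k - 1) (y * v) : ℂ) *
    𝓕 (cayleyPow n (2 * k)) v) with hF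
  have hFn : ∀ n v, ‖F n v‖ ≤ ‖c n‖ * ‖𝓕 (cayleyPow n (2 * k)) v‖ := by
    intro n v
    rw [hF, norm_mul]
    exact mul_le_mul_of_nonneg_left (norm_besselClifford_mul_fourier_le n hy v) (norm_nonneg _)
  have hFi : ∀ n, Integrable (F n) := by
    intro n
    refine ((integrable_fourier_cayleyPow n hk2).norm.const_mul ‖c n‖).mono' ?_
      (Filter.Eventually.of_forall (hFn n))
    have := continuous_fourier (integrable_cayleyPow n hk2)
    exact Continuous.aestronglyMeasurable (by fun_prop)
  have hs : Summable fun n => ∫ v, ‖F n v‖ := by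
    refine Summable.of_nonneg_of_le (fun n => integral_nonneg fun t => norm_nonneg _) (fun n => ?_)
      (hc.summable_integral_fourier (k := k))
    exact integral_mono (hFi n).norm ((integrable_fourier_cayleyPow n hk2).norm.const_mul ‖c n‖)
      (hFn n)
  have hsum : ∀ v, ∑' n, F n v =
      (besselClifford (2 * k - 1) (y * v) : ℂ) * 𝓕 (boundaryValue k c) v := by
    intro v
    rw [← (hc.hasSum_fourier_boundaryValue v).tsum_eq, ← tsum_mul_left]
    exact tsum_congr fun n => by rw [hF]; ring
  have key := hasSum_integral_of_summable_integral_norm hFi hs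
  simp only [hsum] at key
  refine ⟨?_, hasSum_of_eq key fun n => (integral_const_mul _ _).symm⟩
  have hL : Summable fun n => ‖c n‖ * (2 * (2 * n + (2 * k : ℕ) + 2 : ℝ) ^ 2) := by
    refine Summable.of_nonneg_of_le (fun n => by positivity) (fun n => ?_)
      ((hc.summable_mul_pow 2).mul_left (2 * (2 * k + 2 : ℝ) ^ 2))
    have h2 : (2 * n + (2 * k : ℕ) + 2 : ℝ) ^ 2 ≤ ((2 * k + 2) * ((n : ℝ) + 1)) ^ 2 := by
      push_cast
      gcongr
      nlinarith [mul_nonneg (Nat.cast_nonneg k : (0 : ℝ) ≤ k) (Nat.cast_nonneg n : (0 : ℝ) ≤ n)]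
    calc _ ≤ ‖c n‖ * (2 * ((2 * k + 2) * ((n : ℝ) + 1)) ^ 2) := by gcongr
      _ = _ := by ring
  refine (integrable_inv_one_add_sq.const_mul
    (∑' n, ‖c n‖ * (2 * (2 * n + (2 * k : ℕ) + 2 : ℝ) ^ 2))).mono' ?_
      (Filter.Eventually.of_forall fun v => ?_)
  · have := continuous_fourier (hc.integrable_boundaryValue (k := k))
    exact Continuous.aestronglyMeasurable (by fun_prop)
  · rw [← hsum]
    refine tsum_of_norm_bounded (hL.hasSum.mul_right _) fun n => (hFn n v).trans ?_
    rw [mul_assoc]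
    exact mul_le_mul_of_nonneg_left (norm_fourier_cayleyPow_le n hk2 v) (norm_nonneg _)

theorem mulMeasure_restrict : mulMeasure.restrict ({0}ᶜ : Set ℝ) = mulMeasure := by
  rw [mulMeasure, restrict_withDensity (measurableSet_singleton 0).compl,
    Measure.restrict_eq_self_of_ae_mem]
  exact compl_mem_ae_iff.2 (measure_singleton 0)

theorem measurable_one_div_abs : Measurable fun u : ℝ => ENNReal.ofReal (1 / |u|) := by
  have : Measurable fun u : ℝ => |u| := continuous_abs.measurable
  fun_prop

theorem integrable_mulMeasure_iff (g : ℝ → ℂ) :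
    Integrable g mulMeasure ↔ Integrable fun t : ℝ => (|t|⁻¹ : ℝ) • g t := by
  rw [mulMeasure, integrable_withDensity_iff_integrable_smul' measurable_one_div_abs
    (Filter.Eventually.of_forall fun t => ENNReal.ofReal_lt_top)]
  simp only [one_div, ENNReal.toReal_ofReal (inv_nonneg.2 (abs_nonneg _))]

theorem integral_mulMeasure (g : ℝ → ℂ) :
    ∫ t, g t ∂mulMeasure = ∫ t : ℝ, (|t|⁻¹ : ℝ) • g t := by
  rw [mulMeasure, integral_withDensity_eq_integral_toReal_smul measurable_one_div_abs
    (Filter.Eventually.of_forall fun t => ENNReal.ofReal_lt_top)]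
  simp only [one_div, ENNReal.toReal_ofReal (inv_nonneg.2 (abs_nonneg _))]

open FourierTransform in
/-- The action of the Weyl element in the Kirillov model. -/
theorem IsSmooth.kirillov_rightTranslate_w {φ : D k σ} (hφ : IsSmooth φ) {u : ℝ} (hu : u ≠ 0) :
    IntegrableOn (fun t : ℝ => (repBessel ((k : ℝ) - 1 / 2) (u * t) : ℂ) * kirillov (toFun φ) t)
        {0}ᶜ mulMeasure ∧
      kirillov (rightTranslate w (toFun φ)) u = ∫ t in ({0}ᶜ : Set ℝ),
        (repBessel ((k : ℝ) - 1 / 2) (u * t) : ℂ) * kirillov (toFun φ) t ∂mulMeasure := by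
  have hc := isSmooth_iff.1 hφ
  obtain ⟨ψ, hψ, hseq⟩ := exists_isSmooth_seq (k := k) σ (hc.neg_one_pow_mul k)
  rw [← toFun_eq_rightTranslate_w (φ := φ) (ψ := ψ) (fun n => by rw [hseq]), IntegrableOn,
    mulMeasure_restrict, integrable_mulMeasure_iff, integral_mulMeasure]
  have hσ : ((σ : ℤ) : ℝ) * ((σ : ℤ) : ℝ) = 1 := by exact_mod_cast units_mul_self σ
  have hσ0 : ((σ : ℤ) : ℝ) ≠ 0 := left_ne_zero_of_mul_eq_one hσ
  have habs : |((σ : ℤ) : ℝ)| = 1 := by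
    rcases Int.units_eq_one_or σ with rfl | rfl <;> simp
  set h : ℝ → ℂ := fun t => (|t|⁻¹ : ℝ) •
    ((repBessel ((k : ℝ) - 1 / 2) (u * t) : ℂ) * kirillov (toFun φ) t) with hh
  -- Substituting `t = σ s` moves the support of the transform to `s > 0`.
  have hint := integrable_comp_mul_left_iff h hσ0
  have hval := Measure.integral_comp_mul_left h ((σ : ℤ) : ℝ)
  rw [abs_inv, habs, inv_one, one_smul] at hval
  rw [← hint, ← hval]
  have hneg : ∀ s ≤ 0, h (((σ : ℤ) : ℝ) * s) = 0 := by
    intro s hs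
    rw [hh]
    simp only
    rw [hφ.kirillov_eq_zero, mul_zero, smul_zero]
    rw [← mul_assoc, hσ, one_mul]
    exact hs
  set x : ℝ := ((σ : ℤ) : ℝ) * u with hx
  have hux : u = ((σ : ℤ) : ℝ) * x := by rw [hx, ← mul_assoc, hσ, one_mul]
  have hx0 : x ≠ 0 := mul_ne_zero hσ0 hu
  rcases lt_or_gt_of_ne hx0 with hlt | hgt
  -- For `σ u < 0` the argument `u t` is negative on the support of the transform, so the kernel
  -- vanishes there, and both sides are 0.
  · have h0 : ∀ s, h (((σ : ℤ) : ℝ) * s) = 0 := by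
      intro s
      rcases le_or_gt s 0 with hs | hs
      · exact hneg s hs
      · rw [hh]
        simp only
        rw [repBessel_half_integer, if_neg]
        · simp
        · rw [← mul_assoc, mul_comm u, ← hx]
          nlinarith
    simp only [h0]
    exact ⟨integrable_zero _ _ _, by rw [integral_zero, hψ.kirillov_eq_zero hlt.le]⟩
  · have h1 : ∀ s, h (((σ : ℤ) : ℝ) * s) =
        (((-1) ^ k * (2 * Real.pi) ^ (2 * k) * x ^ k : ℝ) : ℂ) *
        ((besselClifford (2 * k - 1) ((2 * Real.pi) ^ 2 * x * s) : ℂ) *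
          𝓕 (boundaryValue k (seq φ)) s) := by
      intro s
      rcases le_or_gt s 0 with hs | hs
      · rw [hneg s hs, hc.fourier_boundaryValue_of_nonpos hs, mul_zero, mul_zero]
      · rw [hh]
        simp only
        have e1 : u * (((σ : ℤ) : ℝ) * s) = x * s := by rw [hx]; ring
        rw [e1, repBessel_eq_besselClifford k (by positivity),
          kirillov_toFun φ (mul_ne_zero hσ0 hs.ne'), ← mul_assoc (((σ : ℤ) : ℝ)), hσ, one_mul,
          abs_mul, habs, one_mul, abs_of_pos hs, Complex.real_smul, mul_assoc _ x s]
        have hsc : (s : ℂ) ≠ 0 := by exact_mod_cast hs.ne'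
        push_cast
        rw [mul_pow (x : ℂ)]
        field_simp
    obtain ⟨hi, hsum⟩ := hc.hasSum_integral_besselClifford (k := k)
      (y := (2 * Real.pi) ^ 2 * x) (by positivity)
    simp only [h1]
    refine ⟨hi.const_mul _, ?_⟩
    rw [integral_const_mul, kirillov_toFun ψ hu, ← hx, hseq]
    have hux' : |u| = x := by rw [hux, abs_mul, habs, one_mul, abs_of_pos hgt]
    rw [hux']
    have h2 := ((hc.neg_one_pow_mul k).hasSum_fourier_boundaryValue (k := k) x).mul_left
      ((x * (x ^ k)⁻¹ : ℝ) : ℂ)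
    -- Both sides are series over the basis; termwise, the sign `(-1)^(k+n)` of `w` matches `(-1)^k`
    -- from the kernel and the Hankel eigenvalue `(-1)^n`.
    refine h2.unique (hasSum_of_eq (hsum.mul_left _) fun n => ?_)
    rw [integral_besselClifford_mul_fourier n hgt]
    have hxc : (x : ℂ) ≠ 0 := by exact_mod_cast hx0
    have hπc : (Real.pi : ℂ) ≠ 0 := by exact_mod_cast Real.pi_ne_zero
    push_cast
    rw [pow_add, two_mul k, pow_add, pow_add]
    field_simp

/-! ### Injectivity of the Fourier transform and the measure on the half-line -/

open FourierTransform in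
/-- The Fourier transform is injective on integrable functions. -/
theorem ae_eq_zero_of_fourier_eq_zero {h : ℝ → ℂ} (hi : Integrable h) (h0 : ∀ x, 𝓕 h x = 0) :
    ∀ᵐ t : ℝ, h t = 0 := by
  refine ae_eq_zero_of_integral_contDiff_smul_eq_zero hi.locallyIntegrable fun g hg hgc => ?_
  have h1 : HasCompactSupport fun x => (g x : ℂ) := hgc.comp_left Complex.ofReal_zero
  have h2 : ContDiff ℝ ((⊤ : ℕ∞) : WithTop ℕ∞) fun x => (g x : ℂ) :=
    Complex.ofRealCLM.contDiff.comp hg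
  set S : SchwartzMap ℝ ℂ := h1.toSchwartzMap h2 with hS
  set Q : SchwartzMap ℝ ℂ := 𝓕⁻ S with hQ
  have hQS : 𝓕 (Q : ℝ → ℂ) = S := by
    rw [← SchwartzMap.fourier_coe, hQ, FourierTransform.fourier_fourierInv_eq]
  -- A test function is the transform of a Schwartz function, and the transform can be moved onto
  -- `h`, where it vanishes.
  have key := VectorFourier.integral_fourierIntegral_smul_eq_flip (e := Real.fourierChar)
    (μ := volume) (ν := volume) (L := innerₗ ℝ) (f := h) (g := Q) Real.continuous_fourierChar
    (show Continuous fun p : ℝ × ℝ => inner ℝ p.1 p.2 from continuous_inner) hi Q.integrable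
  have e1 : ∀ ξ, VectorFourier.fourierIntegral Real.fourierChar volume (innerₗ ℝ) h ξ = 0 := h0
  have e2 : ∀ x, VectorFourier.fourierIntegral Real.fourierChar volume (innerₗ ℝ).flip
      (Q : ℝ → ℂ) x = g x := by
    intro x
    rw [flip_innerₗ]
    exact congrFun hQS x
  simp only [e1, e2, zero_smul, integral_zero] at key
  rw [key]
  refine integral_congr_ae (Filter.Eventually.of_forall fun x => ?_)
  simp only [smul_eq_mul, Complex.real_smul]
  rw [mul_comm]

theorem measurableSet_halfLine (σ : ℤˣ) : MeasurableSet (halfLine σ) :=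
  (isOpen_lt continuous_const (by fun_prop)).measurableSet

theorem ae_halfMeasure_of_ae {P : ℝ → Prop} (h : ∀ᵐ u : ℝ, u ∈ halfLine σ → P u) :
    ∀ᵐ u ∂halfMeasure σ, P u := by
  rw [halfMeasure]
  refine Measure.ae_smul_measure ?_ _
  rw [ae_restrict_iff' (measurableSet_halfLine σ)]
  exact (withDensity_absolutelyContinuous _ _).ae_le h

theorem ae_halfMeasure_mem (σ : ℤˣ) : ∀ᵐ u ∂halfMeasure σ, u ∈ halfLine σ :=
  ae_halfMeasure_of_ae (Filter.Eventually.of_forall fun _ h => h)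

theorem ne_zero_of_mem_halfLine {u : ℝ} (hu : u ∈ halfLine σ) : u ≠ 0 := by
  rintro rfl
  simp [halfLine] at hu

theorem integrable_halfMeasure_iff (g : ℝ → ℂ) : Integrable g (halfMeasure σ) ↔
    Integrable fun t : ℝ => (|t|⁻¹ : ℝ) • (halfLine σ).indicator g t := by
  rw [halfMeasure, integrable_smul_measure (by simp [Real.pi_pos]) ENNReal.ofReal_ne_top,
    ← integrable_mulMeasure_iff]
  exact (integrable_indicator_iff (measurableSet_halfLine σ)).symm

theorem integral_halfMeasure (g : ℝ → ℂ) : ∫ u, g u ∂halfMeasure σ =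
    (Real.pi⁻¹ : ℝ) • ∫ t : ℝ, (|t|⁻¹ : ℝ) • (halfLine σ).indicator g t := by
  rw [halfMeasure, integral_smul_measure, ENNReal.toReal_ofReal (by positivity), one_div,
    ← integral_mulMeasure, integral_indicator (measurableSet_halfLine σ)]

theorem indicator_halfLine_comp (g : ℝ → ℂ) (s : ℝ) :
    (|((σ : ℤ) : ℝ) * s|⁻¹ : ℝ) • (halfLine σ).indicator g (((σ : ℤ) : ℝ) * s) =
      (Set.Ioi (0 : ℝ)).indicator (fun s => (s⁻¹ : ℝ) • g (((σ : ℤ) : ℝ) * s)) s := by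
  have hσ : ((σ : ℤ) : ℝ) * ((σ : ℤ) : ℝ) = 1 := by exact_mod_cast units_mul_self σ
  have habs : |((σ : ℤ) : ℝ)| = 1 := by
    rcases Int.units_eq_one_or σ with rfl | rfl <;> simp
  have hiff : ((σ : ℤ) : ℝ) * s ∈ halfLine σ ↔ s ∈ Set.Ioi (0 : ℝ) := by
    rw [halfLine, Set.mem_ofPred_eq, ← mul_assoc, hσ, one_mul, Set.mem_Ioi]
  by_cases hs : s ∈ Set.Ioi (0 : ℝ)
  · rw [Set.indicator_of_mem hs, Set.indicator_of_mem (hiff.2 hs), abs_mul, habs, one_mul,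
      abs_of_pos hs]
  · rw [Set.indicator_of_notMem hs, Set.indicator_of_notMem (fun h => hs (hiff.1 h)), smul_zero]

theorem integrable_halfMeasure_iff_Ioi (g : ℝ → ℂ) : Integrable g (halfMeasure σ) ↔
    IntegrableOn (fun s : ℝ => (s⁻¹ : ℝ) • g (((σ : ℤ) : ℝ) * s)) (Set.Ioi 0) := by
  have hσ0 : ((σ : ℤ) : ℝ) ≠ 0 := by
    rcases Int.units_eq_one_or σ with rfl | rfl <;> simp
  rw [integrable_halfMeasure_iff, ← integrable_comp_mul_left_iff _ hσ0,
    ← integrable_indicator_iff measurableSet_Ioi]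
  simp only [indicator_halfLine_comp]

theorem integral_halfMeasure_eq_Ioi (g : ℝ → ℂ) : ∫ u, g u ∂halfMeasure σ =
    (Real.pi⁻¹ : ℝ) • ∫ s in Set.Ioi (0 : ℝ), (s⁻¹ : ℝ) • g (((σ : ℤ) : ℝ) * s) := by
  have habs : |(((σ : ℤ) : ℝ))⁻¹| = 1 := by
    rcases Int.units_eq_one_or σ with rfl | rfl <;> simp
  rw [integral_halfMeasure, ← integral_indicator measurableSet_Ioi]
  have := Measure.integral_comp_mul_left
    (fun t : ℝ => (|t|⁻¹ : ℝ) • (halfLine σ).indicator g t) ((σ : ℤ) : ℝ)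
  rw [habs, one_smul] at this
  rw [← this]
  simp only [indicator_halfLine_comp]

/-! ### The isometry onto `L²` -/

open FourierTransform in
/-- The Kirillov transform of the vector `φ_p`, `p = σ (k + n)`. -/
def kirillovBasis (k : ℕ) (σ : ℤˣ) (n : ℕ) (u : ℝ) : ℂ :=
  ((|u| * (|u| ^ k)⁻¹ : ℝ) : ℂ) * 𝓕 (cayleyPow n (2 * k)) (((σ : ℤ) : ℝ) * u)

theorem kirillovBasis_eq (n : ℕ) {s : ℝ} (hs : 0 < s) :
    kirillovBasis k σ n (((σ : ℤ) : ℝ) * s) = (((-1) ^ k * (2 * Real.pi) ^ (2 * k) * (s ^ k *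
      Real.exp (-(2 * Real.pi * s)) * laguerre (2 * k - 1) n (4 * Real.pi * s)) : ℝ) : ℂ) := by
  have hk : 1 ≤ k := Nat.one_le_iff_ne_zero.2 (NeZero.ne k)
  have hσ : ((σ : ℤ) : ℝ) * ((σ : ℤ) : ℝ) = 1 := by exact_mod_cast units_mul_self σ
  have habs : |((σ : ℤ) : ℝ)| = 1 := by
    rcases Int.units_eq_one_or σ with rfl | rfl <;> simp
  rw [kirillovBasis, ← mul_assoc (((σ : ℤ) : ℝ)), hσ, one_mul, abs_mul, habs, one_mul,
    abs_of_pos hs, fourier_cayleyPow_of_pos n hs, ← Complex.ofReal_mul]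
  congr 1
  have e : s * s ^ (2 * k - 1) = s ^ k * s ^ k := by
    rw [← pow_succ', ← pow_add]
    congr 1
    omega
  generalize laguerre (2 * k - 1) n (4 * Real.pi * s) = A
  generalize Real.exp (-(2 * Real.pi * s)) = E
  calc _ = (s ^ k)⁻¹ * ((-1) ^ k * (2 * Real.pi) ^ (2 * k)) * (s * s ^ (2 * k - 1)) * (E * A) := by
        ring
    _ = _ := by
      rw [e]
      field_simp

theorem measurable_kirillovBasis (n : ℕ) : Measurable (kirillovBasis k σ n) := by
  have hk : 1 ≤ k := Nat.one_le_iff_ne_zero.2 (NeZero.ne k)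
  have h1 := (continuous_fourier (integrable_cayleyPow n (m := 2 * k) (by omega))).measurable
  have h2 : Measurable fun u : ℝ => |u| := continuous_abs.measurable
  unfold kirillovBasis
  fun_prop

/-- In `x = 4πs` this is the Laguerre weight `x^(2k-1) exp(-x)`. The factor `4π` cancels with `dx =
4π ds`, and one `π` with the normalization of the measure, leaving `π^(2k-1)` as in the norm of
`φ_p`. -/
theorem kirillovBasis_product (m n : ℕ) {s : ℝ} (hs : 0 < s) :
    (s⁻¹ : ℝ) • (kirillovBasis k σ n (((σ : ℤ) : ℝ) * s) *
      starRingEnd ℂ (kirillovBasis k σ m (((σ : ℤ) : ℝ) * s))) =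
    ((4 * Real.pi * Real.pi ^ (2 * k) * ((4 * Real.pi * s) ^ (2 * k - 1) *
      Real.exp (-(4 * Real.pi * s)) * (laguerre (2 * k - 1) m (4 * Real.pi * s) *
        laguerre (2 * k - 1) n (4 * Real.pi * s))) : ℝ) : ℂ) := by
  have hk : 1 ≤ k := Nat.one_le_iff_ne_zero.2 (NeZero.ne k)
  rw [kirillovBasis_eq n hs, kirillovBasis_eq m hs, Complex.conj_ofReal, ← Complex.ofReal_mul,
    Complex.real_smul, ← Complex.ofReal_mul]
  congr 1
  have e : s * s ^ (2 * k - 1) = s ^ k * s ^ k := by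
    rw [← pow_succ', ← pow_add]
    congr 1
    omega
  have e2 : (-1 : ℝ) ^ k * (-1) ^ k = 1 := by rw [← mul_pow]; simp
  have e3 : Real.exp (-(2 * Real.pi * s)) * Real.exp (-(2 * Real.pi * s)) =
      Real.exp (-(4 * Real.pi * s)) := by
    rw [← Real.exp_add]
    ring_nf
  have e4 : (2 * Real.pi) ^ (2 * k) * (2 * Real.pi) ^ (2 * k) =
      4 * Real.pi * Real.pi ^ (2 * k) * (4 * Real.pi) ^ (2 * k - 1) := by
    have : 4 * Real.pi * (4 * Real.pi) ^ (2 * k - 1) = (4 * Real.pi) ^ (2 * k) := by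
      rw [← pow_succ']
      congr 1
      omega
    rw [mul_right_comm, this, ← mul_pow, ← mul_pow]
    congr 1
    ring
  rw [mul_pow (4 * Real.pi) s, ← e3]
  generalize laguerre (2 * k - 1) m (4 * Real.pi * s) = A
  generalize laguerre (2 * k - 1) n (4 * Real.pi * s) = B
  generalize Real.exp (-(2 * Real.pi * s)) = E
  calc _ = s⁻¹ * ((-1 : ℝ) ^ k * (-1) ^ k) * ((2 * Real.pi) ^ (2 * k) * (2 * Real.pi) ^ (2 * k)) *
        (s ^ k * s ^ k) * (E * E) * (A * B) := by ring
    _ = _ := by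
      rw [e2, e4, ← e]
      field_simp

theorem integrable_kirillovBasis_product (m n : ℕ) :
    Integrable (fun u => kirillovBasis k σ n u * starRingEnd ℂ (kirillovBasis k σ m u))
      (halfMeasure σ) := by
  rw [integrable_halfMeasure_iff_Ioi]
  have h4 : (0 : ℝ) < 4 * Real.pi := by positivity
  have h1 := (integrableOn_Ioi_comp_mul_left_iff
    (fun x => x ^ (2 * k - 1) * Real.exp (-x) * (laguerre (2 * k - 1) m x *
      laguerre (2 * k - 1) n x)) 0 h4).2 (by
        rw [mul_zero]
        exact integrableOn_laguerre_mul_laguerre _ _ _)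
  refine Integrable.congr ((h1.const_mul (4 * Real.pi * Real.pi ^ (2 * k))).ofReal (𝕜 := ℂ)) ?_
  filter_upwards [ae_restrict_mem measurableSet_Ioi] with s hs
  exact (kirillovBasis_product m n hs).symm

theorem integral_kirillovBasis_product (m n : ℕ) :
    ∫ u, kirillovBasis k σ n u * starRingEnd ℂ (kirillovBasis k σ m u) ∂halfMeasure σ =
      if m = n then
        ((Real.pi ^ (2 * k - 1) * ((n.factorial : ℝ) / (2 * k - 1 + n).factorial) : ℝ) : ℂ)
      else 0 := by
  have hk : 1 ≤ k := Nat.one_le_iff_ne_zero.2 (NeZero.ne k)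
  have h4 : (0 : ℝ) < 4 * Real.pi := by positivity
  rw [integral_halfMeasure_eq_Ioi, setIntegral_congr_fun measurableSet_Ioi
    fun s hs => kirillovBasis_product m n hs, integral_complex_ofReal, integral_const_mul,
    integral_comp_mul_left_Ioi (fun x => x ^ (2 * k - 1) * Real.exp (-x) *
      (laguerre (2 * k - 1) m x * laguerre (2 * k - 1) n x)) 0 h4, mul_zero,
    integral_laguerre_mul_laguerre, Complex.real_smul, ← Complex.ofReal_mul]
  split_ifs with h
  · congr 1
    have : Real.pi ^ (2 * k) = Real.pi * Real.pi ^ (2 * k - 1) := by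
      rw [← pow_succ']
      congr 1
      omega
    rw [this, smul_eq_mul]
    field_simp
  · simp

theorem memLp_kirillovBasis (n : ℕ) : MemLp (kirillovBasis k σ n) 2 (halfMeasure σ) := by
  rw [memLp_two_iff_integrable_sq_norm (measurable_kirillovBasis n).aestronglyMeasurable]
  refine (integrable_kirillovBasis_product (k := k) (σ := σ) n n).norm.congr
    (Filter.Eventually.of_forall fun u => ?_)
  simp only [norm_mul, RCLike.norm_conj, sq]

/-- The Kirillov transform of the vector `φ_p`, `p = σ (k + n)`, as an element of `L²`. -/
def basisL2 (k : ℕ) [NeZero k] (σ : ℤˣ) (n : ℕ) : L2Half σ := (memLp_kirillovBasis (k := k) n).toLp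

theorem coeFn_basisL2 (n : ℕ) : basisL2 k σ n =ᵐ[halfMeasure σ] kirillovBasis k σ n :=
  MemLp.coeFn_toLp _

theorem inner_basisL2 (m n : ℕ) : inner ℂ (basisL2 k σ m) (basisL2 k σ n) = if m = n then
    ((Real.pi ^ (2 * k - 1) * ((n.factorial : ℝ) / (2 * k - 1 + n).factorial) : ℝ) : ℂ)
      else 0 := by
  rw [← integral_kirillovBasis_product (σ := σ), L2.inner_def]
  refine integral_congr_ae ?_
  filter_upwards [coeFn_basisL2 (k := k) (σ := σ) m, coeFn_basisL2 (k := k) (σ := σ) n] with u h1 h2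
  rw [h1, h2, RCLike.inner_apply]

theorem norm_basisL2_sq (n : ℕ) : ‖basisL2 k σ n‖ ^ 2 =
    Real.pi ^ (2 * k - 1) * ((n.factorial : ℝ) / (2 * k - 1 + n).factorial) := by
  rw [← inner_self_eq_norm_sq (𝕜 := ℂ), inner_basisL2, if_pos rfl, RCLike.re_to_complex,
    Complex.ofReal_re]

/-- The Kirillov transform on the line `ℂ φ_p`. -/
def lineIsometry (k : ℕ) [NeZero k] (σ : ℤˣ) (p : Weight k σ) : Line k σ p →ₗᵢ[ℂ] L2Half σ where
  toFun v := v.val • basisL2 k σ ((weightEquiv k σ).symm p)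
  map_add' v v' := add_smul v.val v'.val _
  map_smul' c v := mul_smul c v.val _
  norm_map' v := by
    obtain ⟨n, rfl⟩ := (weightEquiv k σ).surjective p
    change ‖v.val • basisL2 k σ _‖ = ‖v‖
    rw [Equiv.symm_apply_apply, ← sq_eq_sq₀ (norm_nonneg _) (norm_nonneg _), norm_smul, mul_pow,
      norm_basisL2_sq, norm_sq_line, normSqPhi_weightEquiv, mul_comm]

theorem lineIsometry_apply (p : Weight k σ) (v : Line k σ p) :
    lineIsometry k σ p v = v.val • basisL2 k σ ((weightEquiv k σ).symm p) := rfl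

theorem orthogonalFamily_lineIsometry (k : ℕ) [NeZero k] (σ : ℤˣ) :
    OrthogonalFamily ℂ (Line k σ) (lineIsometry k σ) := by
  intro p q hpq v v'
  rw [lineIsometry_apply, lineIsometry_apply, inner_smul_left, inner_smul_right, inner_basisL2,
    if_neg (fun h => hpq ((weightEquiv k σ).symm.injective h)), mul_zero, mul_zero]

/-- The Kirillov operator as an isometry of Hilbert spaces. -/
def kirillovIsometry (k : ℕ) [NeZero k] (σ : ℤˣ) : D k σ →ₗᵢ[ℂ] L2Half σ :=
  (orthogonalFamily_lineIsometry k σ).linearIsometry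

theorem hasSum_kirillovIsometry (φ : D k σ) :
    HasSum (fun n => seq φ n • basisL2 k σ n) (kirillovIsometry k σ φ) := by
  have h := (orthogonalFamily_lineIsometry k σ).hasSum_linearIsometry φ
  rw [← (weightEquiv k σ).hasSum_iff] at h
  refine hasSum_of_eq h fun n => ?_
  rw [Function.comp, lineIsometry_apply, Equiv.symm_apply_apply]
  rfl

theorem IsSmooth.hasSum_kirillov {φ : D k σ} (hφ : IsSmooth φ) {u : ℝ} (hu : u ≠ 0) :
    HasSum (fun n => seq φ n * kirillovBasis k σ n u) (kirillov (toFun φ) u) := by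
  rw [kirillov_toFun φ hu]
  refine hasSum_of_eq (((isSmooth_iff.1 hφ).hasSum_fourier_boundaryValue _).mul_left _) fun n => ?_
  rw [kirillovBasis]
  ring

/-- The partial sums converge in `L²`, so a subsequence converges almost everywhere; it must agree
with the pointwise limit, which is the integral transform. -/
theorem IsSmooth.kirillovIsometry_ae {φ : D k σ} (hφ : IsSmooth φ) :
    kirillovIsometry k σ φ =ᵐ[halfMeasure σ] kirillov (toFun φ) := by
  have h1 := (hasSum_kirillovIsometry φ).tendsto_sum_nat
  obtain ⟨ns, hns, hae⟩ := (tendstoInMeasure_of_tendsto_Lp h1).exists_seq_tendsto_ae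
  have h2 : ∀ᵐ u ∂halfMeasure σ, ∀ n, (seq φ n • basisL2 k σ n : L2Half σ) u =
      seq φ n * kirillovBasis k σ n u := by
    rw [ae_all_iff]
    intro n
    filter_upwards [Lp.coeFn_smul (seq φ n) (basisL2 k σ n), coeFn_basisL2 (k := k) (σ := σ) n]
      with u e1 e2
    rw [e1, Pi.smul_apply, e2, smul_eq_mul]
  have h3 : ∀ᵐ u ∂halfMeasure σ, ∀ N, (∑ n ∈ Finset.range N, seq φ n • basisL2 k σ n : L2Half σ) u =
      ∑ n ∈ Finset.range N, (seq φ n • basisL2 k σ n : L2Half σ) u := by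
    rw [ae_all_iff]
    intro N
    filter_upwards [Lp.coeFn_finsetSum (Finset.range N) fun n => seq φ n • basisL2 k σ n] with u e1
    rw [e1, Finset.sum_apply]
  filter_upwards [hae, h2, h3, ae_halfMeasure_mem σ] with u e1 e2 e3 hu
  have h4 := (hφ.hasSum_kirillov (ne_zero_of_mem_halfLine hu)).tendsto_sum_nat.comp
    hns.tendsto_atTop
  refine tendsto_nhds_unique e1 (h4.congr fun i => ?_)
  rw [e3, Function.comp]
  exact Finset.sum_congr rfl fun n _ => (e2 n).symm

theorem rapidDecay_single : RapidDecay (Pi.single 0 1) := by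
  intro N
  refine ⟨1, fun n => ?_⟩
  cases n with
  | zero => simp
  | succ n => simp

/-- The Laguerre polynomial of degree 0 is a nonzero constant, so no zeros arise; surjectivity
divides by this function. -/
theorem kirillovBasis_zero_ne_zero {u : ℝ} (hu : u ∈ halfLine σ) : kirillovBasis k σ 0 u ≠ 0 := by
  have hσ : ((σ : ℤ) : ℝ) * ((σ : ℤ) : ℝ) = 1 := by exact_mod_cast units_mul_self σ
  have hs : 0 < ((σ : ℤ) : ℝ) * u := hu
  have h := kirillovBasis_eq (k := k) (σ := σ) 0 hs
  rw [← mul_assoc, hσ, one_mul] at h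
  rw [h]
  norm_cast
  have hL : laguerre (2 * k - 1) 0 (4 * Real.pi * (((σ : ℤ) : ℝ) * u)) ≠ 0 := by
    simp [laguerre, Nat.factorial_ne_zero]
  have := hs.ne'
  have hpi := Real.pi_ne_zero
  have he := (Real.exp_pos (-(2 * Real.pi * (((σ : ℤ) : ℝ) * u)))).ne'
  refine mul_ne_zero (by simp [hpi]) (mul_ne_zero (mul_ne_zero (pow_ne_zero _ this) he) hL)

theorem conj_e (x : ℝ) : starRingEnd ℂ (e x) = e (-x) := by
  rw [e, e, ← Complex.exp_conj]
  congr 1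
  simp only [map_mul, Complex.conj_I, Complex.conj_ofReal, map_ofNat]
  push_cast
  ring

-- The range is closed, so let `f` be orthogonal to it. Pairing `f` with the translates by `n[x]` of
-- the vector of index 0, for all `x`, says that `f` times the conjugate of a nowhere vanishing
-- function has zero Fourier transform. Completeness of the Laguerre functions is thus a
-- consequence, not an input.
open FourierTransform in
theorem kirillovIsometry_surjective : Function.Surjective (kirillovIsometry k σ) := by
  have hcl : IsClosed (LinearMap.range (kirillovIsometry k σ).toLinearMap : Set (L2Half σ)) := by
    rw [LinearMap.coe_range]
    exact (kirillovIsometry k σ).isometry.isClosedEmbedding.isClosed_range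
  have : CompleteSpace (LinearMap.range (kirillovIsometry k σ).toLinearMap) :=
    hcl.completeSpace_coe
  rw [← LinearIsometry.coe_toLinearMap, ← LinearMap.range_eq_top,
    ← Submodule.orthogonal_eq_bot_iff, Submodule.eq_bot_iff]
  intro f hf
  obtain ⟨φ, hφ, hseq⟩ := exists_isSmooth_seq (k := k) σ rapidDecay_single
  have hK : ∀ u, u ≠ 0 → kirillov (toFun φ) u = kirillovBasis k σ 0 u := by
    intro u hu
    refine (hφ.hasSum_kirillov hu).unique (hasSum_of_eq (hasSum_ite_eq 0 _) fun n => ?_)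
    rw [hseq]
    rcases eq_or_ne n 0 with rfl | hn
    · simp
    · simp [hn]
  have hortho : ∀ x : ℝ, ∫ u, f u * (e (-(u * x)) * starRingEnd ℂ (kirillovBasis k σ 0 u))
      ∂halfMeasure σ = 0 := by
    intro x
    obtain ⟨ψ, hψ, hfun⟩ := hφ.exists_rightTranslate (n x)
    have h1 := (Submodule.mem_orthogonal _ _).1 hf (kirillovIsometry k σ ψ) ⟨ψ, rfl⟩
    rw [L2.inner_def] at h1
    rw [← h1]
    refine integral_congr_ae ?_
    filter_upwards [hψ.kirillovIsometry_ae, ae_halfMeasure_mem σ] with u e1 hu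
    have hu0 := ne_zero_of_mem_halfLine hu
    rw [e1, RCLike.inner_apply, hfun, kirillov_rightTranslate_n _ hu0, hK u hu0, map_mul, conj_e]
  have hi0 : Integrable (fun u => f u * starRingEnd ℂ (kirillovBasis k σ 0 u)) (halfMeasure σ) := by
    refine (L2.integrable_inner (𝕜 := ℂ) (basisL2 k σ 0) f).congr ?_
    filter_upwards [coeFn_basisL2 (k := k) (σ := σ) 0] with u e1
    rw [e1, RCLike.inner_apply]
  rw [integrable_halfMeasure_iff] at hi0
  have hzero := ae_eq_zero_of_fourier_eq_zero hi0 fun x => by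
    have h1 := hortho x
    rw [integral_halfMeasure, smul_eq_zero] at h1
    rw [← h1.resolve_left (by positivity), Real.fourier_real_eq_integral_exp_smul]
    refine integral_congr_ae (Filter.Eventually.of_forall fun t => ?_)
    simp only
    by_cases ht : t ∈ halfLine σ
    · rw [Set.indicator_of_mem ht, Set.indicator_of_mem ht, e, Complex.real_smul, Complex.real_smul,
        smul_eq_mul]
      have : (2 * Real.pi * Complex.I * ((-(t * x) : ℝ) : ℂ) : ℂ) =
          ((-2 * Real.pi * t * x : ℝ) : ℂ) * Complex.I := by
        push_cast
        ring
      rw [this]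
      ring
    · rw [Set.indicator_of_notMem ht, Set.indicator_of_notMem ht, smul_zero, smul_zero]
  rw [Lp.eq_zero_iff_ae_eq_zero]
  refine ae_halfMeasure_of_ae ?_
  filter_upwards [hzero] with u h1 hu
  rw [Set.indicator_of_mem hu, smul_eq_zero, mul_eq_zero] at h1
  refine (h1.resolve_left (inv_ne_zero (abs_ne_zero.2 (ne_zero_of_mem_halfLine hu)))).resolve_right
    fun h => kirillovBasis_zero_ne_zero hu ((map_eq_zero _).1 h)

/-- The Kirillov operator as a unitary map. -/
def kirillovEquiv (k : ℕ) [NeZero k] (σ : ℤˣ) : D k σ ≃ₗᵢ[ℂ] L2Half σ :=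
  LinearIsometryEquiv.ofSurjective (kirillovIsometry k σ) kirillovIsometry_surjective

theorem IsSmooth.kirillovEquiv_ae {φ : D k σ} (hφ : IsSmooth φ) :
    kirillovEquiv k σ φ =ᵐ[halfMeasure σ] kirillov (toFun φ) :=
  hφ.kirillovIsometry_ae

/-! ### Invariance of the norm under translation -/

theorem IsSmooth.integral_kirillov_mul_conj {φ : D k σ} (hφ : IsSmooth φ) :
    ∫ u, kirillov (toFun φ) u * starRingEnd ℂ (kirillov (toFun φ) u) ∂halfMeasure σ =
      ((‖φ‖ ^ 2 : ℝ) : ℂ) := by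
  have h := inner_self_eq_norm_sq_to_K (𝕜 := ℂ) (kirillovEquiv k σ φ)
  rw [LinearIsometryEquiv.norm_map, L2.inner_def] at h
  push_cast
  refine Eq.trans (integral_congr_ae ?_) h
  filter_upwards [hφ.kirillovEquiv_ae] with u e1
  rw [e1, RCLike.inner_apply]

theorem norm_eq_of_rightTranslate_n {φ ψ : D k σ} (hφ : IsSmooth φ) (hψ : IsSmooth ψ) (x : ℝ)
    (h : toFun ψ = rightTranslate (n x) (toFun φ)) : ‖ψ‖ = ‖φ‖ := by
  rw [← sq_eq_sq₀ (norm_nonneg _) (norm_nonneg _), ← Complex.ofReal_inj,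
    ← hψ.integral_kirillov_mul_conj, ← hφ.integral_kirillov_mul_conj]
  refine integral_congr_ae ?_
  filter_upwards [ae_halfMeasure_mem σ] with u hu
  rw [h, kirillov_rightTranslate_n _ (ne_zero_of_mem_halfLine hu), Complex.mul_conj,
    Complex.mul_conj, Complex.normSq_eq_norm_sq, Complex.normSq_eq_norm_sq, norm_mul, norm_e,
    one_mul]

/-- In the Kirillov model `a[y]` is a dilation, and `d^×` is dilation invariant. -/
theorem norm_eq_of_rightTranslate_a {φ ψ : D k σ} (hφ : IsSmooth φ) (hψ : IsSmooth ψ) {y : ℝ}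
    (hy : 0 < y) (h : toFun ψ = rightTranslate (a y hy) (toFun φ)) : ‖ψ‖ = ‖φ‖ := by
  have hσ0 : ((σ : ℤ) : ℝ) ≠ 0 := by
    rcases Int.units_eq_one_or σ with rfl | rfl <;> simp
  rw [← sq_eq_sq₀ (norm_nonneg _) (norm_nonneg _), ← Complex.ofReal_inj,
    ← hψ.integral_kirillov_mul_conj, ← hφ.integral_kirillov_mul_conj, integral_halfMeasure_eq_Ioi,
    integral_halfMeasure_eq_Ioi]
  congr 1
  set g : ℝ → ℂ := fun s => (s⁻¹ : ℝ) • (kirillov (toFun φ) (((σ : ℤ) : ℝ) * s) *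
    starRingEnd ℂ (kirillov (toFun φ) (((σ : ℤ) : ℝ) * s))) with hg
  have h1 := integral_comp_mul_left_Ioi g 0 hy
  rw [mul_zero, eq_inv_smul_iff₀ hy.ne', ← integral_smul] at h1
  rw [← h1]
  refine setIntegral_congr_fun measurableSet_Ioi fun s hs => ?_
  have hs : 0 < s := hs
  simp only [hg]
  rw [h, kirillov_rightTranslate_a _ (mul_ne_zero hσ0 hs.ne'), smul_smul, mul_inv, ← mul_assoc y,
    mul_inv_cancel₀ hy.ne', one_mul, mul_assoc, mul_comm s y]

theorem norm_eq_of_rightTranslate_w {φ ψ : D k σ} (hφ : IsSmooth φ) (hψ : IsSmooth ψ)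
    (h : toFun ψ = rightTranslate w (toFun φ)) : ‖ψ‖ = ‖φ‖ := by
  obtain ⟨ψ', hψ', hseq⟩ := exists_isSmooth_seq (k := k) σ
    ((isSmooth_iff.1 hφ).neg_one_pow_mul k)
  have h' : ψ = ψ' := hψ.ext_toFun hψ' (h.trans
    (toFun_eq_rightTranslate_w (φ := φ) (ψ := ψ') fun n => by rw [hseq]).symm)
  rw [h', ← sq_eq_sq₀ (norm_nonneg _) (norm_nonneg _)]
  refine (hasSum_norm_sq ψ').unique (hasSum_of_eq (hasSum_norm_sq φ) fun n => ?_)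
  rw [hseq, norm_mul, norm_pow, norm_neg, norm_one, one_pow, one_mul]

theorem mk_neg (g : SL) : (QuotientGroup.mk (-g) : G) = QuotientGroup.mk g := by
  rw [QuotientGroup.eq, Matrix.SpecialLinearGroup.mem_center_iff]
  refine ⟨-1, by simp, ?_⟩
  have : (-g)⁻¹ * g = -1 := by
    rw [inv_mul_eq_iff_eq_mul, mul_neg, mul_one, neg_neg]
  rw [this]
  ext i j
  fin_cases i <;> fin_cases j <;> simp

theorem w_mul_w : w * w = 1 := by
  have h : w * w = QuotientGroup.mk (-1 : SL) := congrArg QuotientGroup.mk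
    (?_ : sl _ _ _ _ _ * sl _ _ _ _ _ = -1)
  · rw [h, mk_neg]
    rfl
  · rw [sl_eta (sl _ _ _ _ _ * sl _ _ _ _ _), sl_eta (-1)]
    apply sl_congr <;> simp only [mul_apply_sl] <;> simp [sl]

/-- The group `G` is generated by the elements `n[x]`, `a[y]` and `w`. -/
theorem induction_generators {P : G → Prop} (hn : ∀ x, P (n x)) (ha : ∀ y hy, P (a y hy)) (hw : P w)
    (hmul : ∀ g h, P g → P h → P (g * h)) (g : G) : P g := by
  have hneg : ∀ g : SL, g 1 0 < 0 → P (QuotientGroup.mk g) := by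
    intro g hc
    have hdet : g 0 0 * g 1 1 - g 0 1 * g 1 0 = 1 := by
      rw [← Matrix.det_fin_two, g.det_coe]
    have hy : 0 < 1 / (g 1 0) ^ 2 := one_div_pos.2 (sq_pos_of_neg hc)
    have hs : √(1 / (g 1 0) ^ 2) = -(g 1 0)⁻¹ := by
      rw [Real.sqrt_div zero_le_one, Real.sqrt_one, Real.sqrt_sq_eq_abs, abs_of_neg hc, one_div,
        inv_neg]
    -- The Bruhat decomposition. For `c < 0` it holds in `SL(2, ℝ)` itself, since `√(1/c²) = -1/c`;
    -- for `c > 0` pass to `-g`.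
    have h : (QuotientGroup.mk g : G) =
        n (g 0 0 / g 1 0) * a (1 / (g 1 0) ^ 2) hy * w * n (g 1 1 / g 1 0) := by
      refine congrArg QuotientGroup.mk (?_ : _ = sl _ _ _ _ _ * sl _ _ _ _ _ * sl _ _ _ _ _ *
        sl _ _ _ _ _)
      have hc0 := hc.ne
      conv_lhs => rw [sl_eta g]
      rw [sl_eta (_ * sl _ _ _ _ _)]
      apply sl_congr <;> simp only [mul_apply_sl, hs] <;> simp [sl] <;> field_simp
      linear_combination -hdet
    rw [h]
    exact hmul _ _ (hmul _ _ (hmul _ _ (hn _) (ha _ _)) hw) (hn _)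
  have hne : ∀ g : SL, g 1 0 ≠ 0 → P (QuotientGroup.mk g) := by
    intro g hc
    rcases lt_or_gt_of_ne hc with h | h
    · exact hneg g h
    · rw [← mk_neg]
      refine hneg (-g) ?_
      simpa using h
  obtain ⟨g, rfl⟩ := QuotientGroup.mk_surjective g
  by_cases hc : g 1 0 = 0
  · have h1 : (QuotientGroup.mk g : G) =
        QuotientGroup.mk (g * sl 0 1 (-1) 0 (by norm_num)) * w := by
      have : (QuotientGroup.mk (g * sl 0 1 (-1) 0 (by norm_num)) : G) =
        QuotientGroup.mk g * w := rfl
      rw [this, mul_assoc, w_mul_w, mul_one]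
    rw [h1]
    refine hmul _ _ (hne _ ?_) hw
    rw [mul_apply_sl, hc]
    have hdet : g 0 0 * g 1 1 - g 0 1 * g 1 0 = 1 := by
      rw [← Matrix.det_fin_two, g.det_coe]
    have : g 1 1 ≠ 0 := by
      intro h
      simp [h, hc] at hdet
    simpa [sl] using this
  · exact hne g hc

theorem rightTranslate_mul (g h : G) (f : G → ℂ) :
    rightTranslate (g * h) f = rightTranslate g (rightTranslate h f) := by
  ext x
  rw [rightTranslate, rightTranslate, rightTranslate, mul_assoc]

/-- Induction over the generators; the intermediate translate in a product is again a smooth vector,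
which is what lets the steps compose. -/
theorem norm_eq_of_rightTranslate (h : G) {φ ψ : D k σ} (hφ : IsSmooth φ) (hψ : IsSmooth ψ)
    (hfun : toFun ψ = rightTranslate h (toFun φ)) : ‖ψ‖ = ‖φ‖ := by
  refine induction_generators (P := fun h => ∀ φ ψ : D k σ, IsSmooth φ → IsSmooth ψ →
    toFun ψ = rightTranslate h (toFun φ) → ‖ψ‖ = ‖φ‖)
    (fun x φ ψ hφ hψ h => norm_eq_of_rightTranslate_n hφ hψ x h)
    (fun y hy φ ψ hφ hψ h => norm_eq_of_rightTranslate_a hφ hψ hy h)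
    (fun φ ψ hφ hψ h => norm_eq_of_rightTranslate_w hφ hψ h) ?_ h φ ψ hφ hψ hfun
  intro g h hg hh φ ψ hφ hψ hfun
  obtain ⟨χ, hχ, hχf⟩ := hφ.exists_rightTranslate h
  rw [rightTranslate_mul, ← hχf] at hfun
  rw [hg χ ψ hχ hψ hfun, hh φ χ hφ hχ hχf]

/-! ### The unitary representation and its continuity -/

theorem seq_add (φ ψ : D k σ) (n : ℕ) : seq (φ + ψ) n = seq φ n + seq ψ n := rfl

theorem seq_smul (c : ℂ) (φ : D k σ) (n : ℕ) : seq (c • φ) n = c * seq φ n := rfl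

theorem RapidDecay.add {c d : ℕ → ℂ} (hc : RapidDecay c) (hd : RapidDecay d) :
    RapidDecay fun n => c n + d n := by
  intro N
  obtain ⟨A, hA⟩ := hc N
  obtain ⟨B, hB⟩ := hd N
  refine ⟨A + B, fun n => ?_⟩
  calc _ ≤ (‖c n‖ + ‖d n‖) * ((n : ℝ) + 1) ^ N := by
        gcongr
        exact norm_add_le _ _
    _ ≤ _ := by
        rw [add_mul]
        exact add_le_add (hA n) (hB n)

theorem RapidDecay.const_mul {c : ℕ → ℂ} (hc : RapidDecay c) (b : ℂ) :
    RapidDecay fun n => b * c n := by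
  intro N
  obtain ⟨A, hA⟩ := hc N
  refine ⟨‖b‖ * A, fun n => ?_⟩
  rw [norm_mul, mul_assoc]
  exact mul_le_mul_of_nonneg_left (hA n) (norm_nonneg _)

theorem rapidDecay_zero : RapidDecay fun _ => 0 := fun N => ⟨0, fun n => by simp⟩

/-- The space of smooth vectors. -/
def smoothVectors (k : ℕ) [NeZero k] (σ : ℤˣ) : Submodule ℂ (D k σ) where
  carrier := {φ | IsSmooth φ}
  add_mem' hφ hψ := isSmooth_iff.2 ((isSmooth_iff.1 hφ).add (isSmooth_iff.1 hψ))
  zero_mem' := isSmooth_iff.2 rapidDecay_zero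
  smul_mem' c _ hφ := isSmooth_iff.2 ((isSmooth_iff.1 hφ).const_mul c)

theorem IsSmooth.toFun_add {φ ψ : D k σ} (hφ : IsSmooth φ) (hψ : IsSmooth ψ) :
    toFun (φ + ψ) = toFun φ + toFun ψ := by
  ext g
  rw [Pi.add_apply, toFun, toFun, toFun, ← (hφ.summable_term g).tsum_add (hψ.summable_term g)]
  exact tsum_congr fun p => add_mul (coeff φ p) (coeff ψ p) _

theorem toFun_smul (c : ℂ) (φ : D k σ) : toFun (c • φ) = c • toFun φ := by
  ext g
  rw [Pi.smul_apply, toFun, toFun, smul_eq_mul, ← tsum_mul_left]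
  exact tsum_congr fun p => mul_assoc c (coeff φ p) _

/-- The right translate of a smooth vector. -/
def translate (h : G) (φ : smoothVectors k σ) : smoothVectors k σ :=
  ⟨(IsSmooth.exists_rightTranslate φ.2 h).choose,
    (IsSmooth.exists_rightTranslate φ.2 h).choose_spec.1⟩

theorem toFun_translate (h : G) (φ : smoothVectors k σ) :
    toFun (translate h φ : D k σ) = rightTranslate h (toFun (φ : D k σ)) :=
  (IsSmooth.exists_rightTranslate φ.2 h).choose_spec.2

/-- It makes the chosen translate unique, so linearity and the group law reduce to identities
between functions. -/
theorem smoothVectors_ext {φ ψ : smoothVectors k σ}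
    (h : toFun (φ : D k σ) = toFun (ψ : D k σ)) : φ = ψ :=
  Subtype.ext (IsSmooth.ext_toFun φ.2 ψ.2 h)

theorem translate_mul (g h : G) (φ : smoothVectors k σ) :
    translate (g * h) φ = translate g (translate h φ) :=
  smoothVectors_ext (by simp only [toFun_translate, rightTranslate_mul])

theorem translate_one (φ : smoothVectors k σ) : translate 1 φ = φ :=
  smoothVectors_ext (by
    rw [toFun_translate]
    ext g
    rw [rightTranslate, mul_one])

/-- Right translation by `h` as a linear equivalence of the space of smooth vectors. -/
def translateEquiv (h : G) : smoothVectors k σ ≃ₗ[ℂ] smoothVectors k σ where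
  toFun := translate h
  map_add' φ ψ := smoothVectors_ext (by
    rw [toFun_translate, Submodule.coe_add, Submodule.coe_add, IsSmooth.toFun_add φ.2 ψ.2,
      IsSmooth.toFun_add (translate h φ).2 (translate h ψ).2, toFun_translate, toFun_translate]
    rfl)
  map_smul' c φ := smoothVectors_ext (by
    rw [toFun_translate, Submodule.coe_smul, RingHom.id_apply, Submodule.coe_smul, toFun_smul,
      toFun_smul, toFun_translate]
    rfl)
  invFun := translate h⁻¹
  left_inv φ := by rw [← translate_mul, inv_mul_cancel, translate_one]
  right_inv φ := by rw [← translate_mul, mul_inv_cancel, translate_one]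

open Classical in
theorem isSmooth_single (p : Weight k σ) (v : Line k σ p) : IsSmooth (lp.single 2 p v : D k σ) := by
  intro N
  refine ⟨‖v.val‖ * |((p : ℤ) : ℝ)| ^ N, fun q => ?_⟩
  rcases eq_or_ne q p with rfl | hq
  · have : coeff (lp.single 2 q v : D k σ) q = v.val :=
      congrArg Line.val (lp.single_apply_self 2 q v)
    rw [this]
  · have : coeff (lp.single 2 p v : D k σ) q = 0 :=
      congrArg Line.val (lp.single_apply_ne 2 p v hq)
    rw [this, norm_zero, zero_mul]
    positivity

open Classical in
theorem denseRange_smoothVectors : DenseRange ((smoothVectors k σ).subtype : _ → D k σ) := by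
  intro φ
  have h := lp.hasSum_single (p := 2) (by norm_num) φ
  refine mem_closure_of_tendsto h (Filter.Eventually.of_forall fun s => ?_)
  exact ⟨⟨_, Submodule.sum_mem (smoothVectors k σ) fun p _ => isSmooth_single p (φ p)⟩, rfl⟩

/-- The unitary operator on the discrete series that extends right translation by `h`. -/
def translateIsometry (h : G) : D k σ ≃ₗᵢ[ℂ] D k σ :=
  (translateEquiv h).extendOfIsometry (smoothVectors k σ).subtype (smoothVectors k σ).subtype
    denseRange_smoothVectors denseRange_smoothVectors
    fun φ => norm_eq_of_rightTranslate h φ.2 (translate h φ).2 (toFun_translate h φ)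

theorem translateIsometry_coe (h : G) (φ : smoothVectors k σ) :
    translateIsometry h (φ : D k σ) = translate h φ :=
  LinearEquiv.extendOfIsometry_eq _ _ _ _ _ _ φ

/-- The unitary representation of `G` in the discrete series. -/
def translateRep (k : ℕ) [NeZero k] (σ : ℤˣ) : G →* (D k σ ≃ₗᵢ[ℂ] D k σ) where
  toFun := translateIsometry
  map_one' := by
    refine LinearIsometryEquiv.ext fun φ => congrFun
      ((denseRange_smoothVectors (k := k) (σ := σ)).equalizer
        (translateIsometry (k := k) (σ := σ) 1).continuous continuous_id
        (funext fun φ => ?_)) φ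
    exact (translateIsometry_coe 1 φ).trans (congrArg Subtype.val (translate_one φ))
  map_mul' g h := by
    refine LinearIsometryEquiv.ext fun φ => congrFun
      ((denseRange_smoothVectors (k := k) (σ := σ)).equalizer
        (translateIsometry (k := k) (σ := σ) (g * h)).continuous
        ((translateIsometry (k := k) (σ := σ) g).continuous.comp
          (translateIsometry (k := k) (σ := σ) h).continuous)
        (funext fun φ => ?_)) φ
    refine (translateIsometry_coe (g * h) φ).trans ?_
    rw [translate_mul, ← translateIsometry_coe, ← translateIsometry_coe]
    rfl

theorem translateRep_apply {φ : D k σ} (hφ : IsSmooth φ) (h : G) :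
    IsSmooth (translateRep k σ h φ) ∧
      toFun (translateRep k σ h φ) = rightTranslate h (toFun φ) := by
  have h1 : translateRep k σ h φ = translate h ⟨φ, hφ⟩ := translateIsometry_coe h ⟨φ, hφ⟩
  rw [h1]
  exact ⟨(translate h ⟨φ, hφ⟩).2, toFun_translate h ⟨φ, hφ⟩⟩

/-- The coefficient is an integral over rotations of a function jointly continuous in the angle and
in `h`. -/
theorem IsSmooth.continuous_coeff_translateRep {φ : D k σ} (hφ : IsSmooth φ) (p : Weight k σ) :
    Continuous fun h : G => coeff (translateRep k σ h φ) p := by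
  have h1 : ∀ h : G, coeff (translateRep k σ h φ) p = (2 * Real.pi : ℂ)⁻¹ *
      ∫ θ in (0 : ℝ)..(2 * Real.pi),
        toFun φ (rot θ * h) * Complex.exp (2 * (-(p : ℤ) : ℤ) * θ * Complex.I) := by
    intro h
    obtain ⟨hs, hf⟩ := translateRep_apply hφ h
    have h2 := hs.integral_toFun_rot p
    rw [hf] at h2
    have : (2 * Real.pi : ℂ) ≠ 0 := by simp [Real.pi_ne_zero]
    rw [eq_inv_mul_iff_mul_eq₀ this, ← h2]
    rfl
  simp only [h1]
  refine continuous_const.mul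
    (intervalIntegral.continuous_parametric_intervalIntegral_of_continuous'
    ?_ _ _)
  have h3 := hφ.continuous_toFun
  have h4 := continuous_rot
  simp only [Function.uncurry_def]
  fun_prop

-- For unitary operators strong continuity follows from a diagonal matrix coefficient: with `ω` the
-- representation, `‖ω(h)b - ω(h₀)b‖² = 2‖b‖² - 2 Re ⟨ω(h₀⁻¹h)b, b⟩`. For `b` in the line of `φ_p`
-- this coefficient involves only the `p`-th coordinate.
open Classical in
theorem continuous_translateRep_single (p : Weight k σ) (v : Line k σ p) :
    Continuous fun h : G => translateRep k σ h (lp.single 2 p v) := by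
  set b : D k σ := lp.single 2 p v with hb
  have hF : Continuous fun h : G => RCLike.re (inner ℂ (translateRep k σ h b) b : ℂ) := by
    have h1 : ∀ h : G, (inner ℂ (translateRep k σ h b) b : ℂ) = (normSqPhi k p : ℂ) *
        (starRingEnd ℂ (coeff (translateRep k σ h b) p) * v.val) := by
      intro h
      rw [hb, lp.inner_single_right]
      rfl
    simp only [h1]
    have h2 := (isSmooth_single p v).continuous_coeff_translateRep p
    exact RCLike.continuous_re.comp (continuous_const.mul
      ((Complex.continuous_conj.comp h2).mul continuous_const))
  rw [continuous_iff_continuousAt]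
  intro h₀
  have h3 : ∀ h : G, ‖translateRep k σ h b - translateRep k σ h₀ b‖ ^ 2 =
      2 * ‖b‖ ^ 2 - 2 * RCLike.re (inner ℂ (translateRep k σ (h₀⁻¹ * h) b) b : ℂ) := by
    intro h
    have e1 : translateRep k σ h b = translateRep k σ h₀ (translateRep k σ (h₀⁻¹ * h) b) := by
      conv_lhs => rw [← mul_inv_cancel_left h₀ h, map_mul]
      rfl
    rw [e1, ← map_sub, LinearIsometryEquiv.norm_map, @norm_sub_sq ℂ, LinearIsometryEquiv.norm_map]
    ring
  have h4 : Filter.Tendsto (fun h : G => ‖translateRep k σ h b - translateRep k σ h₀ b‖ ^ 2)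
      (nhds h₀) (nhds 0) := by
    have h5 : Continuous fun h : G => ‖translateRep k σ h b - translateRep k σ h₀ b‖ ^ 2 := by
      simp only [h3]
      exact continuous_const.sub
        (continuous_const.mul (hF.comp (continuous_const.mul continuous_id)))
    simpa using h5.tendsto h₀
  rw [ContinuousAt, tendsto_iff_norm_sub_tendsto_zero]
  have := h4.sqrt
  simpa [Real.sqrt_sq] using this

open Classical in
/-- The representation of `G` in the discrete series is strongly continuous. -/
theorem continuous_translateRep (φ : D k σ) : Continuous fun h : G => translateRep k σ h φ := by
  have hs := lp.hasSum_single (p := 2) (by norm_num) φ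
  have hu : TendstoUniformly (fun (s : Finset (Weight k σ)) (h : G) =>
      translateRep k σ h (∑ p ∈ s, lp.single 2 p (φ p))) (fun h => translateRep k σ h φ)
      Filter.atTop := by
    rw [Metric.tendstoUniformly_iff]
    intro ε hε
    filter_upwards [Metric.tendsto_nhds.1 hs ε hε] with s h1 h
    -- Isometry makes the approximation by finite sums uniform in `h`.
    rw [LinearIsometryEquiv.dist_map, dist_comm]
    exact h1
  refine hu.continuous (Filter.Frequently.of_forall fun s => ?_)
  simp only [map_sum]
  exact continuous_finsetSum s fun p _ => continuous_translateRep_single p (φ p)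

/-- Conjugation of a unitary representation by a unitary map. -/
def conjRep {H K : Type*} [NormedAddCommGroup H] [InnerProductSpace ℂ H] [NormedAddCommGroup K]
    [InnerProductSpace ℂ K] (U : H ≃ₗᵢ[ℂ] K) (ω : G →* (H ≃ₗᵢ[ℂ] H)) : G →* (K ≃ₗᵢ[ℂ] K) where
  toFun h := (U.symm.trans (ω h)).trans U
  map_one' := by
    ext f
    simp
  map_mul' g h := by
    ext f
    simp

/-! ### The involution -/

/-- The unitary map between two discrete series that preserves the coefficients. -/
def transfer (k : ℕ) [NeZero k] (σ τ : ℤˣ) : D k σ ≃ₗᵢ[ℂ] D k τ where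
  toFun φ := ofSeq τ (seq φ) (hasSum_norm_sq φ).summable
  map_add' φ ψ := D.ext_seq fun n => by
    rw [seq_add, seq_ofSeq, seq_ofSeq, seq_ofSeq, seq_add]
  map_smul' c φ := D.ext_seq fun n => by
    rw [RingHom.id_apply, seq_smul, seq_ofSeq, seq_ofSeq, seq_smul]
  invFun φ := ofSeq σ (seq φ) (hasSum_norm_sq φ).summable
  left_inv φ := D.ext_seq fun n => by rw [seq_ofSeq, seq_ofSeq]
  right_inv φ := D.ext_seq fun n => by rw [seq_ofSeq, seq_ofSeq]
  norm_map' φ := by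
    rw [← sq_eq_sq₀ (norm_nonneg _) (norm_nonneg _)]
    refine (hasSum_norm_sq _).unique (hasSum_of_eq (hasSum_norm_sq φ) fun n => ?_)
    change _ * ‖seq (ofSeq τ (seq φ) (hasSum_norm_sq φ).summable) n‖ ^ 2 = _
    rw [seq_ofSeq]

theorem seq_transfer (τ : ℤˣ) (φ : D k σ) : seq (transfer k σ τ φ) = seq φ :=
  seq_ofSeq (seq φ) (hasSum_norm_sq φ).summable

/-- The involution changes the sign of `c`, which in `ζ = d + σ i c` amounts to changing `σ`; the
power series stays the same. -/
theorem toFun_transfer_neg (φ : D k σ) :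
    toFun (transfer k σ (-σ) φ) = toFun φ ∘ involution := by
  refine funext fun g => ?_
  obtain ⟨g, rfl⟩ := QuotientGroup.mk_surjective g
  have e1 : (toFun φ ∘ involution) (QuotientGroup.mk g) =
    toFun φ (QuotientGroup.mk (involutionSL g)) := rfl
  have hz : zetaSL σ (involutionSL g) = zetaSL (-σ) g := by
    have h1 : (involutionSL g) 1 0 = -g 1 0 := rfl
    have h2 : (involutionSL g) 1 1 = g 1 1 := rfl
    rw [zetaSL, zetaSL, h1, h2]
    push_cast
    ring
  rw [e1, toFun_mk, toFun_mk, hz, seq_transfer]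

/-- For fixed coefficients the transform depends only on `|u|` and `σ u`. -/
theorem kirillov_transfer_neg (φ : D k σ) (u : ℝ) :
    kirillov (toFun (transfer k σ (-σ) φ)) u = kirillov (toFun φ) (-u) := by
  rcases eq_or_ne u 0 with rfl | hu
  · rw [neg_zero, kirillov_zero, kirillov_zero]
  · rw [kirillov_toFun _ hu, kirillov_toFun _ (neg_ne_zero.2 hu), seq_transfer, abs_neg]
    congr 2
    push_cast
    rw [neg_mul, mul_neg]

end

end Kirillov

theorem lemma6p3 (k : ℕ) [NeZero k] (σ : ℤˣ) :
    -- the series of a smooth vector and the integrals defining its Jacquet transforms converge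
    -- absolutely, and its Kirillov transform lives on the half-line of sign `σ`
    (∀ φ : D k σ, IsSmooth φ →
      (∀ g : G, Summable (term φ g)) ∧
      (∀ (δ : ℝ) (g : G), MeasureTheory.Integrable (jacquetIntegrand δ (toFun φ) g)) ∧
      (∀ u : ℝ, ((σ : ℤ) : ℝ) * u < 0 → kirillov (toFun φ) u = 0)) ∧
    -- the operator `K` is unitary, and intertwines unitary representations of `G`
    (∃ (U : D k σ ≃ₗᵢ[ℂ] L2Half σ) (ω : G →* (D k σ ≃ₗᵢ[ℂ] D k σ))
        (R : G →* (L2Half σ ≃ₗᵢ[ℂ] L2Half σ)),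
      (∀ φ : D k σ, IsSmooth φ → U φ =ᵐ[halfMeasure σ] kirillov (toFun φ)) ∧
      (∀ φ : D k σ, IsSmooth φ → ∀ h : G,
        IsSmooth (ω h φ) ∧ toFun (ω h φ) = rightTranslate h (toFun φ)) ∧
      (∀ (h : G) (f : L2Half σ), R h f = U (ω h (U.symm f))) ∧
      (∀ φ : D k σ, Continuous fun h : G => ω h φ) ∧
      (∀ f : L2Half σ, Continuous fun h : G => R h f)) ∧
    -- the actions of `n[x]`, `a[y]` and `w`
    (∀ φ : D k σ, IsSmooth φ → ∀ u : ℝ, u ≠ 0 →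
      (∀ x : ℝ, kirillov (rightTranslate (n x) (toFun φ)) u
        = e (u * x) * kirillov (toFun φ) u) ∧
      (∀ (y : ℝ) (hy : 0 < y), kirillov (rightTranslate (a y hy) (toFun φ)) u
        = kirillov (toFun φ) (u * y)) ∧
      MeasureTheory.IntegrableOn
        (fun t : ℝ => (repBessel ((k : ℝ) - 1 / 2) (u * t) : ℂ) * kirillov (toFun φ) t)
        {0}ᶜ mulMeasure ∧
      kirillov (rightTranslate w (toFun φ)) u
        = ∫ t in ({0}ᶜ : Set ℝ),
            (repBessel ((k : ℝ) - 1 / 2) (u * t) : ℂ) * kirillov (toFun φ) t ∂mulMeasure) ∧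
    -- the kernel
    (∀ u : ℝ, u ≠ 0 → repBessel ((k : ℝ) - 1 / 2) u
      = if 0 < u then 2 * Real.pi * (-1) ^ k * √u * besselJ (2 * k - 1) (4 * Real.pi * √u)
        else 0) ∧
    -- the involution carries the series of sign `σ` to the one of sign `-σ`
    (∃ J : D k σ ≃ₗᵢ[ℂ] D k (-σ), ∀ φ : D k σ, IsSmooth φ →
      IsSmooth (J φ) ∧ toFun (J φ) = toFun φ ∘ involution ∧
      ∀ u : ℝ, kirillov (toFun (J φ)) u = kirillov (toFun φ) (-u)) := by
  refine ⟨fun φ hφ => ⟨hφ.summable_term, hφ.integrable_jacquetIntegrand,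
    fun u hu => hφ.kirillov_eq_zero hu.le⟩, ?_, ?_, ?_, ?_⟩
  · exact ⟨kirillovEquiv k σ, translateRep k σ, conjRep (kirillovEquiv k σ) (translateRep k σ),
      fun φ hφ => hφ.kirillovEquiv_ae, fun φ hφ h => translateRep_apply hφ h, fun h f => rfl,
      continuous_translateRep, fun f => (kirillovEquiv k σ).continuous.comp
        (continuous_translateRep ((kirillovEquiv k σ).symm f))⟩
  · intro φ hφ u hu
    exact ⟨kirillov_rightTranslate_n _ hu, fun y hy => kirillov_rightTranslate_a _ hu hy,
      hφ.kirillov_rightTranslate_w hu⟩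
  · exact fun u _ => repBessel_half_integer k u
  · refine ⟨transfer k σ (-σ), fun φ hφ => ⟨?_, toFun_transfer_neg φ, kirillov_transfer_neg φ⟩⟩
    rw [isSmooth_iff, seq_transfer]
    exact isSmooth_iff.1 hφ
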